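/- **Definitions.** A (finite) hypergraph $G$ consists of a finite nonempty vertex set $V(G)$ and a set $E(G)$ of nonempty subsets of $V(G)$; it is $k$-uniform if every edge has exactly $k$ vertices, and its size is $|E(G)|$. The degree of a vertex is the number of edges containing it. A walk of length $p$ is a sequence $(v_0,e_1,v_1,\dots,e_p,v_p)$ with $v_{i-1},v_i\in e_i\in E(G)$ and $v_{i-1}\ne v_i$; it is a path if all $v_i$ and all $e_i$ are distinct, and a cycle if $p\ge 2$, $v_0=v_p$, and all $e_i$ and $v_1,\dots,v_p$ are distinct. A hypertree is a connected hypergraph without cycles. The distance $d_G(u,v)$ is the length of a shortest path from $u$ to $v$, and the distance spectral radius $\rho(G)$ is the largest eigenvalue of the distance matrix $(d_G(u,v))_{u,v\in V(G)}$. Let $\mathbb{T}_k(m,\Delta,n)$ be the class of $k$-uniform hypertrees with $m$ edges and maximum degree $\Delta$ that have exactly $n$ vertices of degree $\Delta$. Let $C_k(m,\Delta,a,b)$ be the $k$-uniform caterpillar obtained from the $k$-uniform loose path with $m$ edges $e_1,\dots,e_m$ and vertices $u_0,\dots,u_m$ (where $u_{i-1},u_i\in e_i$, and every further vertex lies in only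 one edge) by attaching $\Delta-2$ new pendant edges, each consisting of $u_i$ and $k-1$ new vertices, at $u_i$ for every $i$ with $0<i<m$ and ($i\le a$ or $i\ge m-b$). **Theorem.** Let $k\ge 2$, $\Delta\ge 3$, $n\ge 2$ and $m$ be integers such that $\mathbb{T}_k(m,\Delta,n)$ is nonempty, let $m^*=m-n(\Delta-2)$ and $C=C_k(m^*,\Delta,\lfloor n/2\rfloor,\lceil n/2\rceil)$. Then $C\in\mathbb{T}_k(m,\Delta,n)$, and every $T\in\mathbb{T}_k(m,\Delta,n)$ satisfies $\rho(T)\le\rho(C)$, with equality if and only if $T$ is isomorphic to $C$. In other words, $C$ is, up to isomorphism, the unique hypertree in $\mathbb{T}_k(m,\Delta,n)$ with maximum distance spectral radius. -/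

import Mathlib

namespace Hypergraph

/-- `G` is `k`-uniform: every edge has exactly `k` vertices. -/
def IsUniform {α : Type*} (G : Hypergraph α) (k : ℕ) : Prop :=
  ∀ e ∈ G.edgeSet, e.ncard = k

/-- The degree of `v`: the number of edges containing `v`. -/
noncomputable def degree {α : Type*} (G : Hypergraph α) (v : α) : ℕ :=
  {e | e ∈ G.edgeSet ∧ v ∈ e}.ncard

/-- `(v 0, e 0, v 1, e 1, …, e (p - 1), v p)` is a walk of length `p` in `G`. -/
structure IsWalk {α : Type*} (G : Hypergraph α) {p : ℕ}
    (v : Fin (p + 1) → α) (e : Fin p → Set α) : Prop where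
  vertex_mem : ∀ i, v i ∈ G.vertexSet
  edge_mem : ∀ i, e i ∈ G.edgeSet
  left_mem : ∀ i : Fin p, v i.castSucc ∈ e i
  right_mem : ∀ i : Fin p, v i.succ ∈ e i
  ne : ∀ i : Fin p, v i.castSucc ≠ v i.succ

/-- A path is a walk whose vertices and edges are pairwise distinct. -/
structure IsPath {α : Type*} (G : Hypergraph α) {p : ℕ}
    (v : Fin (p + 1) → α) (e : Fin p → Set α) : Prop extends IsWalk G v e where
  vertex_inj : Function.Injective v
  edge_inj : Function.Injective e

/-- A cycle is a closed walk with at least two edges, whose edges are pairwise distinct and whose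
vertices `v 0, …, v (p - 1)` are pairwise distinct. -/
structure IsCycle {α : Type*} (G : Hypergraph α) {p : ℕ}
    (v : Fin (p + 1) → α) (e : Fin p → Set α) : Prop extends IsWalk G v e where
  two_le : 2 ≤ p
  closed : v 0 = v (Fin.last p)
  vertex_inj : Function.Injective (fun i : Fin p => v i.castSucc)
  edge_inj : Function.Injective e

/-- There is a path of length `p` from `x` to `y` in `G`. -/
def HasPath {α : Type*} (G : Hypergraph α) (x y : α) (p : ℕ) : Prop :=
  ∃ (v : Fin (p + 1) → α) (e : Fin p → Set α),
    G.IsPath v e ∧ v 0 = x ∧ v (Fin.last p) = y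

/-- A hypertree: a connected hypergraph (with nonempty vertex set and nonempty edges)
without cycles. -/
structure IsHypertree {α : Type*} (G : Hypergraph α) : Prop where
  nonempty : G.vertexSet.Nonempty
  edge_nonempty : ∀ e ∈ G.edgeSet, e.Nonempty
  connected : ∀ x ∈ G.vertexSet, ∀ y ∈ G.vertexSet, ∃ p, G.HasPath x y p
  acyclic : ∀ (p : ℕ) (v : Fin (p + 1) → α) (e : Fin p → Set α), ¬ G.IsCycle v e

/-- The distance between `x` and `y`: the length of a shortest path from `x` to `y`. -/
noncomputable def dist {α : Type*} (G : Hypergraph α) (x y : α) : ℕ :=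
  sInf {p | G.HasPath x y p}

/-- The distance matrix of `G`, indexed by the vertices of `G`. -/
noncomputable def distMatrix {α : Type*} (G : Hypergraph α) :
    Matrix G.vertexSet G.vertexSet ℝ :=
  fun x y => (G.dist x y : ℝ)

open Classical in
/-- The distance spectral radius of a finite hypergraph: the largest (real) eigenvalue of its
distance matrix. -/
noncomputable def distSpectralRadius {α : Type*} (G : Hypergraph α) [Finite G.vertexSet] : ℝ :=
  letI : Fintype G.vertexSet := Fintype.ofFinite _
  sSup {μ : ℝ | Module.End.HasEigenvalue (Matrix.toLin' G.distMatrix) μ}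

/-- `G` and `H` are isomorphic: some bijection between their vertex sets maps edges to edges
and non-edges to non-edges. -/
def Isomorphic {α β : Type*} (G : Hypergraph α) (H : Hypergraph β) : Prop :=
  ∃ f : G.vertexSet ≃ H.vertexSet, ∀ s : Set G.vertexSet,
    Subtype.val '' s ∈ G.edgeSet ↔ Subtype.val '' (f '' s) ∈ H.edgeSet

/-- The class `𝕋_k(m, Δ, n)`: `k`-uniform hypertrees with `m` edges, of maximum degree `Δ`,
having exactly `n` vertices of degree `Δ`. -/
structure MemClass {α : Type*} (G : Hypergraph α) (k m Δ n : ℕ) : Prop where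
  finite : G.vertexSet.Finite
  isHypertree : G.IsHypertree
  isUniform : G.IsUniform k
  size : G.edgeSet.ncard = m
  maxDegree : IsGreatest (G.degree '' G.vertexSet) Δ
  card_maxDegree : {v | v ∈ G.vertexSet ∧ G.degree v = Δ}.ncard = n

/-- The positions `i` on the loose path `u_0, …, u_m` at which a star is attached in
`C_k(m, Δ, a, b)`: all `i` except `i = 0`, `i = m` and those with `a < i < m - b`. -/
def IsStarIndex (m a b : ℕ) (i : Fin (m + 1)) : Prop :=
  ¬ (i.val = 0 ∨ i.val = m ∨ (a < i.val ∧ i.val + b < m))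

/-- The vertices of `C_k(m, Δ, a, b)`: the vertices `u_0, …, u_m` of the loose path, the `k - 2`
further vertices of each of the `m` edges of the path, and, at each position carrying a star,
the `k - 1` pendant vertices of each of the `Δ - 2` edges of the star. -/
abbrev CaterpillarVertex (k m Δ a b : ℕ) : Type :=
  Fin (m + 1) ⊕ (Fin m × Fin (k - 2)) ⊕
    ({i : Fin (m + 1) // IsStarIndex m a b i} × Fin (Δ - 2) × Fin (k - 1))

/-- The edge of the loose path joining `u_i` and `u_{i+1}`. -/
def caterpillarPathEdge (k m Δ a b : ℕ) (i : Fin m) : Set (CaterpillarVertex k m Δ a b) :=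
  {Sum.inl i.castSucc, Sum.inl i.succ} ∪
    Set.range (fun j : Fin (k - 2) => Sum.inr (Sum.inl (i, j)))

/-- The `l`-th pendant edge of the star with centre `u_i`. -/
def caterpillarStarEdge (k m Δ a b : ℕ) (i : {i : Fin (m + 1) // IsStarIndex m a b i})
    (l : Fin (Δ - 2)) : Set (CaterpillarVertex k m Δ a b) :=
  {Sum.inl i.val} ∪ Set.range (fun j : Fin (k - 1) => Sum.inr (Sum.inr (i, l, j)))

/-- The caterpillar `C_k(m, Δ, a, b)`: the `k`-uniform loose path with `m` edges, at whose
vertices `u_i`, for `1 ≤ i ≤ a` and `m - b ≤ i ≤ m - 1`, the centre of a `k`-uniform hyperstar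
with `Δ - 2` edges is attached. -/
def caterpillar (k m Δ a b : ℕ) : Hypergraph (CaterpillarVertex k m Δ a b) where
  vertexSet := Set.univ
  edgeSet := Set.range (caterpillarPathEdge k m Δ a b) ∪
    {e | ∃ i l, e = caterpillarStarEdge k m Δ a b i l}
  subset_vertexSet_of_mem_edgeSet' := fun _ _ => Set.subset_univ _

end Hypergraph

/-!
A hypertree with `m` edges of size `k` is, combinatorially, a connected `k`-uniform family of `m`
sets on `1 + (k - 1) * m` vertices. On a fixed vertex set there are finitely many such families, so
some family `E` in the class has the largest distance spectral radius; everything is deduced from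
the shape of such a maximizer (`Hypertree.IsMaximizer`), which turns out to be the caterpillar.

The tool for all but the last step is an exchange of branches. If edges `F₁` at `u` and `F₂` at `v`
lead away from each other and trade places, then the distances change, up to an inequality in the
favourable direction, by the symmetric matrix `s rᵀ + r sᵀ`, where `s` is `1` on the branches
leaving `u` and `-1` on those leaving `v`, and `r w = d(v, w) - d(u, w)` on the vertices that stay
(`Exchangeable.le_edist`). The Rayleigh quotient at the Perron vector `x` of `E` increases if
`⟨s, x⟩ * ⟨r, x⟩ > 0` (`rho_lt_of_gain`). Choosing the branches according to their Perron mass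
excludes, in a maximizer, degrees other than `1`, `2`, `Δ` (`IsMaximizer.deg_le_two`), a vertex with
three edges each leading to a further vertex of degree at least two
(`IsMaximizer.no_three_branches`), and an edge with three vertices of degree at least two
(`IsMaximizer.no_three_in_edge`). Hence the vertices of degree at least two are the inner vertices
of a diametral path, the spine (`IsMaximizer.exists_spine`), and all other edges are pendant edges
at vertices of degree `Δ`. A vertex of degree `Δ` between two inner vertices of degree two is
excluded in the same way (`Spine.not_between`), so the stars form two groups at the two ends of the
spine, of sizes `a` and `b`.

It remains to see that `a` and `b` differ by at most one (`Spine.balanced`), and here the Perron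
vector of `E` alone does not decide. If `a + 2 ≤ b`, let `p = a + 1`, let `q` be the position of the
innermost star of the larger group, and let `E'` be obtained by moving that star from `q` to `p`.
With Perron vectors `x` and `x'` of `E` and `E'`, one has
`(ρ' - ρ) ⟨x, x'⟩ ≥ X ρ' (x'_p - x'_q) + X' ρ (x_p - x_q)`, where `X` and `X'` are the masses of the
star (`Spine.le_rho_move_sub_mul`). Reflect the spine at the midpoint of `p` and `q`, and put
`Y_i = ρ (x_i - x_{p+q-i})`, and `Y'_i` accordingly. The eigenvalue equations give second order
recursions for `Y` and `Y'` with nonnegative coefficients; at `p`, the first has the source `-2 X`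
and the second `2 X'`, and these cancel in `X Y' + X' Y`. If `ρ' ≤ ρ`, a discrete maximum principle
(`pos_of_antisymmetric`, `pos_of_reflected`) shows that this combination is positive at `p`, so that
`ρ' > ρ` after all, against the choice of `E`.

So every maximizer is a copy of the caterpillar (`IsMaximizer.exists_represents`). Together with the
dictionary between hypergraphs and families of edges (`Represents`), this gives the membership of
the caterpillar in the class, the inequality, and the case of equality.
-/

set_option linter.unusedSectionVars false

namespace Hypertree

open Matrix

/-! ### The largest eigenvalue of a nonnegative symmetric matrix -/

/-- The largest real eigenvalue of a square real matrix. -/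
noncomputable def topEigenvalue {V : Type*} [Fintype V] [DecidableEq V] (D : Matrix V V ℝ) : ℝ :=
  sSup {μ : ℝ | Module.End.HasEigenvalue (Matrix.toLin' D) μ}

lemma hasEigenvalue_toLin'_iff {V : Type*} [Fintype V] [DecidableEq V] (D : Matrix V V ℝ) (μ : ℝ) :
    Module.End.HasEigenvalue (Matrix.toLin' D) μ ↔ ∃ x : V → ℝ, x ≠ 0 ∧ D *ᵥ x = μ • x := by
  constructor
  · intro h
    obtain ⟨x, hx⟩ := h.exists_hasEigenvector
    exact ⟨x, hx.2, by simpa using hx.apply_eq_smul⟩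
  · rintro ⟨x, hx, h⟩
    exact Module.End.hasEigenvalue_of_hasEigenvector
      ⟨Module.End.mem_eigenspace_iff.2 (by simpa using h), hx⟩

lemma topEigenvalue_reindex {V W : Type*} [Fintype V] [DecidableEq V] [Fintype W] [DecidableEq W]
    (e : V ≃ W) (D : Matrix V V ℝ) (D' : Matrix W W ℝ) (h : ∀ u v, D' (e u) (e v) = D u v) :
    topEigenvalue D' = topEigenvalue D := by
  unfold topEigenvalue
  congr 1
  ext μ
  simp only [Set.mem_ofPred_eq, hasEigenvalue_toLin'_iff]
  have hmul : ∀ (x : W → ℝ) (v : V), (D' *ᵥ x) (e v) = (D *ᵥ (x ∘ e)) v := by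
    intro x v
    simp only [mulVec, dotProduct, Function.comp]
    rw [← e.sum_comp]
    simp [h]
  constructor
  · rintro ⟨x, hx, hD⟩
    refine ⟨x ∘ e, fun h0 => hx ?_, ?_⟩
    · ext w
      simpa using congrFun h0 (e.symm w)
    · ext v
      rw [← hmul, hD]
      simp
  · rintro ⟨x, hx, hD⟩
    refine ⟨x ∘ e.symm, fun h0 => hx ?_, ?_⟩
    · ext v
      simpa using congrFun h0 (e v)
    · ext w
      obtain ⟨v, rfl⟩ := e.surjective w
      rw [hmul]
      have : (x ∘ e.symm) ∘ e = x := by ext; simp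
      rw [this, hD]
      simp

/-- Perron's theorem for symmetric matrices with zero diagonal and positive off-diagonal entries:
the largest eigenvalue is positive, has a positive eigenvector, and is the maximum of the
Rayleigh quotient. -/
theorem exists_perron {V : Type*} [Fintype V] [DecidableEq V] [Nontrivial V] (D : Matrix V V ℝ)
    (hsymm : ∀ u v, D u v = D v u) (hdiag : ∀ u, D u u = 0) (hpos : ∀ u v, u ≠ v → 0 < D u v) :
    0 < topEigenvalue D ∧
    (∀ y : V → ℝ, y ⬝ᵥ D *ᵥ y ≤ topEigenvalue D * (y ⬝ᵥ y)) ∧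
    ∃ x : V → ℝ, (∀ v, 0 < x v) ∧ D *ᵥ x = topEigenvalue D • x := by
  have hnn : ∀ u v, 0 ≤ D u v := by
    intro u v
    by_cases h : u = v
    · rw [h, hdiag]
    · exact (hpos u v h).le
  have hsq : ∀ y : V → ℝ, y ⬝ᵥ y = ∑ v, y v ^ 2 := fun y => by
    simp [dotProduct, sq]
  have hcomp : IsCompact {y : V → ℝ | y ⬝ᵥ y = 1} := by
    refine Metric.isCompact_of_isClosed_isBounded ?_ ?_
    · exact isClosed_eq (by unfold dotProduct; fun_prop) continuous_const
    · refine (Metric.isBounded_closedBall (x := (0 : V → ℝ)) (r := 1)).subset ?_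
      intro y hy
      simp only [Set.mem_ofPred_eq, hsq] at hy
      rw [mem_closedBall_zero_iff, pi_norm_le_iff_of_nonneg zero_le_one]
      intro v
      have : y v ^ 2 ≤ 1 := by
        rw [← hy]
        exact Finset.single_le_sum (f := fun v => y v ^ 2) (fun _ _ => sq_nonneg _)
          (Finset.mem_univ v)
      rw [Real.norm_eq_abs]
      exact abs_le_one_iff_mul_self_le_one.2 (by nlinarith)
  obtain ⟨v0⟩ := (inferInstance : Nonempty V)
  have hne : {y : V → ℝ | y ⬝ᵥ y = 1}.Nonempty := ⟨Pi.single v0 1, by simp⟩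
  obtain ⟨y0, hy0, hmax⟩ := hcomp.exists_isMaxOn hne
    (f := fun y => y ⬝ᵥ D *ᵥ y) (by unfold dotProduct mulVec dotProduct; fun_prop)
  set r := y0 ⬝ᵥ D *ᵥ y0 with hr
  have hy0' : y0 ⬝ᵥ y0 = 1 := hy0
  have hray : ∀ y : V → ℝ, y ⬝ᵥ D *ᵥ y ≤ r * (y ⬝ᵥ y) := by
    intro y
    have h0 : 0 ≤ y ⬝ᵥ y := by rw [hsq]; positivity
    rcases h0.eq_or_lt with h | h
    · have : y = 0 := dotProduct_self_eq_zero.1 h.symm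
      simp [this]
    · set c := (Real.sqrt (y ⬝ᵥ y))⁻¹ with hc
      have hcc : c * c * (y ⬝ᵥ y) = 1 := by
        rw [hc, ← mul_inv, Real.mul_self_sqrt h0, inv_mul_cancel₀ h.ne']
      have h1 : (c • y) ⬝ᵥ (c • y) = 1 := by
        simp only [smul_dotProduct, dotProduct_smul, smul_eq_mul]
        linarith
      have h2 : (c • y) ⬝ᵥ D *ᵥ (c • y) ≤ r := hmax h1
      simp only [smul_dotProduct, dotProduct_smul, mulVec_smul, smul_eq_mul] at h2
      calc y ⬝ᵥ D *ᵥ y = (c * (c * (y ⬝ᵥ D *ᵥ y))) * (y ⬝ᵥ y) := by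
            linear_combination (-(y ⬝ᵥ D *ᵥ y)) * hcc
        _ ≤ r * (y ⬝ᵥ y) := by gcongr
  set x : V → ℝ := fun v => |y0 v| with hx
  have hxx : x ⬝ᵥ x = 1 := by
    rw [← hy0', hsq, hsq]
    simp [hx]
  have hxD : r ≤ x ⬝ᵥ D *ᵥ x := by
    rw [hr]
    simp only [dotProduct, mulVec, Finset.mul_sum]
    refine Finset.sum_le_sum fun u _ => Finset.sum_le_sum fun v _ => ?_
    have : y0 u * y0 v ≤ x u * x v := by
      simp only [hx]
      rw [← abs_mul]
      exact le_abs_self _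
    nlinarith [hnn u v]
  have hpsd : (r • (1 : Matrix V V ℝ) - D).PosSemidef := by
    refine Matrix.PosSemidef.of_dotProduct_mulVec_nonneg ?_ ?_
    · ext u v
      simp [hsymm u v, one_apply, eq_comm]
    · intro y
      simp only [star_trivial, sub_mulVec, smul_mulVec, one_mulVec, dotProduct_sub,
        dotProduct_smul, smul_eq_mul]
      linarith [hray y]
  have hker : (r • (1 : Matrix V V ℝ) - D) *ᵥ x = 0 := by
    refine (hpsd.dotProduct_mulVec_zero_iff x).1 ?_
    simp only [star_trivial, sub_mulVec, smul_mulVec, one_mulVec, dotProduct_sub,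
      dotProduct_smul, smul_eq_mul]
    have h := hray x
    rw [hxx] at h ⊢
    linarith
  have heig : D *ᵥ x = r • x := by
    simp only [sub_mulVec, smul_mulVec, one_mulVec] at hker
    exact (sub_eq_zero.1 hker).symm
  have hxnn : ∀ v, 0 ≤ x v := fun v => abs_nonneg _
  have hxpos : ∀ v, 0 < x v := by
    intro v
    refine lt_of_le_of_ne (hxnn v) fun h0 => ?_
    have h1 : (D *ᵥ x) v = 0 := by rw [heig]; simp [← h0]
    have h2 : ∀ w, D v w * x w = 0 := by
      intro w
      have := (Finset.sum_eq_zero_iff_of_nonneg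
        (fun w _ => mul_nonneg (hnn v w) (hxnn w))).1 h1 w (Finset.mem_univ w)
      exact this
    have h3 : x = 0 := by
      ext w
      by_cases hw : v = w
      · rw [← hw, ← h0]; rfl
      · exact (mul_eq_zero.1 (h2 w)).resolve_left (hpos v w hw).ne'
    rw [h3] at hxx
    simp at hxx
  have hrpos : 0 < r := by
    obtain ⟨w, hw⟩ := exists_ne v0
    have h1 : 0 < (D *ᵥ x) v0 := by
      refine lt_of_lt_of_le (mul_pos (hpos v0 w hw.symm) (hxpos w)) ?_
      exact Finset.single_le_sum (f := fun w => D v0 w * x w)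
        (fun w _ => mul_nonneg (hnn v0 w) (hxnn w)) (Finset.mem_univ w)
    rw [heig] at h1
    exact pos_of_mul_pos_left h1 (hxnn v0)
  have htop : topEigenvalue D = r := by
    refine IsGreatest.csSup_eq ⟨?_, ?_⟩
    · exact (hasEigenvalue_toLin'_iff D r).2 ⟨x, fun h => (hxpos v0).ne' (congrFun h v0), heig⟩
    · intro μ hμ
      obtain ⟨y, hy, hDy⟩ := (hasEigenvalue_toLin'_iff D μ).1 hμ
      have h1 := hray y
      rw [hDy, dotProduct_smul, smul_eq_mul] at h1
      have h2 : 0 < y ⬝ᵥ y := lt_of_le_of_ne (by rw [hsq]; positivity)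
        fun h => hy (dotProduct_self_eq_zero.1 h.symm)
      exact le_of_mul_le_mul_right h1 h2
  rw [htop]
  exact ⟨hrpos, hray, x, hxpos, heig⟩

/-! ### Uniform hypertrees as finite families of edges -/

variable {V : Type*} [Fintype V] [DecidableEq V]

/-- The 2-section of a family of edges: two distinct vertices are adjacent if some edge contains
both. -/
def twoSection (E : Finset (Finset V)) : SimpleGraph V where
  Adj u v := u ≠ v ∧ ∃ e ∈ E, u ∈ e ∧ v ∈ e
  symm := ⟨fun _ _ h => ⟨h.1.symm, h.2.imp fun _ he => ⟨he.1, he.2.2, he.2.1⟩⟩⟩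
  loopless := ⟨fun _ h => h.1 rfl⟩

/-- The distance between two vertices, as the distance in the 2-section. -/
noncomputable abbrev edist (E : Finset (Finset V)) (u v : V) : ℕ := (twoSection E).dist u v

/-- The number of edges containing `v`. -/
def deg (E : Finset (Finset V)) (v : V) : ℕ := (E.filter (v ∈ ·)).card

/-- The distance matrix of a family of edges. -/
noncomputable def distMat (E : Finset (Finset V)) : Matrix V V ℝ := fun u v => (edist E u v : ℝ)

/-- The `k`-uniform hypertrees on `V`, described as the connected `k`-uniform families for which
the number of vertices is the largest possible in terms of the number of edges. -/
structure IsTree (k : ℕ) (E : Finset (Finset V)) : Prop where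
  two_le : 2 ≤ k
  unif : ∀ e ∈ E, e.card = k
  conn : (twoSection E).Connected
  card_eq : Fintype.card V = 1 + (k - 1) * E.card

lemma edist_le_one {E : Finset (Finset V)} {e : Finset V} (he : e ∈ E) {y z : V} (hy : y ∈ e)
    (hz : z ∈ e) : edist E y z ≤ 1 := by
  by_cases h : y = z
  · simp [h]
  · exact (SimpleGraph.dist_eq_one_iff_adj.2 (show (twoSection E).Adj y z from
      ⟨h, e, he, hy, hz⟩)).le

lemma edist_eq_one {E : Finset (Finset V)} {e : Finset V} (he : e ∈ E) {y z : V} (hy : y ∈ e)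
    (hz : z ∈ e) (h : y ≠ z) : edist E y z = 1 :=
  SimpleGraph.dist_eq_one_iff_adj.2 (show (twoSection E).Adj y z from ⟨h, e, he, hy, hz⟩)

lemma edist_comm (E : Finset (Finset V)) (u v : V) : edist E u v = edist E v u :=
  SimpleGraph.dist_comm

/-- A function that varies by at most `1` on every edge varies by at most the distance. -/
lemma le_add_edist_of_lipschitz {E : Finset (Finset V)} (hE : (twoSection E).Connected)
    (φ : V → ℝ) (hφ : ∀ e ∈ E, ∀ y ∈ e, ∀ z ∈ e, φ y ≤ φ z + 1) (u v : V) :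
    φ v ≤ φ u + edist E u v := by
  obtain ⟨p, hp⟩ := hE.exists_walk_length_eq_dist u v
  rw [edist, ← hp]
  clear hp
  induction p with
  | nil => simp
  | cons h p ih =>
    obtain ⟨-, e, he, hu, hw⟩ := id h
    have := hφ e he _ hw _ hu
    rw [SimpleGraph.Walk.length_cons]
    push_cast
    linarith

section Connected

variable {E : Finset (Finset V)} (hE : (twoSection E).Connected)
include hE

lemma edist_triangle (u v w : V) : edist E u w ≤ edist E u v + edist E v w :=
  hE.dist_triangle

lemma edist_eq_zero {u v : V} : edist E u v = 0 ↔ u = v := hE.dist_eq_zero_iff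

lemma edist_le_succ {e : Finset V} (he : e ∈ E) {y z : V} (hy : y ∈ e) (hz : z ∈ e) (r : V) :
    edist E r y ≤ edist E r z + 1 :=
  (edist_triangle hE r z y).trans (by gcongr; exact edist_le_one he hz hy)

/-- Every vertex other than `r` has a neighbour closer to `r`. -/
lemma exists_closer {r v : V} (h : v ≠ r) :
    ∃ e ∈ E, v ∈ e ∧ ∃ y ∈ e, edist E r v = edist E r y + 1 := by
  obtain ⟨p, hp⟩ := hE.exists_walk_length_eq_dist v r
  revert hp
  cases p with
  | nil => exact absurd rfl h
  | @cons _ y _ hadj q =>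
    intro hp
    obtain ⟨-, e, he, hve, hye⟩ := id hadj
    refine ⟨e, he, hve, y, hye, ?_⟩
    rw [SimpleGraph.Walk.length_cons] at hp
    have h1 : edist E y r ≤ q.length := SimpleGraph.dist_le q
    have h2 := edist_le_succ hE he hve hye r
    rw [edist_comm E r v, edist_comm E r y] at h2 ⊢
    change q.length + 1 = edist E v r at hp
    omega

end Connected

/-- The vertices of `e` that are not closest to `r`. -/
noncomputable def children (E : Finset (Finset V)) (r : V) (e : Finset V) : Finset V :=
  e.filter fun v => ∃ y ∈ e, edist E r v = edist E r y + 1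

lemma card_children_lt {E : Finset (Finset V)} {e : Finset V} (he : e.Nonempty) (r : V) :
    (children E r e).card < e.card := by
  obtain ⟨y, hy, hmin⟩ := Finset.exists_min_image e (edist E r) he
  refine Finset.card_lt_card ⟨Finset.filter_subset _ _, fun h => ?_⟩
  obtain ⟨-, z, hz, h1⟩ := Finset.mem_filter.1 (h hy)
  have := hmin z hz
  omega

lemma sum_card_children (E : Finset (Finset V)) (r : V) :
    ∑ e ∈ E, (children E r e).card = ∑ v, (E.filter (v ∈ children E r ·)).card := by
  simp only [Finset.card_eq_sum_ones, Finset.sum_filter]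
  rw [Finset.sum_comm]
  refine Finset.sum_congr rfl fun e _ => ?_
  simp only [children, Finset.mem_filter, ← Finset.sum_filter]
  congr 1
  ext
  simp

lemma not_mem_children_root {E : Finset (Finset V)} (r : V) (e : Finset V) :
    r ∉ children E r e := by
  simp [children]

/-- A connected family of edges of size at most `k` spans at most `1 + (k - 1) |E|` vertices. -/
lemma card_le_of_connected {E : Finset (Finset V)} (hE : (twoSection E).Connected) {k : ℕ}
    (hk : ∀ e ∈ E, e.card = k) : Fintype.card V ≤ 1 + (k - 1) * E.card := by
  obtain ⟨r⟩ := hE.nonempty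
  have h1 : ∑ e ∈ E, (children E r e).card ≤ ∑ _e ∈ E, (k - 1) := by
    refine Finset.sum_le_sum fun e he => ?_
    have := hk e he
    rcases e.eq_empty_or_nonempty with rfl | hne
    · simp [children]
    · have := card_children_lt (E := E) hne r
      omega
  have h2 : ∑ v ∈ Finset.univ.erase r, 1 ≤ ∑ v, (E.filter (v ∈ children E r ·)).card := by
    refine (Finset.sum_le_sum fun v hv => ?_).trans
      (Finset.sum_le_sum_of_subset (Finset.subset_univ (Finset.univ.erase r)))
    obtain ⟨e, he, hv, hy⟩ := exists_closer hE (Finset.ne_of_mem_erase hv)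
    exact Finset.card_pos.2 ⟨e, by simp [children, he, hv, hy]⟩
  rw [sum_card_children] at h1
  have h3 := h2.trans h1
  simp only [Finset.sum_const, smul_eq_mul, mul_one, Finset.card_erase_of_mem (Finset.mem_univ r),
    Finset.card_univ] at h3
  rw [mul_comm]
  omega

section Tree

variable {k : ℕ} {E : Finset (Finset V)} (hE : IsTree k E)
include hE

/-- Double counting of the pairs of an edge and a vertex of it which is not closest to `r`. -/
lemma IsTree.children_count (r : V) :
    (∀ e ∈ E, (children E r e).card = k - 1) ∧
    ∀ v, v ≠ r → (E.filter (v ∈ children E r ·)).card = 1 := by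
  have hk := hE.two_le
  have h1 : ∀ e ∈ E, (children E r e).card ≤ k - 1 := by
    intro e he
    have := hE.unif e he
    have := card_children_lt (E := E) (e := e) (Finset.card_pos.1 (by omega)) r
    omega
  have h2 : ∀ v ∈ Finset.univ.erase r, 1 ≤ (E.filter (v ∈ children E r ·)).card := by
    intro v hv
    obtain ⟨e, he, hv, hy⟩ := exists_closer hE.conn (Finset.ne_of_mem_erase hv)
    exact Finset.card_pos.2 ⟨e, by simp [children, he, hv, hy]⟩
  have hr : (E.filter (r ∈ children E r ·)).card = 0 := by
    simp [not_mem_children_root]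
  have h3 := sum_card_children E r
  rw [← Finset.add_sum_erase _ _ (Finset.mem_univ r), hr, zero_add] at h3
  have h4 := Finset.sum_le_sum h1
  have h5 := Finset.sum_le_sum h2
  have h6 : ∑ _v ∈ Finset.univ.erase r, 1 = ∑ _e ∈ E, (k - 1) := by
    simp only [Finset.sum_const, smul_eq_mul, mul_one,
      Finset.card_erase_of_mem (Finset.mem_univ r), Finset.card_univ, hE.card_eq]
    rw [mul_comm]
    omega
  constructor
  · exact (Finset.sum_eq_sum_iff_of_le h1).1 (le_antisymm h4 (by omega))
  · intro v hv
    exact ((Finset.sum_eq_sum_iff_of_le h2).1 (le_antisymm h5 (by omega)) v (by simp [hv])).symm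

/-- Every edge has a unique vertex closest to `r`. -/
lemma IsTree.exists_gate (r : V) {e : Finset V} (he : e ∈ E) :
    ∃ y ∈ e, ∀ z ∈ e, z ≠ y → edist E r z = edist E r y + 1 := by
  have hk := hE.two_le
  have hc := (hE.children_count r).1 e he
  have hu := hE.unif e he
  obtain ⟨y, hy, hmin⟩ := Finset.exists_min_image e (edist E r) (Finset.card_pos.1 (by omega))
  refine ⟨y, hy, fun z hz hzy => ?_⟩
  have hsub : children E r e ⊆ e := Finset.filter_subset _ _
  have hyc : y ∉ children E r e := by
    intro h
    obtain ⟨-, z, hz, h1⟩ := Finset.mem_filter.1 h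
    have := hmin z hz
    omega
  have h1 : children E r e = e.erase y := by
    refine Finset.eq_of_subset_of_card_le (fun w hw => Finset.mem_erase.2 ⟨?_, hsub hw⟩) ?_
    · rintro rfl
      exact hyc hw
    · rw [Finset.card_erase_of_mem hy]
      omega
  have hz' : z ∈ children E r e := by
    rw [h1]
    exact Finset.mem_erase.2 ⟨hzy, hz⟩
  obtain ⟨-, w, hw, h2⟩ := Finset.mem_filter.1 hz'
  have := hmin w hw
  have := edist_le_succ hE.conn he hz hy r
  omega

/-- Every vertex other than `r` lies in exactly one edge in which it is not closest to `r`. -/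
lemma IsTree.unique_parent {r v : V} (h : v ≠ r) {e e' : Finset V} (he : e ∈ E) (he' : e' ∈ E)
    (hv : v ∈ e) (hv' : v ∈ e') (hy : ∃ y ∈ e, edist E r y < edist E r v)
    (hy' : ∃ y ∈ e', edist E r y < edist E r v) : e = e' := by
  have hc := (hE.children_count r).2 v h
  have key : ∀ f ∈ E, v ∈ f → (∃ y ∈ f, edist E r y < edist E r v) →
      f ∈ E.filter (v ∈ children E r ·) := by
    rintro f hf hvf ⟨y, hyf, hlt⟩
    refine Finset.mem_filter.2 ⟨hf, Finset.mem_filter.2 ⟨hvf, y, hyf, ?_⟩⟩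
    have := edist_le_succ hE.conn hf hvf hyf r
    omega
  exact Finset.card_le_one.1 hc.le _ (key e he hv hy) _ (key e' he' hv' hy')

end Tree

/-! ### Branches at a vertex -/

/-- The branch of `e` at `u`: the vertices that are closer to some vertex of `e` than to `u`. If
`u ∈ e` is a vertex of a hypertree, these are the vertices whose path to `u` ends with `e`. -/
noncomputable def branch (E : Finset (Finset V)) (u : V) (e : Finset V) : Finset V :=
  Finset.univ.filter fun w => ∃ y ∈ e, edist E w y < edist E w u

lemma mem_branch {E : Finset (Finset V)} {u w : V} {e : Finset V} :
    w ∈ branch E u e ↔ ∃ y ∈ e, edist E w y < edist E w u := by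
  simp [branch]

lemma not_mem_branch_self (E : Finset (Finset V)) (u : V) (e : Finset V) : u ∉ branch E u e := by
  simp [mem_branch]

lemma ne_of_mem_branch {E : Finset (Finset V)} {u w : V} {e : Finset V}
    (h : w ∈ branch E u e) : w ≠ u := by
  rintro rfl
  exact not_mem_branch_self E w e h

section Branch

variable {k : ℕ} {E : Finset (Finset V)} (hE : IsTree k E)
include hE

lemma IsTree.mem_branch_of_mem {u y : V} {e : Finset V} (hy : y ∈ e) (h : y ≠ u) :
    y ∈ branch E u e := by
  rw [mem_branch]
  refine ⟨y, hy, ?_⟩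
  rw [(edist_eq_zero hE.conn).2 rfl]
  exact Nat.pos_of_ne_zero fun h0 => h ((edist_eq_zero hE.conn).1 h0)

lemma IsTree.branch_unique {u w : V} {e e' : Finset V} (he : e ∈ E) (he' : e' ∈ E) (hu : u ∈ e)
    (hu' : u ∈ e') (hw : w ∈ branch E u e) (hw' : w ∈ branch E u e') : e = e' :=
  hE.unique_parent (ne_of_mem_branch hw).symm he he' hu hu' (mem_branch.1 hw) (mem_branch.1 hw')

lemma IsTree.exists_branch {u w : V} (h : w ≠ u) : ∃ e ∈ E, u ∈ e ∧ w ∈ branch E u e := by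
  obtain ⟨e, he, hu, y, hy, hd⟩ := exists_closer hE.conn h.symm
  exact ⟨e, he, hu, mem_branch.2 ⟨y, hy, by omega⟩⟩

/-- Two edges with two common vertices are equal. -/
lemma IsTree.edge_unique {u w : V} {e e' : Finset V} (he : e ∈ E) (he' : e' ∈ E) (hu : u ∈ e)
    (hu' : u ∈ e') (hw : w ∈ e) (hw' : w ∈ e') (h : w ≠ u) : e = e' :=
  hE.branch_unique he he' hu hu' (hE.mem_branch_of_mem hw h) (hE.mem_branch_of_mem hw' h)

/-- Distances from a vertex of the branch of `e` at `u` to the vertices of `e`: there is a vertex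
`y ≠ u` of `e` through which all paths pass. -/
lemma IsTree.exists_gate_branch {u w : V} {e : Finset V} (he : e ∈ E)
    (hw : w ∈ branch E u e) :
    ∃ y ∈ e, y ≠ u ∧ ∀ z ∈ e, z ≠ y → edist E w z = edist E w y + 1 := by
  obtain ⟨y, hy, h⟩ := hE.exists_gate w he
  refine ⟨y, hy, ?_, h⟩
  rintro rfl
  obtain ⟨z, hz, hlt⟩ := mem_branch.1 hw
  rcases eq_or_ne z y with rfl | hzy
  · exact lt_irrefl _ hlt
  · have := h z hz hzy
    omega

/-- If `u` is the vertex of `e` closest to `w`, then all others are at distance one more. -/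
lemma IsTree.edist_of_not_mem_branch {u w z : V} {e : Finset V} (he : e ∈ E) (hu : u ∈ e)
    (hw : w ∉ branch E u e) (hz : z ∈ e) (h : z ≠ u) : edist E w z = edist E w u + 1 := by
  obtain ⟨y, hy, hg⟩ := hE.exists_gate w he
  rcases eq_or_ne u y with rfl | huy
  · exact hg z hz h
  · exact absurd (mem_branch.2 ⟨y, hy, by rw [hg u hu huy]; omega⟩) hw

lemma branch_closed_aux {u z z' : V} {e e' : Finset V} (he' : e' ∈ E)
    (hz : z ∈ branch E u e) (hze : z ∈ e') (hze' : z' ∈ e')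
    (hlt : edist E z u < edist E z' u) : z' ∈ branch E u e := by
  obtain ⟨y, hy, hd⟩ := mem_branch.1 hz
  refine mem_branch.2 ⟨y, hy, ?_⟩
  have := edist_le_succ hE.conn he' hze' hze y
  rw [edist_comm E z' y, edist_comm E z y] at *
  omega

/-- A branch at `u` can only be left through `u`. -/
lemma IsTree.branch_closed {u z z' : V} {e e' : Finset V} (he : e ∈ E) (hu : u ∈ e)
    (he' : e' ∈ E) (hz : z ∈ branch E u e) (hze : z ∈ e') (hze' : z' ∈ e') (h : z' ≠ u) :
    z' ∈ branch E u e := by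
  have key : ∀ a b : V, ∀ f ∈ E, u ∈ f → a ∈ branch E u f → a ∈ e' → b ∈ e' →
      edist E a u < edist E b u → b ∈ branch E u f :=
    fun a b f _ _ ha hae hbe hlt => branch_closed_aux hE he' ha hae hbe hlt
  rcases lt_trichotomy (edist E z u) (edist E z' u) with hlt | heq | hgt
  · exact key z z' e he hu hz hze hze' hlt
  · obtain ⟨y, hy, hg⟩ := hE.exists_gate u he'
    have hzu := ne_of_mem_branch hz
    rcases eq_or_ne y u with rfl | hyu
    · have h1 := hE.mem_branch_of_mem hze hzu
      rw [hE.branch_unique he he' hu hy hz h1]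
      exact hE.mem_branch_of_mem hze' h
    · by_cases hzy : z = y
      · subst hzy
        by_cases hzz : z' = z
        · rwa [hzz]
        · have := hg z' hze' hzz
          rw [edist_comm E u z', edist_comm E u z] at this
          omega
      · have hzy' : z' ≠ y := by
          rintro rfl
          have := hg z hze hzy
          rw [edist_comm E u z', edist_comm E u z] at this
          omega
        obtain ⟨f, hf, huf, hyf⟩ := hE.exists_branch hyu
        have h1 := hg z hze hzy
        have h2 := hg z' hze' hzy'
        rw [edist_comm E u y, edist_comm E u z] at h1
        rw [edist_comm E u y, edist_comm E u z'] at h2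
        have h3 := key y z f hf huf hyf hy hze (by omega)
        rw [hE.branch_unique he hf hu huf hz h3]
        exact key y z' f hf huf hyf hy hze' (by omega)
  · obtain ⟨f, hf, huf, hzf⟩ := hE.exists_branch h
    have h1 := key z' z f hf huf hzf hze' hze hgt
    rwa [hE.branch_unique he hf hu huf hz h1]

/-- Distances are additive across a vertex `u` separating a branch from the rest. -/
lemma IsTree.edist_add {u w w' : V} {e : Finset V} (he : e ∈ E) (hu : u ∈ e)
    (hw : w ∈ branch E u e) (hw' : w' ∉ branch E u e) :
    edist E w w' = edist E w u + edist E u w' := by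
  refine le_antisymm (edist_triangle hE.conn w u w') ?_
  have h := le_add_edist_of_lipschitz hE.conn
    (fun z => if z ∈ branch E u e then -(edist E u z : ℝ) else edist E u z) ?_ w w'
  · simp only [hw, hw', if_true, if_false] at h
    rw [edist_comm E w u]
    exact_mod_cast (by linarith : (edist E u w : ℝ) + edist E u w' ≤ edist E w w')
  · intro f hf y hy z hz
    have h1 : (edist E u y : ℝ) ≤ edist E u z + 1 := by
      exact_mod_cast edist_le_succ hE.conn hf hy hz u
    have h2 : (edist E u z : ℝ) ≤ edist E u y + 1 := by
      exact_mod_cast edist_le_succ hE.conn hf hz hy u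
    by_cases hyb : y ∈ branch E u e <;> by_cases hzb : z ∈ branch E u e <;>
      simp only [hyb, hzb, if_true, if_false]
    · linarith
    · linarith [(edist E u y).cast_nonneg (α := ℝ), (edist E u z).cast_nonneg (α := ℝ)]
    · have hyu : y = u := by
        by_contra hne
        exact hyb (hE.branch_closed he hu hf hzb hz hy hne)
      subst hyu
      have : edist E y z ≤ 1 := edist_le_one hf hy hz
      have : (edist E y z : ℝ) ≤ 1 := by exact_mod_cast this
      have h0 : edist E y y = 0 := (edist_eq_zero hE.conn).2 rfl
      simp only [h0, Nat.cast_zero]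
      linarith
    · linarith

end Branch

open Matrix

/-! ### The distance spectral radius -/

/-- The distance spectral radius of a family of edges. -/
noncomputable def rho (E : Finset (Finset V)) : ℝ := topEigenvalue (distMat E)

/-- `x` is a positive eigenvector of the distance matrix for the distance spectral radius. -/
structure IsPerron (E : Finset (Finset V)) (x : V → ℝ) : Prop where
  pos : ∀ v, 0 < x v
  eigen : ∀ u, ∑ v, (edist E u v : ℝ) * x v = rho E * x u

section Perron

variable [Nontrivial V] {E : Finset (Finset V)} (hE : (twoSection E).Connected)
include hE

lemma perron_distMat :
    0 < topEigenvalue (distMat E) ∧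
    (∀ y : V → ℝ, y ⬝ᵥ distMat E *ᵥ y ≤ topEigenvalue (distMat E) * (y ⬝ᵥ y)) ∧
    ∃ x : V → ℝ, (∀ v, 0 < x v) ∧ distMat E *ᵥ x = topEigenvalue (distMat E) • x := by
  refine exists_perron (distMat E) (fun u v => ?_) (fun u => ?_) (fun u v huv => ?_)
  · simp only [distMat, edist_comm E u v]
  · simp [distMat]
  · simp only [distMat, Nat.cast_pos]
    exact hE.pos_dist_of_ne huv

lemma rho_pos : 0 < rho E := (perron_distMat hE).1

lemma exists_isPerron : ∃ x, IsPerron E x := by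
  obtain ⟨-, -, x, hx, h⟩ := perron_distMat hE
  exact ⟨x, hx, fun u => congrFun h u⟩

lemma rayleigh_le (y : V → ℝ) :
    ∑ u, ∑ v, (edist E u v : ℝ) * (y u * y v) ≤ rho E * ∑ u, y u * y u := by
  refine le_of_eq_of_le ?_ ((perron_distMat hE).2.1 y)
  simp only [dotProduct, mulVec, Finset.mul_sum, distMat]
  exact Finset.sum_congr rfl fun u _ => Finset.sum_congr rfl fun v _ => by ring

end Perron

lemma IsPerron.quadratic {E : Finset (Finset V)} {x : V → ℝ} (hx : IsPerron E x) :
    ∑ u, ∑ v, (edist E u v : ℝ) * (x u * x v) = rho E * ∑ u, x u * x u := by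
  rw [Finset.mul_sum]
  refine Finset.sum_congr rfl fun u _ => ?_
  rw [← mul_assoc, ← hx.eigen u, Finset.sum_mul]
  exact Finset.sum_congr rfl fun v _ => by ring

/-- Comparison of spectral radii through the Rayleigh quotient: the distances of `E'`, after a
relabelling `τ` of the vertices, are at least those of `E` plus a symmetric perturbation of rank
two whose quadratic form is positive at the Perron vector of `E`. -/
lemma rho_lt_of_gain [Nontrivial V] {E E' : Finset (Finset V)} (hE' : (twoSection E').Connected)
    {x : V → ℝ} (hx : IsPerron E x) (τ : Equiv.Perm V) (s r : V → ℝ)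
    (hM : ∀ w z, (edist E w z : ℝ) + s w * r z + s z * r w ≤ edist E' (τ w) (τ z))
    (hgain : 0 < (∑ w, s w * x w) * ∑ z, r z * x z) : rho E < rho E' := by
  have h1 := rayleigh_le hE' (x ∘ τ.symm)
  have hr : ∑ w, (x ∘ τ.symm) w * (x ∘ τ.symm) w = ∑ w, x w * x w := by
    rw [← Equiv.sum_comp τ]
    simp
  rw [hr, ← Equiv.sum_comp τ] at h1
  have h2 : ∑ w, ∑ z, ((edist E w z : ℝ) + s w * r z + s z * r w) * (x w * x z) ≤
      rho E' * ∑ w, x w * x w := by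
    refine le_trans (Finset.sum_le_sum fun w _ => ?_) h1
    rw [← Equiv.sum_comp τ (fun z => (edist E' (τ w) z : ℝ) * _)]
    simp only [Function.comp, Equiv.symm_apply_apply]
    exact Finset.sum_le_sum fun z _ =>
      mul_le_mul_of_nonneg_right (hM w z) (mul_pos (hx.pos w) (hx.pos z)).le
  have h3 : ∑ w, ∑ z, ((edist E w z : ℝ) + s w * r z + s z * r w) * (x w * x z) =
      rho E * ∑ u, x u * x u + 2 * ((∑ w, s w * x w) * ∑ z, r z * x z) := by
    rw [← hx.quadratic]
    have h4 : ∑ w, ∑ z, s w * r z * (x w * x z) = (∑ w, s w * x w) * ∑ z, r z * x z := by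
      rw [Finset.sum_mul_sum]
      exact Finset.sum_congr rfl fun w _ => Finset.sum_congr rfl fun z _ => by ring
    have h5 : ∑ w, ∑ z, s z * r w * (x w * x z) = (∑ w, s w * x w) * ∑ z, r z * x z := by
      rw [Finset.sum_comm, ← h4]
      exact Finset.sum_congr rfl fun w _ => Finset.sum_congr rfl fun z _ => by ring
    simp only [add_mul, Finset.sum_add_distrib]
    rw [h4, h5]
    ring
  have h6 : 0 < ∑ w, x w * x w :=
    Finset.sum_pos (fun w _ => mul_pos (hx.pos w) (hx.pos w)) Finset.univ_nonempty
  by_contra hlt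
  push Not at hlt
  have := mul_le_mul_of_nonneg_right hlt h6.le
  linarith

/-! ### Exchanging branches between two vertices -/

/-- The effect on the edge `e` of exchanging the edges `F₁` at `u` with the edges `F₂` at `v`. -/
def exchangeEdge (u v : V) (F₁ F₂ : Finset (Finset V)) (e : Finset V) : Finset V :=
  if e ∈ F₁ then insert v (e.erase u) else if e ∈ F₂ then insert u (e.erase v) else e

/-- The family obtained from `E` by moving the edges `F₁` from `u` to `v` and the edges `F₂` from
`v` to `u`. -/
def exchange (E : Finset (Finset V)) (u v : V) (F₁ F₂ : Finset (Finset V)) :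
    Finset (Finset V) :=
  E.image (exchangeEdge u v F₁ F₂)

/-- `F₁` are edges at `u` and `F₂` edges at `v`, none of them on the path between the two distinct
vertices `u` and `v` of a hypertree. -/
structure Exchangeable (k : ℕ) (E : Finset (Finset V)) (u v : V) (F₁ F₂ : Finset (Finset V)) :
    Prop where
  tree : IsTree k E
  ne : u ≠ v
  sub₁ : F₁ ⊆ E
  sub₂ : F₂ ⊆ E
  mem₁ : ∀ e ∈ F₁, u ∈ e
  mem₂ : ∀ e ∈ F₂, v ∈ e
  not_mem₁ : ∀ e ∈ F₁, v ∉ branch E u e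
  not_mem₂ : ∀ e ∈ F₂, u ∉ branch E v e

/-- The union of the branches at `u` of the edges in `F`. -/
noncomputable def branches (E : Finset (Finset V)) (u : V) (F : Finset (Finset V)) : Finset V :=
  F.biUnion (branch E u)

lemma mem_branches {E : Finset (Finset V)} {u w : V} {F : Finset (Finset V)} :
    w ∈ branches E u F ↔ ∃ e ∈ F, w ∈ branch E u e := by
  simp [branches]

namespace Exchangeable

variable {k : ℕ} {E : Finset (Finset V)} {u v : V} {F₁ F₂ : Finset (Finset V)}
  (h : Exchangeable k E u v F₁ F₂)
include h

lemma symm : Exchangeable k E v u F₂ F₁ :=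
  ⟨h.tree, h.ne.symm, h.sub₂, h.sub₁, h.mem₂, h.mem₁, h.not_mem₂, h.not_mem₁⟩

lemma mem_branches_of_mem {e : Finset V} (he : e ∈ F₁) {y : V} (hy : y ∈ e) (hyu : y ≠ u) :
    y ∈ branches E u F₁ :=
  mem_branches.2 ⟨e, he, h.tree.mem_branch_of_mem hy hyu⟩

lemma right_not_mem : v ∉ branches E u F₁ := by
  simpa [mem_branches] using h.not_mem₁

lemma left_not_mem : u ∉ branches E u F₁ := by
  simp [mem_branches, not_mem_branch_self]

lemma right_not_mem_edge {e : Finset V} (he : e ∈ F₁) : v ∉ e := fun hv =>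
  h.right_not_mem (h.mem_branches_of_mem he hv h.ne.symm)

lemma not_mem_of_mem {e : Finset V} (he : e ∈ F₁) : e ∉ F₂ := fun he' =>
  h.right_not_mem_edge he (h.mem₂ e he')

lemma edist_add {w z : V} (hw : w ∈ branches E u F₁) (hz : z ∉ branches E u F₁) :
    edist E w z = edist E w u + edist E u z := by
  obtain ⟨e, he, hwe⟩ := mem_branches.1 hw
  exact h.tree.edist_add (h.sub₁ he) (h.mem₁ e he) hwe
    fun hze => hz (mem_branches.2 ⟨e, he, hze⟩)

lemma disjoint {w : V} (hw : w ∈ branches E u F₁) : w ∉ branches E v F₂ := by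
  intro hw'
  have h1 := h.edist_add hw h.right_not_mem
  have h2 := h.symm.edist_add hw' h.symm.right_not_mem
  have h3 := edist_comm E u v
  have h4 : edist E u v ≠ 0 := fun h0 => h.ne ((edist_eq_zero h.tree.conn).1 h0)
  omega

lemma closed {e : Finset V} (he : e ∈ E) (he₁ : e ∉ F₁) {a b : V} (ha : a ∈ e) (hb : b ∈ e)
    (haB : a ∈ branches E u F₁) : b ∈ branches E u F₁ := by
  obtain ⟨f, hf, haf⟩ := mem_branches.1 haB
  refine mem_branches.2 ⟨f, hf, ?_⟩
  by_cases hbu : b = u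
  · subst hbu
    have h1 := h.tree.branch_unique he (h.sub₁ hf) hb (h.mem₁ f hf)
      (h.tree.mem_branch_of_mem ha (ne_of_mem_branch haf)) haf
    exact absurd (h1 ▸ hf) he₁
  · exact h.tree.branch_closed (h.sub₁ hf) (h.mem₁ f hf) he haf ha hb hbu

lemma exchangeEdge_of_mem {e : Finset V} (he : e ∈ F₁) :
    exchangeEdge u v F₁ F₂ e = insert v (e.erase u) := by
  simp [exchangeEdge, he]

lemma exchangeEdge_symm (e : Finset V) :
    exchangeEdge v u F₂ F₁ e = exchangeEdge u v F₁ F₂ e := by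
  by_cases h1 : e ∈ F₁
  · simp [exchangeEdge, h1, h.not_mem_of_mem h1]
  · simp [exchangeEdge, h1]

lemma exchange_symm : exchange E v u F₂ F₁ = exchange E u v F₁ F₂ := by
  unfold exchange
  exact Finset.image_congr fun e _ => h.exchangeEdge_symm e

lemma mem_exchange_of_not_mem {e : Finset V} (he : e ∈ E) (h1 : e ∉ F₁) (h2 : e ∉ F₂) :
    e ∈ exchange E u v F₁ F₂ :=
  Finset.mem_image.2 ⟨e, he, by simp [exchangeEdge, h1, h2]⟩

lemma mem_exchange_of_mem {e : Finset V} (he : e ∈ F₁) :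
    insert v (e.erase u) ∈ exchange E u v F₁ F₂ :=
  Finset.mem_image.2 ⟨e, h.sub₁ he, h.exchangeEdge_of_mem he⟩

/-- A shortest path from `u` to a vertex outside all moved branches uses no moved edge, so it
survives the exchange. -/
lemma reachable_left {z : V} (hz₁ : z ∉ branches E u F₁) (hz₂ : z ∉ branches E v F₂) :
    (twoSection (exchange E u v F₁ F₂)).Reachable u z := by
  induction hn : edist E u z using Nat.strong_induction_on generalizing z with
  | _ n ih =>
    subst hn
    by_cases hzu : z = u
    · rw [hzu]
    · obtain ⟨e, he, hze, y, hy, hd⟩ := exists_closer h.tree.conn hzu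
      have hyz : z ≠ y := by
        rintro rfl
        omega
      have he₁ : e ∉ F₁ := fun he₁ => hz₁ (h.mem_branches_of_mem he₁ hze hzu)
      have he₂ : e ∉ F₂ := by
        intro he₂
        have hzv : z = v := by
          by_contra hzv
          exact hz₂ (h.symm.mem_branches_of_mem he₂ hze hzv)
        subst hzv
        have := h.tree.edist_of_not_mem_branch he hze (h.not_mem₂ e he₂) hy hyz.symm
        omega
      have hy₁ : y ∉ branches E u F₁ := fun hyB => hz₁ (h.closed he he₁ hy hze hyB)
      have hy₂ : y ∉ branches E v F₂ := fun hyB => hz₂ (h.symm.closed he he₂ hy hze hyB)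
      have hadj : (twoSection (exchange E u v F₁ F₂)).Adj y z :=
        ⟨hyz.symm, e, h.mem_exchange_of_not_mem he he₁ he₂, hy, hze⟩
      exact (ih _ (by omega) hy₁ hy₂ rfl).trans hadj.reachable

lemma reachable_branches {z : V} (hz : z ∈ branches E u F₁) :
    (twoSection (exchange E u v F₁ F₂)).Reachable v z := by
  induction hn : edist E u z using Nat.strong_induction_on generalizing z with
  | _ n ih =>
    subst hn
    have hzu : z ≠ u := by
      rintro rfl
      exact h.left_not_mem hz
    obtain ⟨e, he, hze, y, hy, hd⟩ := exists_closer h.tree.conn hzu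
    have hyz : z ≠ y := by
      rintro rfl
      omega
    by_cases he₁ : e ∈ F₁
    · have hadj : (twoSection (exchange E u v F₁ F₂)).Adj v z :=
        ⟨fun hv => h.right_not_mem (hv ▸ hz), _, h.mem_exchange_of_mem he₁,
          Finset.mem_insert_self _ _, Finset.mem_insert_of_mem (Finset.mem_erase.2 ⟨hzu, hze⟩)⟩
      exact hadj.reachable
    · have hyB := h.closed he he₁ hze hy hz
      have he₂ : e ∉ F₂ := fun he₂ =>
        h.right_not_mem (h.closed he he₁ hze (h.mem₂ e he₂) hz)
      have hadj : (twoSection (exchange E u v F₁ F₂)).Adj y z :=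
        ⟨hyz.symm, e, h.mem_exchange_of_not_mem he he₁ he₂, hy, hze⟩
      exact (ih _ (by omega) hyB rfl).trans hadj.reachable

lemma connected : (twoSection (exchange E u v F₁ F₂)).Connected := by
  have key : ∀ z, (twoSection (exchange E u v F₁ F₂)).Reachable u z := by
    intro z
    by_cases hz₁ : z ∈ branches E u F₁
    · refine (h.reachable_left h.right_not_mem ?_).trans (h.reachable_branches hz₁)
      exact h.symm.left_not_mem
    · by_cases hz₂ : z ∈ branches E v F₂
      · have := h.symm.reachable_branches hz₂
        rwa [h.exchange_symm] at this
      · exact h.reachable_left hz₁ hz₂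
  have : Nonempty V := ⟨u⟩
  exact ⟨fun a b => (key a).symm.trans (key b)⟩

lemma card_exchangeEdge {e : Finset V} (he : e ∈ E) : (exchangeEdge u v F₁ F₂ e).card = k := by
  have hk := h.tree.unif e he
  by_cases h1 : e ∈ F₁
  · rw [h.exchangeEdge_of_mem h1, Finset.card_insert_of_notMem
      fun hv => h.right_not_mem_edge h1 (Finset.mem_of_mem_erase hv),
      Finset.card_erase_add_one (h.mem₁ e h1), hk]
  · by_cases h2 : e ∈ F₂
    · rw [← h.exchangeEdge_symm, h.symm.exchangeEdge_of_mem h2, Finset.card_insert_of_notMem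
        fun hv => h.symm.right_not_mem_edge h2 (Finset.mem_of_mem_erase hv),
        Finset.card_erase_add_one (h.mem₂ e h2), hk]
    · simp [exchangeEdge, h1, h2, hk]

lemma unif : ∀ e ∈ exchange E u v F₁ F₂, e.card = k := by
  intro e he
  obtain ⟨f, hf, rfl⟩ := Finset.mem_image.1 he
  exact h.card_exchangeEdge hf

/-- No edges are identified by an exchange, because the new family is still connected. -/
lemma card_exchange : (exchange E u v F₁ F₂).card = E.card := by
  refine le_antisymm Finset.card_image_le ?_
  have h1 := card_le_of_connected h.connected h.unif
  rw [h.tree.card_eq] at h1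
  have := h.tree.two_le
  exact Nat.le_of_mul_le_mul_left (by omega) (show 0 < k - 1 by omega)

lemma isTree : IsTree k (exchange E u v F₁ F₂) :=
  ⟨h.tree.two_le, h.unif, h.connected, by rw [h.card_exchange]; exact h.tree.card_eq⟩

lemma deg_exchange (x : V) :
    deg (exchange E u v F₁ F₂) x = (E.filter (x ∈ exchangeEdge u v F₁ F₂ ·)).card := by
  have hinj : Set.InjOn (exchangeEdge u v F₁ F₂) E := Finset.card_image_iff.1 h.card_exchange
  rw [deg, exchange, Finset.filter_image, Finset.card_image_of_injOn]
  exact hinj.mono (Finset.coe_subset.2 (Finset.filter_subset _ _))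

lemma deg_of_ne {x : V} (hu : x ≠ u) (hv : x ≠ v) : deg (exchange E u v F₁ F₂) x = deg E x := by
  rw [h.deg_exchange, deg]
  congr 1
  refine Finset.filter_congr fun e _ => ?_
  unfold exchangeEdge
  split_ifs <;> simp [hu, hv]

lemma deg_left : deg (exchange E u v F₁ F₂) u + F₁.card = deg E u + F₂.card := by
  have h1 : E.filter (u ∈ exchangeEdge u v F₁ F₂ ·) = (E.filter (u ∈ ·) \ F₁) ∪ F₂ := by
    ext e
    simp only [Finset.mem_filter, Finset.mem_union, Finset.mem_sdiff]
    unfold exchangeEdge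
    by_cases h1 : e ∈ F₁
    · simp [h1, h.ne, h.not_mem_of_mem h1]
    · by_cases h2 : e ∈ F₂
      · simp [h1, h2, h.sub₂ h2]
      · simp [h1, h2]
  have h2 : F₁ ⊆ E.filter (u ∈ ·) := fun e he =>
    Finset.mem_filter.2 ⟨h.sub₁ he, h.mem₁ e he⟩
  have h3 : Disjoint (E.filter (u ∈ ·) \ F₁) F₂ := by
    rw [Finset.disjoint_left]
    intro e he he₂
    exact h.symm.right_not_mem_edge he₂ (Finset.mem_filter.1 (Finset.mem_sdiff.1 he).1).2
  rw [h.deg_exchange, h1, Finset.card_union_of_disjoint h3, Finset.card_sdiff_of_subset h2, deg]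
  have := Finset.card_le_card h2
  omega

lemma deg_right : deg (exchange E u v F₁ F₂) v + F₂.card = deg E v + F₁.card := by
  rw [← h.exchange_symm]
  exact h.symm.deg_left

end Exchangeable

/-- `1` on the branches moved from `u` to `v`, `-1` on those moved from `v` to `u`. -/
noncomputable def moved (E : Finset (Finset V)) (u v : V) (F₁ F₂ : Finset (Finset V)) (w : V) :
    ℝ :=
  (if w ∈ branches E u F₁ then 1 else 0) - (if w ∈ branches E v F₂ then 1 else 0)

/-- On the vertices that are not moved, the difference of the distances to `v` and to `u`. -/
noncomputable def shift (E : Finset (Finset V)) (u v : V) (F₁ F₂ : Finset (Finset V)) (w : V) :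
    ℝ :=
  if w ∈ branches E u F₁ ∨ w ∈ branches E v F₂ then 0 else (edist E v w : ℝ) - edist E u w

namespace Exchangeable

variable {k : ℕ} {E : Finset (Finset V)} {u v : V} {F₁ F₂ : Finset (Finset V)}
  (h : Exchangeable k E u v F₁ F₂)
include h

lemma moved_symm (w : V) : moved E v u F₂ F₁ w = - moved E u v F₁ F₂ w := by
  simp [moved]

lemma shift_symm (w : V) : shift E v u F₂ F₁ w = - shift E u v F₁ F₂ w := by
  simp only [shift, or_comm (a := w ∈ branches E v F₂)]
  split_ifs <;> simp

lemma edist_add_real {w z : V} (hw : w ∈ branches E u F₁) (hz : z ∉ branches E u F₁) :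
    (edist E w z : ℝ) = edist E u w + edist E u z := by
  rw [h.edist_add hw hz, edist_comm E w u]
  push_cast
  ring

/-- The distances after the exchange, on an edge that is moved from `u` to `v`. -/
lemma lipschitz_of_mem {e : Finset V} (he : e ∈ F₁) (w : V) {y z : V}
    (hy : y ∈ insert v (e.erase u)) (hz : z ∈ insert v (e.erase u)) :
    (edist E w y : ℝ) + moved E u v F₁ F₂ w * shift E u v F₁ F₂ y +
        moved E u v F₁ F₂ y * shift E u v F₁ F₂ w ≤
      (edist E w z : ℝ) + moved E u v F₁ F₂ w * shift E u v F₁ F₂ z +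
        moved E u v F₁ F₂ z * shift E u v F₁ F₂ w + 1 := by
  have heE := h.sub₁ he
  have hue := h.mem₁ e he
  have hv1 := h.right_not_mem
  have hv2 := h.symm.left_not_mem
  have huv : (edist E u v : ℝ) = edist E v u := by rw [edist_comm E u v]
  have h0 : (edist E v v : ℝ) = 0 := by simp
  -- the value at a vertex of `e` other than `u` is within `1` of the value at `v`
  have hval : ∀ y ∈ e.erase u,
      y ∈ branches E u F₁ ∧ y ∉ branches E v F₂ ∧ (edist E u y : ℝ) = 1 := by
    intro y hy
    have hyB := h.mem_branches_of_mem he (Finset.mem_of_mem_erase hy) (Finset.ne_of_mem_erase hy)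
    refine ⟨hyB, h.disjoint hyB, ?_⟩
    rw [edist_eq_one heE hue (Finset.mem_of_mem_erase hy) (Finset.ne_of_mem_erase hy).symm]
    simp
  have hvy : ∀ y ∈ e.erase u, |((edist E w y : ℝ) + moved E u v F₁ F₂ y * shift E u v F₁ F₂ w) -
      ((edist E w v : ℝ) + moved E u v F₁ F₂ w * shift E u v F₁ F₂ v)| ≤ 1 := by
    intro y hy
    obtain ⟨hy1, hy2, hd⟩ := hval y hy
    have hye := Finset.mem_of_mem_erase hy
    by_cases hw1 : w ∈ branches E u F₁
    · have hw2 := h.disjoint hw1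
      simp only [moved, shift, hw1, hw2, hy1, hy2, hv1, hv2, if_true, if_false, true_or, or_self,
        h0]
      have h1 := h.edist_add_real hw1 hv1
      have h2 : (edist E w y : ℝ) ≤ edist E w u + 1 := by
        exact_mod_cast edist_le_succ h.tree.conn heE hye hue w
      have h3 : (edist E w u : ℝ) ≤ edist E w y + 1 := by
        exact_mod_cast edist_le_succ h.tree.conn heE hue hye w
      have h4 : (edist E w u : ℝ) = edist E u w := by rw [edist_comm]
      rw [abs_le]
      constructor <;> linarith
    · have h1 := h.edist_add_real hy1 hw1
      have h4 : (edist E w y : ℝ) = edist E y w := by rw [edist_comm]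
      have h5 : (edist E w v : ℝ) = edist E v w := by rw [edist_comm]
      by_cases hw2 : w ∈ branches E v F₂
      · simp only [moved, shift, hw1, hw2, hy1, hy2, hv1, hv2, if_true, if_false, or_true,
          or_self, h0]
        have h2 := h.symm.edist_add_real hw2 h.symm.right_not_mem
        have h6 : (edist E w u : ℝ) = edist E u w := by rw [edist_comm]
        rw [abs_le]
        constructor <;> linarith
      · simp only [moved, shift, hw1, hw2, hy1, hy2, hv1, hv2, if_true, if_false,
          or_self, h0]
        rw [abs_le]
        constructor <;> linarith
  have hmv : moved E u v F₁ F₂ v = 0 := by simp [moved, hv1, hv2]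
  have hsy : ∀ y ∈ e.erase u, shift E u v F₁ F₂ y = 0 := by
    intro y hy
    simp [shift, (hval y hy).1]
  have hmy : ∀ y ∈ e.erase u, moved E u v F₁ F₂ y = 1 := by
    intro y hy
    simp [moved, (hval y hy).1, (hval y hy).2.1]
  rcases Finset.mem_insert.1 hy with hy' | hy' <;> rcases Finset.mem_insert.1 hz with hz' | hz'
  · rw [hy', hz']
    linarith
  · have := (abs_le.1 (hvy z hz')).1
    rw [hy', hmv, hsy z hz']
    linarith
  · have := (abs_le.1 (hvy y hy')).2
    rw [hz', hmv, hsy y hy']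
    linarith
  · rw [hsy y hy', hsy z hz', hmy y hy', hmy z hz']
    have : (edist E w y : ℝ) ≤ edist E w z + 1 := by
      exact_mod_cast edist_le_succ h.tree.conn heE (Finset.mem_of_mem_erase hy')
        (Finset.mem_of_mem_erase hz') w
    linarith

/-- The distances after the exchange, on an edge that is not moved. -/
lemma lipschitz_of_not_mem {e : Finset V} (he : e ∈ E) (he₁ : e ∉ F₁) (he₂ : e ∉ F₂) (w : V)
    {y z : V} (hy : y ∈ e) (hz : z ∈ e) :
    (edist E w y : ℝ) + moved E u v F₁ F₂ w * shift E u v F₁ F₂ y +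
        moved E u v F₁ F₂ y * shift E u v F₁ F₂ w ≤
      (edist E w z : ℝ) + moved E u v F₁ F₂ w * shift E u v F₁ F₂ z +
        moved E u v F₁ F₂ z * shift E u v F₁ F₂ w + 1 := by
  have hyz₁ : y ∈ branches E u F₁ ↔ z ∈ branches E u F₁ :=
    ⟨h.closed he he₁ hy hz, h.closed he he₁ hz hy⟩
  have hyz₂ : y ∈ branches E v F₂ ↔ z ∈ branches E v F₂ :=
    ⟨h.symm.closed he he₂ hy hz, h.symm.closed he he₂ hz hy⟩
  have hL : ∀ a : V, (edist E a y : ℝ) ≤ edist E a z + 1 := fun a => by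
    exact_mod_cast edist_le_succ h.tree.conn he hy hz a
  have h1 := hL w
  by_cases hz₁ : z ∈ branches E u F₁
  · simp only [moved, shift, hyz₁, hyz₂, hz₁, true_or, if_true]
    linarith
  · by_cases hz₂ : z ∈ branches E v F₂
    · simp only [moved, shift, hyz₁, hyz₂, hz₂, or_true, if_true]
      linarith
    · by_cases hw₁ : w ∈ branches E u F₁
      · have hw₂ := h.disjoint hw₁
        simp only [moved, shift, hyz₁, hyz₂, hz₁, hz₂, hw₁, hw₂, or_self, true_or, if_true,
          if_false]
        have h2 := h.edist_add_real hw₁ hz₁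
        have h3 := h.edist_add_real hw₁ (hyz₁.not.2 hz₁)
        linarith [hL v]
      · by_cases hw₂ : w ∈ branches E v F₂
        · simp only [moved, shift, hyz₁, hyz₂, hz₁, hz₂, hw₁, hw₂, or_self, or_true, if_true,
            if_false]
          have h2 := h.symm.edist_add_real hw₂ hz₂
          have h3 := h.symm.edist_add_real hw₂ (hyz₂.not.2 hz₂)
          linarith [hL u]
        · simp only [moved, shift, hyz₁, hyz₂, hz₁, hz₂, hw₁, hw₂, or_self, if_false]
          linarith

/-- A lower bound for the distances after an exchange: the distance between a moved vertex and an
unmoved one changes as if `u` and `v` had been interchanged. -/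
lemma le_edist (w z : V) :
    (edist E w z : ℝ) + moved E u v F₁ F₂ w * shift E u v F₁ F₂ z +
        moved E u v F₁ F₂ z * shift E u v F₁ F₂ w ≤ edist (exchange E u v F₁ F₂) w z := by
  have h1 := le_add_edist_of_lipschitz h.connected (fun z => (edist E w z : ℝ) +
    moved E u v F₁ F₂ w * shift E u v F₁ F₂ z + moved E u v F₁ F₂ z * shift E u v F₁ F₂ w)
    ?_ w z
  · have h2 : moved E u v F₁ F₂ w * shift E u v F₁ F₂ w = 0 := by
      unfold moved shift
      split_ifs <;> simp_all
    have h3 : (edist E w w : ℝ) = 0 := by simp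
    simp only [h2, h3] at h1
    linarith
  · intro e he y hy z hz
    obtain ⟨f, hf, rfl⟩ := Finset.mem_image.1 he
    by_cases h1 : f ∈ F₁
    · rw [h.exchangeEdge_of_mem h1] at hy hz
      exact h.lipschitz_of_mem h1 w hy hz
    · by_cases h2 : f ∈ F₂
      · rw [← h.exchangeEdge_symm, h.symm.exchangeEdge_of_mem h2] at hy hz
        have := h.symm.lipschitz_of_mem h2 w hy hz
        simp only [h.moved_symm, h.shift_symm, neg_mul_neg] at this
        exact this
      · simp only [exchangeEdge, h1, h2, if_false] at hy hz
        exact h.lipschitz_of_not_mem hf h1 h2 w hy hz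

end Exchangeable

/-! ### Exchanges that increase the distance spectral radius -/

/-- The indicator function of a set of vertices. -/
def ind (A : Finset V) (w : V) : ℝ := if w ∈ A then 1 else 0

lemma sum_ind_mul (A : Finset V) (x : V → ℝ) : ∑ w, ind A w * x w = ∑ w ∈ A, x w := by
  simp [ind, Finset.sum_ite_mem]

lemma moved_eq (E : Finset (Finset V)) (u v : V) (F₁ F₂ : Finset (Finset V)) (w : V) :
    moved E u v F₁ F₂ w = ind (branches E u F₁) w - ind (branches E v F₂) w := rfl

namespace Exchangeable

variable [Nontrivial V] {k : ℕ} {E : Finset (Finset V)} {u v : V} {F₁ F₂ : Finset (Finset V)}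
  (h : Exchangeable k E u v F₁ F₂)
include h

/-- Exchanging a heavier set of branches at `u` with a lighter one at `v` increases the distance
spectral radius if the unmoved vertices are on average farther from `v` than from `u`. -/
lemma rho_lt {x : V → ℝ} (hx : IsPerron E x)
    (hB : ∑ w ∈ branches E v F₂, x w < ∑ w ∈ branches E u F₁, x w)
    (hS : 0 < ∑ w, shift E u v F₁ F₂ w * x w) : rho E < rho (exchange E u v F₁ F₂) := by
  refine rho_lt_of_gain h.connected hx 1 (moved E u v F₁ F₂) (shift E u v F₁ F₂) h.le_edist ?_
  refine mul_pos ?_ hS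
  simp only [moved_eq, sub_mul, Finset.sum_sub_distrib, sum_ind_mul]
  linarith

end Exchangeable

/-- The edges at `u` other than `e`. -/
def otherEdges (E : Finset (Finset V)) (u : V) (e : Finset V) : Finset (Finset V) :=
  (E.filter (u ∈ ·)).erase e

lemma mem_otherEdges {E : Finset (Finset V)} {u : V} {e f : Finset V} :
    f ∈ otherEdges E u e ↔ f ≠ e ∧ f ∈ E ∧ u ∈ f := by
  simp [otherEdges]

lemma card_otherEdges {E : Finset (Finset V)} {u : V} {e : Finset V} (he : e ∈ E) (hu : u ∈ e) :
    (otherEdges E u e).card + 1 = deg E u :=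
  Finset.card_erase_add_one (by simp [he, hu])

section Full

variable {k : ℕ} {E : Finset (Finset V)} (hE : IsTree k E) {u v : V} {e g : Finset V}
include hE

lemma IsTree.mem_branches_otherEdges (he : e ∈ E) (hu : u ∈ e) {w : V} :
    w ∈ branches E u (otherEdges E u e) ↔ w ≠ u ∧ w ∉ branch E u e := by
  constructor
  · intro hw
    obtain ⟨f, hf, hwf⟩ := mem_branches.1 hw
    obtain ⟨hfe, hf, huf⟩ := mem_otherEdges.1 hf
    exact ⟨ne_of_mem_branch hwf, fun hwe => hfe (hE.branch_unique hf he huf hu hwf hwe)⟩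
  · rintro ⟨hwu, hw⟩
    obtain ⟨f, hf, huf, hwf⟩ := hE.exists_branch hwu
    refine mem_branches.2 ⟨f, mem_otherEdges.2 ⟨?_, hf, huf⟩, hwf⟩
    rintro rfl
    exact hw hwf

lemma IsTree.exchangeable_otherEdges (he : e ∈ E) (hu : u ∈ e) (hg : g ∈ E) (hv : v ∈ g)
    (hve : v ∈ branch E u e) (hug : u ∈ branch E v g) :
    Exchangeable k E u v (otherEdges E u e) (otherEdges E v g) where
  tree := hE
  ne := (ne_of_mem_branch hve).symm
  sub₁ _ hf := (mem_otherEdges.1 hf).2.1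
  sub₂ _ hf := (mem_otherEdges.1 hf).2.1
  mem₁ _ hf := (mem_otherEdges.1 hf).2.2
  mem₂ _ hf := (mem_otherEdges.1 hf).2.2
  not_mem₁ _ hf h := (mem_otherEdges.1 hf).1
    (hE.branch_unique (mem_otherEdges.1 hf).2.1 he (mem_otherEdges.1 hf).2.2 hu h hve)
  not_mem₂ _ hf h := (mem_otherEdges.1 hf).1
    (hE.branch_unique (mem_otherEdges.1 hf).2.1 hg (mem_otherEdges.1 hf).2.2 hv h hug)

/-- Exchanging everything that hangs off `e` at `u`, including `u` itself, with everything that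
hangs off `g` at `v`, including `v`: on the level of families of edges this is the exchange of all
edges at `u` other than `e` with all edges at `v` other than `g`, followed by the transposition
of `u` and `v`. -/
lemma IsTree.rho_lt_exchange_otherEdges [Nontrivial V] (he : e ∈ E) (hu : u ∈ e) (hg : g ∈ E)
    (hv : v ∈ g) (hve : v ∈ branch E u e) (hug : u ∈ branch E v g) {x : V → ℝ}
    (hx : IsPerron E x)
    (hB : ∑ w ∈ (branch E v g)ᶜ, x w < ∑ w ∈ (branch E u e)ᶜ, x w)
    (hS : 0 < ∑ w, (if w ∈ branch E u e ∧ w ∈ branch E v g then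
      (edist E v w : ℝ) - edist E u w else 0) * x w) :
    rho E < rho (exchange E u v (otherEdges E u e) (otherEdges E v g)) := by
  have h := hE.exchangeable_otherEdges he hu hg hv hve hug
  set s : V → ℝ := fun w => ind (branch E u e)ᶜ w - ind (branch E v g)ᶜ w with hs
  set r : V → ℝ := fun w => if w ∈ branch E u e ∧ w ∈ branch E v g then
      (edist E v w : ℝ) - edist E u w else 0 with hr
  refine rho_lt_of_gain h.connected hx (Equiv.swap u v) s r ?_ ?_
  · have hue := not_mem_branch_self E u e
    have hvg := not_mem_branch_self E v g
    have hb₁ : ∀ w, w ≠ u → (w ∈ branches E u (otherEdges E u e) ↔ w ∉ branch E u e) := by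
      intro w hw
      simp [hE.mem_branches_otherEdges he hu, hw]
    have hb₂ : ∀ w, w ≠ v → (w ∈ branches E v (otherEdges E v g) ↔ w ∉ branch E v g) := by
      intro w hw
      simp [hE.mem_branches_otherEdges hg hv, hw]
    set F₁ := otherEdges E u e
    set F₂ := otherEdges E v g
    have hsw : ∀ w, w ≠ u → w ≠ v → s w = moved E u v F₁ F₂ w := by
      intro w h1 h2
      simp [hs, moved, ind, hb₁ w h1, hb₂ w h2]
    have hrw : ∀ w, w ≠ u → w ≠ v → r w = shift E u v F₁ F₂ w := by
      intro w h1 h2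
      simp only [hr, shift, hb₁ w h1, hb₂ w h2]
      by_cases h3 : w ∈ branch E u e <;> by_cases h4 : w ∈ branch E v g <;> simp [h3, h4]
    have hsu : s u = 1 := by simp [hs, ind, hue, hug]
    have hsv : s v = -1 := by simp [hs, ind, hve, hvg]
    have hru : r u = 0 := by simp [hr, hue]
    have hrv : r v = 0 := by simp [hr, hvg]
    have hmu : moved E u v F₁ F₂ u = 0 := by
      simp [moved, h.left_not_mem, h.symm.right_not_mem]
    have hmv : moved E u v F₁ F₂ v = 0 := by
      simp [moved, h.symm.left_not_mem, h.right_not_mem]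
    have hShu : shift E u v F₁ F₂ u = edist E u v := by
      simp [shift, h.left_not_mem, h.symm.right_not_mem, edist_comm E v u]
    have hShv : shift E u v F₁ F₂ v = - (edist E u v : ℝ) := by
      simp [shift, h.symm.left_not_mem, h.right_not_mem]
    have key : ∀ z, z ≠ u → z ≠ v →
        (edist E u z : ℝ) + shift E u v F₁ F₂ z =
          edist E v z + moved E u v F₁ F₂ z * (- (edist E u v : ℝ)) ∧
        (edist E v z : ℝ) - shift E u v F₁ F₂ z =
          edist E u z + moved E u v F₁ F₂ z * (edist E u v : ℝ) := by
      intro z hzu hzv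
      have h0 : (edist E v u : ℝ) = edist E u v := by rw [edist_comm]
      have h1' : (edist E z u : ℝ) = edist E u z := by rw [edist_comm]
      have h2' : (edist E z v : ℝ) = edist E v z := by rw [edist_comm]
      by_cases h1 : z ∈ branches E u F₁
      · have h2 := h.disjoint h1
        have h3 := h.edist_add_real h1 h.right_not_mem
        simp only [shift, moved, h1, h2, true_or, if_true, if_false]
        constructor <;> linarith
      · by_cases h2 : z ∈ branches E v F₂
        · have h3 := h.symm.edist_add_real h2 h.symm.right_not_mem
          simp only [shift, moved, h1, h2, or_true, if_true, if_false]
          constructor <;> linarith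
        · simp only [shift, moved, h1, h2, or_self, if_false]
          constructor <;> ring
    intro w z
    refine le_trans (le_of_eq ?_) (h.le_edist (Equiv.swap u v w) (Equiv.swap u v z))
    have h0 : (edist E v u : ℝ) = edist E u v := by rw [edist_comm]
    have hd : ∀ a : V, (edist E a a : ℝ) = 0 := by simp
    by_cases hwu : w = u
    · subst hwu
      by_cases hzu : z = w
      · subst hzu
        simp [hsu, hru, hmv]
      · by_cases hzv : z = v
        · subst hzv
          simp [hsu, hru, hsv, hrv, hmu, hmv, h0]
        · rw [Equiv.swap_apply_left, Equiv.swap_apply_of_ne_of_ne hzu hzv, hsu, hru, hmv, hShv,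
            hrw z hzu hzv]
          linarith [(key z hzu hzv).1]
    · by_cases hwv : w = v
      · subst hwv
        by_cases hzu : z = u
        · subst hzu
          simp [hsu, hru, hsv, hrv, hmu, hmv, h0]
        · by_cases hzv : z = w
          · subst hzv
            simp [hsv, hrv, hmu]
          · rw [Equiv.swap_apply_right, Equiv.swap_apply_of_ne_of_ne hzu hzv, hsv, hrv, hmu, hShu,
              hrw z hzu hzv]
            linarith [(key z hzu hzv).2]
      · rw [Equiv.swap_apply_of_ne_of_ne hwu hwv, hsw w hwu hwv, hrw w hwu hwv]
        by_cases hzu : z = u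
        · subst hzu
          rw [Equiv.swap_apply_left, hsu, hru, hmv, hShv, edist_comm E w z, edist_comm E w v]
          linarith [(key w hwu hwv).1]
        · by_cases hzv : z = v
          · subst hzv
            rw [Equiv.swap_apply_right, hsv, hrv, hmu, hShu, edist_comm E w z, edist_comm E w u]
            linarith [(key w hwu hwv).2]
          · rw [Equiv.swap_apply_of_ne_of_ne hzu hzv, hsw z hzu hzv, hrw z hzu hzv]
  · refine mul_pos ?_ hS
    simp only [hs, sub_mul, Finset.sum_sub_distrib, sum_ind_mul]
    linarith

/-- In a hypertree, moving edges from `u` to a vertex `z` in the lighter of two other branches at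
`u` increases the distance spectral radius. -/
lemma IsTree.rho_lt_move [Nontrivial V] {x : V → ℝ} (hx : IsPerron E x) {z : V}
    {F : Finset (Finset V)} (hF : F.Nonempty) (hFE : F ⊆ E) (hFu : ∀ f ∈ F, u ∈ f)
    (he : e ∈ E) (hue : u ∈ e) (hg : g ∈ E) (hug : u ∈ g) (heg : e ≠ g) (heF : e ∉ F)
    (hgF : g ∉ F) (hle : ∑ w ∈ branch E u e, x w ≤ ∑ w ∈ branch E u g, x w)
    (hz : z ∈ branch E u e) :
    Exchangeable k E u z F ∅ ∧ rho E < rho (exchange E u z F ∅) := by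
  have hzu := ne_of_mem_branch hz
  have hFb : ∀ f ∈ E, u ∈ f → f ∉ F → ∀ w, w ∈ branch E u f → w ∉ branches E u F := by
    intro f hf huf hfF w hw hwF
    obtain ⟨f', hf', hwf'⟩ := mem_branches.1 hwF
    have := hE.branch_unique hf (hFE hf') huf (hFu f' hf') hw hwf'
    exact hfF (this ▸ hf')
  have h : Exchangeable k E u z F ∅ :=
    ⟨hE, hzu.symm, hFE, by simp, hFu, by simp, fun f hf hzf =>
      hFb e he hue heF z hz (mem_branches.2 ⟨f, hf, hzf⟩), by simp⟩
  refine ⟨h, h.rho_lt hx ?_ ?_⟩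
  · obtain ⟨f, hf⟩ := hF
    have hcard := hE.unif f (hFE hf)
    have hk := hE.two_le
    obtain ⟨y, hy, hyu⟩ := Finset.exists_mem_ne (by omega : 1 < f.card) u
    simp only [branches, Finset.biUnion_empty, Finset.sum_empty]
    exact Finset.sum_pos (fun w _ => hx.pos w) ⟨y, h.mem_branches_of_mem hf hy hyu⟩
  · set t : ℝ := (edist E u z : ℝ) with ht
    have ht0 : 0 < t := by
      rw [ht, Nat.cast_pos]
      exact hE.conn.pos_dist_of_ne hzu.symm
    have hpt : ∀ w, t * (ind {u} w + ind (branch E u g) w - ind (branch E u e) w) ≤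
        shift E u z F ∅ w := by
      intro w
      have hnone : w ∉ branches E z ∅ := by simp [branches]
      by_cases hwF : w ∈ branches E u F
      · have h1 : w ≠ u := fun hh => h.left_not_mem (hh ▸ hwF)
        have h2 : w ∉ branch E u e := fun hh => hFb e he hue heF w hh hwF
        have h3 : w ∉ branch E u g := fun hh => hFb g hg hug hgF w hh hwF
        simp [ind, h1, h2, h3, shift, hwF]
      · simp only [shift, hwF, hnone, or_self, if_false]
        by_cases hwe : w ∈ branch E u e
        · have h1 : w ≠ u := ne_of_mem_branch hwe
          have h3 : w ∉ branch E u g := fun hh => heg (hE.branch_unique he hg hue hug hwe hh)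
          have h4 : (edist E u w : ℝ) ≤ edist E u z + edist E z w := by
            exact_mod_cast edist_triangle hE.conn u z w
          simp only [ind, Finset.mem_singleton, h1, hwe, h3, if_true, if_false]
          linarith
        · have h4 : (edist E z w : ℝ) = edist E u z + edist E u w := by
            rw [hE.edist_add he hue hz hwe, edist_comm E z u]
            push_cast
            ring
          have h5 : ind {u} w + ind (branch E u g) w ≤ 1 := by
            by_cases h1 : w = u
            · subst h1
              simp [ind, not_mem_branch_self]
            · simp only [ind, Finset.mem_singleton, h1, if_false, zero_add]
              split_ifs <;> norm_num
          have h6 : ind (branch E u e) w = 0 := by simp [ind, hwe]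
          rw [h6, h4, ← ht]
          nlinarith
    have h1 : ∑ w, t * (ind {u} w + ind (branch E u g) w - ind (branch E u e) w) * x w ≤
        ∑ w, shift E u z F ∅ w * x w :=
      Finset.sum_le_sum fun w _ => mul_le_mul_of_nonneg_right (hpt w) (hx.pos w).le
    refine lt_of_lt_of_le ?_ h1
    simp only [mul_assoc, ← Finset.mul_sum, sub_mul, add_mul, Finset.sum_sub_distrib,
      Finset.sum_add_distrib, sum_ind_mul, Finset.sum_singleton]
    exact mul_pos ht0 (by linarith [hx.pos u])

/-- A vertex of degree at least two has an edge that does not lead towards `z`. -/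
lemma IsTree.exists_edge_away {w : V} (hw : 2 ≤ deg E w) (z : V) :
    ∃ f ∈ E, w ∈ f ∧ z ∉ branch E w f ∧ ∃ y ∈ f, y ≠ w := by
  have hk := hE.two_le
  obtain ⟨f₁, h1, f₂, h2, hne⟩ := Finset.one_lt_card.1 hw
  simp only [Finset.mem_filter] at h1 h2
  have hy : ∀ f ∈ E, ∃ y ∈ f, y ≠ w := fun f hf =>
    Finset.exists_mem_ne (by have := hE.unif f hf; omega : 1 < f.card) w
  by_cases hz : z ∈ branch E w f₁
  · exact ⟨f₂, h2.1, h2.2, fun hz' => hne (hE.branch_unique h1.1 h2.1 h1.2 h2.2 hz hz'),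
      hy f₂ h2.1⟩
  · exact ⟨f₁, h1.1, h1.2, hz, hy f₁ h1.1⟩

/-- From a vertex of degree at least two one can move farther away from any given vertex. -/
lemma IsTree.exists_farther {w : V} (hw : 2 ≤ deg E w) (z : V) :
    ∃ f ∈ E, w ∈ f ∧ ∃ y ∈ f, y ≠ w ∧ edist E z y = edist E z w + 1 := by
  obtain ⟨f, hf, hwf, hz, y, hy, hyw⟩ := hE.exists_edge_away hw z
  exact ⟨f, hf, hwf, y, hy, hyw, hE.edist_of_not_mem_branch hf hwf hz hy hyw⟩

lemma IsTree.deg_pos [Nontrivial V] (w : V) : 0 < deg E w := by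
  obtain ⟨z, hz⟩ := exists_ne w
  obtain ⟨f, hf, hwf, -⟩ := hE.exists_branch hz
  exact Finset.card_pos.2 ⟨f, by simp [hf, hwf]⟩

/-- Every branch contains a vertex of degree one. -/
lemma IsTree.exists_deg_one [Nontrivial V] (he : e ∈ E) (hu : u ∈ e) :
    ∃ z ∈ branch E u e, deg E z = 1 := by
  have hk := hE.two_le
  obtain ⟨y, hy, hyu⟩ := Finset.exists_mem_ne (by have := hE.unif e he; omega : 1 < e.card) u
  obtain ⟨z, hz, hmax⟩ := Finset.exists_max_image (branch E u e) (edist E u)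
    ⟨y, hE.mem_branch_of_mem hy hyu⟩
  refine ⟨z, hz, le_antisymm ?_ (hE.deg_pos z)⟩
  by_contra hdeg
  obtain ⟨f, hf, hzf, y', hy', -, hd⟩ := hE.exists_farther (by omega : 2 ≤ deg E z) u
  have hy'u : y' ≠ u := by
    rintro rfl
    simp at hd
  have := hmax y' (hE.branch_closed he hu hf hz hzf hy' hy'u)
  omega

end Full

/-! ### Hypertrees of maximum distance spectral radius -/

/-- The class of `k`-uniform hypertrees on `V` with `m` edges, all degrees at most `Δ`, and
exactly `n` vertices of degree `Δ`. -/
structure InClass (k m Δ n : ℕ) (E : Finset (Finset V)) : Prop where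
  tree : IsTree k E
  card : E.card = m
  deg_le : ∀ v, deg E v ≤ Δ
  card_deg : (Finset.univ.filter (deg E · = Δ)).card = n

/-- `E` has maximum distance spectral radius in its class. -/
structure IsMaximizer (k m Δ n : ℕ) (E : Finset (Finset V)) : Prop where
  mem : InClass k m Δ n E
  le : ∀ E' : Finset (Finset V), InClass k m Δ n E' → rho E' ≤ rho E

/-- An exchange preserves the class if it permutes the vertices of degree `Δ`. -/
lemma InClass.exchange {k m Δ n : ℕ} {E : Finset (Finset V)} (hE : InClass k m Δ n E) {u v : V}
    {F₁ F₂ : Finset (Finset V)} (h : Exchangeable k E u v F₁ F₂) (τ : Equiv.Perm V)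
    (hle : ∀ w, deg (exchange E u v F₁ F₂) w ≤ Δ)
    (hτ : ∀ w, deg (Hypertree.exchange E u v F₁ F₂) w = Δ ↔ deg E (τ w) = Δ) :
    InClass k m Δ n (Hypertree.exchange E u v F₁ F₂) := by
  refine ⟨h.isTree, h.card_exchange.trans hE.card, hle, ?_⟩
  rw [← hE.card_deg]
  refine Finset.card_bij (fun w _ => τ w) ?_ ?_ ?_
  · intro w hw
    simpa [hτ] using hw
  · intro a _ b _ hab
    exact τ.injective hab
  · intro b hb
    exact ⟨τ.symm b, by simpa [hτ] using hb, by simp⟩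

/-- If an exchange permutes the degrees of `u` and `v`, the class is preserved. -/
lemma InClass.exchange_swap {k m Δ n : ℕ} {E : Finset (Finset V)} (hE : InClass k m Δ n E)
    {u v : V} {F₁ F₂ : Finset (Finset V)} (h : Exchangeable k E u v F₁ F₂)
    (hdeg : deg E u + F₂.card = deg E v + F₁.card) :
    InClass k m Δ n (Hypertree.exchange E u v F₁ F₂) := by
  have key : ∀ w, deg (Hypertree.exchange E u v F₁ F₂) w = deg E (Equiv.swap u v w) := by
    intro w
    have h1 := h.deg_left
    have h2 := h.deg_right
    by_cases hu : w = u
    · subst hu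
      rw [Equiv.swap_apply_left]
      omega
    · by_cases hv : w = v
      · subst hv
        rw [Equiv.swap_apply_right]
        omega
      · rw [Equiv.swap_apply_of_ne_of_ne hu hv, h.deg_of_ne hu hv]
  exact hE.exchange h (Equiv.swap u v) (fun w => by rw [key]; exact hE.deg_le _)
    (fun w => by rw [key])

section Maximizer

variable [Nontrivial V] {k m Δ n : ℕ} {E : Finset (Finset V)} (hE : IsMaximizer k m Δ n E)
include hE

/-- In a maximizer, every degree is `1`, `2` or `Δ`. -/
lemma IsMaximizer.deg_le_two (hΔ : 3 ≤ Δ) {v : V} (hv : deg E v ≠ Δ) : deg E v ≤ 2 := by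
  by_contra hdeg
  have hT := hE.mem.tree
  obtain ⟨x, hx⟩ := exists_isPerron hT.conn
  obtain ⟨e₁, e₂, e₃, h1, h2, h3, h12, h13, h23⟩ :=
    Finset.two_lt_card_iff.1 (by rw [deg] at hdeg; omega : 2 < (E.filter (v ∈ ·)).card)
  simp only [Finset.mem_filter] at h1 h2 h3
  have key : ∀ e g, e ∈ E → v ∈ e → g ∈ E → v ∈ g → e ≠ g → e ≠ e₃ → g ≠ e₃ →
      ¬ ∑ w ∈ branch E v e, x w ≤ ∑ w ∈ branch E v g, x w := by
    intro e g he hve hg hvg heg he3 hg3 hle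
    obtain ⟨z, hz, hzd⟩ := hT.exists_deg_one he hve
    obtain ⟨h, hlt⟩ := hT.rho_lt_move hx (F := {e₃}) (by simp) (by simpa using h3.1)
      (by simpa using h3.2) he hve hg hvg heg (by simpa using he3) (by simpa using hg3) hle hz
    have hdeg' : ∀ w, deg (exchange E v z {e₃} ∅) w ≤ Δ ∧
        (deg (exchange E v z {e₃} ∅) w = Δ ↔ deg E w = Δ) := by
      intro w
      have hd1 := h.deg_left
      have hd2 := h.deg_right
      simp only [Finset.card_singleton, Finset.card_empty] at hd1 hd2
      have hv' := hE.mem.deg_le v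
      by_cases hwv : w = v
      · subst hwv
        omega
      · by_cases hwz : w = z
        · subst hwz
          omega
        · simp [h.deg_of_ne hwv hwz, hE.mem.deg_le w]
    exact absurd (hE.le _ (hE.mem.exchange h 1 (fun w => (hdeg' w).1) fun w => (hdeg' w).2))
      (not_le.2 hlt)
  rcases le_total (∑ w ∈ branch E v e₁, x w) (∑ w ∈ branch E v e₂, x w) with hle | hle
  · exact key e₁ e₂ h1.1 h1.2 h2.1 h2.2 h12 h13 h23 hle
  · exact key e₂ e₁ h2.1 h2.2 h1.1 h1.2 h12.symm h23 h13 hle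

/-- The case of `no_three_branches` in which the masses of the branches are sorted: `e₃` at `v` is
exchanged with an edge `g` at a neighbour `y` of `v` in `e₁`. -/
lemma IsMaximizer.three_branches_aux {x : V → ℝ} (hx : IsPerron E x) {v : V}
    {e₁ e₂ e₃ : Finset V} (h1 : e₁ ∈ E) (h2 : e₂ ∈ E) (h3 : e₃ ∈ E) (hv1 : v ∈ e₁) (hv2 : v ∈ e₂)
    (hv3 : v ∈ e₃) (h12 : e₁ ≠ e₂) (h13 : e₁ ≠ e₃) (h23 : e₂ ≠ e₃)
    (hle12 : ∑ w ∈ branch E v e₁, x w ≤ ∑ w ∈ branch E v e₂, x w)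
    (hle23 : ∑ w ∈ branch E v e₂, x w ≤ ∑ w ∈ branch E v e₃, x w) {y : V} (hy : y ∈ e₁)
    (hyv : y ≠ v) (hdeg : 2 ≤ deg E y) : False := by
  have hT := hE.mem.tree
  obtain ⟨g, hg, hyg, hvg, -⟩ := hT.exists_edge_away hdeg v
  have hyb : y ∈ branch E v e₁ := hT.mem_branch_of_mem hy hyv
  -- the branch of `g` at `y` is a proper part of the branch of `e₁` at `v`
  have hsub : ∀ w ∈ branch E y g, w ∈ branch E v e₁ := by
    intro w hw
    have h4 := hT.edist_add hg hyg hw hvg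
    refine mem_branch.2 ⟨y, hy, ?_⟩
    have : edist E y v ≠ 0 := fun h0 => hyv ((edist_eq_zero hT.conn).1 h0)
    omega
  have h : Exchangeable k E v y {e₃} {g} := by
    refine ⟨hT, hyv.symm, by simpa using h3, by simpa using hg, by simpa using hv3,
      by simpa using hyg, ?_, by simpa using hvg⟩
    simp only [Finset.mem_singleton, forall_eq]
    exact fun hh => h13 (hT.branch_unique h1 h3 hv1 hv3 hyb hh)
  refine absurd (hE.le _ (hE.mem.exchange h 1 ?_ ?_)) (not_le.2 (h.rho_lt hx ?_ ?_))
  · intro w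
    have hd1 := h.deg_left
    have hd2 := h.deg_right
    simp only [Finset.card_singleton, add_left_inj] at hd1 hd2
    by_cases hwv : w = v
    · rw [hwv, hd1]
      exact hE.mem.deg_le v
    · by_cases hwy : w = y
      · rw [hwy, hd2]
        exact hE.mem.deg_le y
      · rw [h.deg_of_ne hwv hwy]
        exact hE.mem.deg_le w
  · intro w
    have hd1 := h.deg_left
    have hd2 := h.deg_right
    simp only [Finset.card_singleton, add_left_inj] at hd1 hd2
    by_cases hwv : w = v
    · rw [hwv, hd1]
      rfl
    · by_cases hwy : w = y
      · rw [hwy, hd2]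
        rfl
      · rw [h.deg_of_ne hwv hwy]
        rfl
  · simp only [branches, Finset.singleton_biUnion]
    have : ∑ w ∈ branch E y g, x w < ∑ w ∈ branch E v e₁, x w :=
      Finset.sum_lt_sum_of_subset hsub hyb (not_mem_branch_self E y g) (hx.pos y)
        fun w _ _ => (hx.pos w).le
    linarith
  · have hpt : ∀ w, ind {v} w + ind (branch E v e₂) w - ind (branch E v e₁) w ≤
        shift E v y {e₃} {g} w := by
      intro w
      have hb3 : w ∈ branches E v {e₃} ↔ w ∈ branch E v e₃ := by simp [branches]
      have hbg : w ∈ branches E y {g} ↔ w ∈ branch E y g := by simp [branches]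
      simp only [shift, hb3, hbg]
      have hvv := not_mem_branch_self E v
      by_cases hw1 : w ∈ branch E v e₁
      · have hwv : w ≠ v := ne_of_mem_branch hw1
        have hw2 : w ∉ branch E v e₂ := fun hh => h12 (hT.branch_unique h1 h2 hv1 hv2 hw1 hh)
        simp only [ind, Finset.mem_singleton, hwv, hw2, hw1, if_true, if_false]
        split_ifs
        · norm_num
        · have : (edist E v w : ℝ) ≤ edist E y w + 1 := by
            have h4 := edist_le_succ hT.conn h1 hv1 hy w
            rw [edist_comm E v w, edist_comm E y w]
            exact_mod_cast h4
          linarith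
      · have hwg : w ∉ branch E y g := fun hh => hw1 (hsub w hh)
        by_cases hw3 : w ∈ branch E v e₃
        · have hwv : w ≠ v := ne_of_mem_branch hw3
          have hw2 : w ∉ branch E v e₂ := fun hh => h23 (hT.branch_unique h2 h3 hv2 hv3 hh hw3)
          simp [ind, hwv, hw2, hw1, hw3]
        · have h4 : (edist E y w : ℝ) = 1 + edist E v w := by
            rw [hT.edist_add h1 hv1 hyb hw1, edist_eq_one h1 hy hv1 hyv]
            push_cast
            ring
          have h5 : ind {v} w + ind (branch E v e₂) w ≤ 1 := by
            by_cases hwv : w = v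
            · subst hwv
              simp [ind, hvv]
            · simp only [ind, Finset.mem_singleton, hwv, if_false, zero_add]
              split_ifs <;> norm_num
          have h6 : ind (branch E v e₁) w = 0 := by simp [ind, hw1]
          simp only [hw3, hwg, or_self, if_false]
          linarith
    have h4 : ∑ w, (ind {v} w + ind (branch E v e₂) w - ind (branch E v e₁) w) * x w ≤
        ∑ w, shift E v y {e₃} {g} w * x w :=
      Finset.sum_le_sum fun w _ => mul_le_mul_of_nonneg_right (hpt w) (hx.pos w).le
    refine lt_of_lt_of_le ?_ h4
    simp only [sub_mul, add_mul, Finset.sum_sub_distrib, Finset.sum_add_distrib, sum_ind_mul,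
      Finset.sum_singleton]
    linarith [hx.pos v]

/-- In a maximizer, at most two edges at a vertex `v` contain another vertex of degree at least
two: otherwise the heaviest of three such branches at `v` could be exchanged with a branch at a
neighbour of `v` inside the lightest one. -/
lemma IsMaximizer.no_three_branches {v : V} {e₁ e₂ e₃ : Finset V} (h1 : e₁ ∈ E) (h2 : e₂ ∈ E)
    (h3 : e₃ ∈ E) (hv1 : v ∈ e₁) (hv2 : v ∈ e₂) (hv3 : v ∈ e₃) (h12 : e₁ ≠ e₂) (h13 : e₁ ≠ e₃)
    (h23 : e₂ ≠ e₃) (hy1 : ∃ y ∈ e₁, y ≠ v ∧ 2 ≤ deg E y) (hy2 : ∃ y ∈ e₂, y ≠ v ∧ 2 ≤ deg E y)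
    (hy3 : ∃ y ∈ e₃, y ≠ v ∧ 2 ≤ deg E y) : False := by
  obtain ⟨x, hx⟩ := exists_isPerron hE.mem.tree.conn
  obtain ⟨y1, hy1, hn1, hd1⟩ := hy1
  obtain ⟨y2, hy2, hn2, hd2⟩ := hy2
  obtain ⟨y3, hy3, hn3, hd3⟩ := hy3
  rcases le_total (∑ w ∈ branch E v e₁, x w) (∑ w ∈ branch E v e₂, x w) with ha | ha <;>
  rcases le_total (∑ w ∈ branch E v e₂, x w) (∑ w ∈ branch E v e₃, x w) with hb | hb <;>
  rcases le_total (∑ w ∈ branch E v e₁, x w) (∑ w ∈ branch E v e₃, x w) with hc | hc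
  · exact hE.three_branches_aux hx h1 h2 h3 hv1 hv2 hv3 h12 h13 h23 ha hb hy1 hn1 hd1
  · exact hE.three_branches_aux hx h1 h2 h3 hv1 hv2 hv3 h12 h13 h23 ha hb hy1 hn1 hd1
  · exact hE.three_branches_aux hx h1 h3 h2 hv1 hv3 hv2 h13 h12 h23.symm hc hb hy1 hn1 hd1
  · exact hE.three_branches_aux hx h3 h1 h2 hv3 hv1 hv2 h13.symm h23.symm h12 hc ha hy3 hn3 hd3
  · exact hE.three_branches_aux hx h2 h1 h3 hv2 hv1 hv3 h12.symm h23 h13 ha hc hy2 hn2 hd2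
  · exact hE.three_branches_aux hx h2 h3 h1 hv2 hv3 hv1 h23 h12.symm h13.symm hb hc hy2 hn2 hd2
  · exact hE.three_branches_aux hx h3 h2 h1 hv3 hv2 hv1 h23.symm h13.symm h12.symm hb ha hy3 hn3
      hd3
  · exact hE.three_branches_aux hx h3 h2 h1 hv3 hv2 hv1 h23.symm h13.symm h12.symm hb ha hy3 hn3
      hd3

/-- The case of `no_three_in_edge` in which the masses of the three parts are sorted: the part at
`v₃` is exchanged with a part at a neighbour `z` of `v₁` outside `e`. -/
lemma IsMaximizer.three_in_edge_aux {x : V → ℝ} (hx : IsPerron E x) {e : Finset V}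
    (he : e ∈ E) {v₁ v₂ v₃ : V} (h1 : v₁ ∈ e) (h2 : v₂ ∈ e) (h3 : v₃ ∈ e) (h12 : v₁ ≠ v₂)
    (h13 : v₁ ≠ v₃) (h23 : v₂ ≠ v₃)
    (hle12 : ∑ w ∈ (branch E v₁ e)ᶜ, x w ≤ ∑ w ∈ (branch E v₂ e)ᶜ, x w)
    (hle23 : ∑ w ∈ (branch E v₂ e)ᶜ, x w ≤ ∑ w ∈ (branch E v₃ e)ᶜ, x w)
    (hdeg : 2 ≤ deg E v₁) : False := by
  have hT := hE.mem.tree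
  obtain ⟨g, hg, h1g, h2g, z, hz, hz1⟩ := hT.exists_edge_away hdeg v₂
  have heg : e ≠ g := by
    rintro rfl
    exact h2g (hT.mem_branch_of_mem h2 h12.symm)
  -- the closest vertex of `e` is unique
  have hsep : ∀ w a b, a ∈ e → b ∈ e → a ≠ b → w ∉ branch E a e → w ∈ branch E b e := by
    intro w a b ha hb hab hw
    refine mem_branch.2 ⟨a, ha, ?_⟩
    rw [hT.edist_of_not_mem_branch he ha hw hb hab.symm]
    omega
  have hzb : z ∈ branch E v₁ g := hT.mem_branch_of_mem hz hz1
  have hz1e : z ∉ branch E v₁ e := fun hh => heg (hT.branch_unique he hg h1 h1g hh hzb)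
  have hz3 : z ∈ branch E v₃ e := hsep z v₁ v₃ h1 h3 h13 hz1e
  have h1z : v₁ ∈ branch E z g := hT.mem_branch_of_mem h1g hz1.symm
  have hsmall : ∀ w, w ∉ branch E z g → w ∉ branch E v₁ e ∧ w ≠ v₁ := by
    intro w hw
    have h4 := hT.edist_of_not_mem_branch hg hz hw h1g hz1.symm
    have h5 : w ∈ branch E v₁ g := mem_branch.2 ⟨z, hz, by omega⟩
    exact ⟨fun hh => heg (hT.branch_unique he hg h1 h1g hh h5), ne_of_mem_branch h5⟩
  have h3z : v₃ ∈ branch E z g := by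
    by_contra hh
    exact (hsmall v₃ hh).1 (hT.mem_branch_of_mem h3 h13.symm)
  have hex := hT.exchangeable_otherEdges he h3 hg hz hz3 h3z
  refine absurd (hE.le _ (hE.mem.exchange_swap hex ?_))
    (not_le.2 (hT.rho_lt_exchange_otherEdges he h3 hg hz hz3 h3z hx ?_ ?_))
  · have h4 := card_otherEdges he h3
    have h5 := card_otherEdges hg hz
    omega
  · have : ∑ w ∈ (branch E z g)ᶜ, x w < ∑ w ∈ (branch E v₁ e)ᶜ, x w := by
      refine Finset.sum_lt_sum_of_subset (i := v₁) (fun w hw => ?_) ?_ ?_ (hx.pos _)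
        fun w _ _ => (hx.pos w).le
      · simp only [Finset.mem_compl] at hw ⊢
        exact (hsmall w hw).1
      · simp [not_mem_branch_self]
      · simpa using h1z
    linarith
  · have hpt : ∀ w, ind {v₁} w + ind (branch E v₂ e)ᶜ w - ind (branch E v₁ e)ᶜ w ≤
        if w ∈ branch E v₃ e ∧ w ∈ branch E z g then
          (edist E z w : ℝ) - edist E v₃ w else 0 := by
      intro w
      by_cases hw1 : w ∈ branch E v₁ e
      · have hwz : w ∈ branch E z g := by
          by_contra hh
          exact (hsmall w hh).1 hw1
        have hwv : w ≠ v₁ := ne_of_mem_branch hw1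
        by_cases hw3 : w ∈ branch E v₃ e
        · obtain ⟨y, hy, hy1, hg1⟩ := hT.exists_gate_branch he hw1
          have hy3 : y ≠ v₃ := by
            rintro rfl
            obtain ⟨y', hy', hy'3, hg3⟩ := hT.exists_gate_branch he hw3
            have h4 := hg1 y' hy' hy'3
            have h5 := hg3 y hy hy'3.symm
            omega
          have h4 := hg1 v₁ h1 hy1.symm
          have h5 := hg1 v₃ h3 hy3.symm
          have h6 := hT.edist_add he h1 hw1 hz1e
          have h7 := edist_eq_one hg h1g hz hz1.symm
          have h8 : (edist E z w : ℝ) = edist E v₃ w + 1 := by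
            rw [edist_comm E z w, edist_comm E v₃ w]
            exact_mod_cast (by omega : edist E w z = edist E w v₃ + 1)
          simp only [hw3, hwz, and_self, if_true, ind, Finset.mem_singleton, hwv, if_false,
            Finset.mem_compl, hw1, not_true]
          split_ifs <;> linarith
        · have hw2 : w ∈ branch E v₂ e := hsep w v₃ v₂ h3 h2 h23.symm hw3
          simp [hw3, ind, hwv, hw1, hw2]
      · have hw2 : w ∈ branch E v₂ e := hsep w v₁ v₂ h1 h2 h12 hw1
        have hw3 : w ∈ branch E v₃ e := hsep w v₁ v₃ h1 h3 h13 hw1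
        have h4 := hT.edist_of_not_mem_branch he h1 hw1 h3 h13.symm
        simp only [hw3, true_and, ind, Finset.mem_compl, hw2, not_true, hw1, not_false_eq_true,
          if_true, if_false, Finset.mem_singleton]
        have h5 := edist_le_succ hT.conn hg h1g hz w
        have h6 : (edist E v₃ w : ℝ) ≤ edist E z w + 2 := by
          rw [edist_comm E z w, edist_comm E v₃ w]
          exact_mod_cast (by omega : edist E w v₃ ≤ edist E w z + 2)
        by_cases hwz : w ∈ branch E z g
        · by_cases hwv : w = v₁
          · subst hwv
            have h7 : edist E w z = 1 := edist_eq_one hg h1g hz hz1.symm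
            have h8 : edist E w v₃ = 1 := edist_eq_one he h1 h3 h13
            simp [hwz, edist_comm E z w, edist_comm E v₃ w, h7, h8]
          · simp only [hwz, if_true, hwv, if_false]
            by_cases hw1g : w ∈ branch E v₁ g
            · obtain ⟨y, hy, hyz, hgz⟩ := hT.exists_gate_branch hg hwz
              have hy1 : y ≠ v₁ := by
                rintro rfl
                obtain ⟨y', hy', hy'1, hg1⟩ := hT.exists_gate_branch hg hw1g
                have h7 := hgz y' hy' hy'1
                have h8 := hg1 y hy hy'1.symm
                omega
              have h7 := hgz z hz hyz.symm
              have h8 := hgz v₁ h1g hy1.symm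
              have h9 : (edist E v₃ w : ℝ) = edist E z w + 1 := by
                rw [edist_comm E z w, edist_comm E v₃ w]
                exact_mod_cast (by omega : edist E w v₃ = edist E w z + 1)
              linarith
            · have h7 := hT.edist_of_not_mem_branch hg h1g hw1g hz hz1
              have h8 : (edist E v₃ w : ℝ) = edist E z w := by
                rw [edist_comm E z w, edist_comm E v₃ w]
                exact_mod_cast (by omega : edist E w v₃ = edist E w z)
              linarith
        · simp only [hwz, if_false]
          split_ifs <;> norm_num
    have h4 : ∑ w, (ind {v₁} w + ind (branch E v₂ e)ᶜ w - ind (branch E v₁ e)ᶜ w) * x w ≤ _ :=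
      Finset.sum_le_sum fun w _ => mul_le_mul_of_nonneg_right (hpt w) (hx.pos w).le
    refine lt_of_lt_of_le ?_ h4
    simp only [sub_mul, add_mul, Finset.sum_sub_distrib, Finset.sum_add_distrib, sum_ind_mul,
      Finset.sum_singleton]
    linarith [hx.pos v₁]

/-- In a maximizer, at most two vertices of an edge `e` have degree at least two: otherwise the
heaviest of the three parts hanging off `e` could be exchanged with a part hanging off another
edge inside the lightest one. -/
lemma IsMaximizer.no_three_in_edge {e : Finset V} (he : e ∈ E) {v₁ v₂ v₃ : V} (h1 : v₁ ∈ e)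
    (h2 : v₂ ∈ e) (h3 : v₃ ∈ e) (h12 : v₁ ≠ v₂) (h13 : v₁ ≠ v₃) (h23 : v₂ ≠ v₃)
    (hd1 : 2 ≤ deg E v₁) (hd2 : 2 ≤ deg E v₂) (hd3 : 2 ≤ deg E v₃) : False := by
  obtain ⟨x, hx⟩ := exists_isPerron hE.mem.tree.conn
  rcases le_total (∑ w ∈ (branch E v₁ e)ᶜ, x w) (∑ w ∈ (branch E v₂ e)ᶜ, x w) with ha | ha <;>
  rcases le_total (∑ w ∈ (branch E v₂ e)ᶜ, x w) (∑ w ∈ (branch E v₃ e)ᶜ, x w) with hb | hb <;>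
  rcases le_total (∑ w ∈ (branch E v₁ e)ᶜ, x w) (∑ w ∈ (branch E v₃ e)ᶜ, x w) with hc | hc
  · exact hE.three_in_edge_aux hx he h1 h2 h3 h12 h13 h23 ha hb hd1
  · exact hE.three_in_edge_aux hx he h1 h2 h3 h12 h13 h23 ha hb hd1
  · exact hE.three_in_edge_aux hx he h1 h3 h2 h13 h12 h23.symm hc hb hd1
  · exact hE.three_in_edge_aux hx he h3 h1 h2 h13.symm h23.symm h12 hc ha hd3
  · exact hE.three_in_edge_aux hx he h2 h1 h3 h12.symm h23 h13 ha hc hd2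
  · exact hE.three_in_edge_aux hx he h2 h3 h1 h23 h12.symm h13.symm hb hc hd2
  · exact hE.three_in_edge_aux hx he h3 h2 h1 h23.symm h13.symm h12.symm hb ha hd3
  · exact hE.three_in_edge_aux hx he h3 h2 h1 h23.symm h13.symm h12.symm hb ha hd3

end Maximizer

/-! ### The spine of a maximizer -/

/-- A geodesic `u 0, …, u M` with edges `ed 0, …, ed (M - 1)` whose inner vertices are exactly the
vertices of degree at least two. -/
structure Spine (E : Finset (Finset V)) (M : ℕ) (u : ℕ → V) (ed : ℕ → Finset V) : Prop where
  two_le : 2 ≤ M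
  edist_eq : ∀ i j, i ≤ j → j ≤ M → edist E (u i) (u j) = j - i
  edge_mem : ∀ i < M, ed i ∈ E
  left_mem : ∀ i < M, u i ∈ ed i
  right_mem : ∀ i < M, u (i + 1) ∈ ed i
  inner_iff : ∀ w, 2 ≤ deg E w ↔ ∃ i, 0 < i ∧ i < M ∧ u i = w

section Diametral

variable {E : Finset (Finset V)} {M : ℕ} {u : ℕ → V} {ed : ℕ → Finset V}

/-- A path realizing the diameter. -/
lemma exists_diametral (hE : (twoSection E).Connected) :
    ∃ (M : ℕ) (u : ℕ → V) (ed : ℕ → Finset V), (∀ a b, edist E a b ≤ M) ∧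
      (∀ i j, i ≤ j → j ≤ M → edist E (u i) (u j) = j - i) ∧
      ∀ i < M, ed i ∈ E ∧ u i ∈ ed i ∧ u (i + 1) ∈ ed i := by
  obtain ⟨r⟩ := hE.nonempty
  obtain ⟨⟨a, b⟩, -, hmax⟩ := Finset.exists_max_image (Finset.univ : Finset (V × V))
    (fun p => edist E p.1 p.2) ⟨(r, r), Finset.mem_univ _⟩
  obtain ⟨p, hp⟩ := hE.exists_walk_length_eq_dist a b
  have hadj : ∀ i < edist E a b, (twoSection E).Adj (p.getVert i) (p.getVert (i + 1)) :=
    fun i hi => p.adj_getVert_succ (by rw [hp]; exact hi)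
  have hed : ∀ i, ∃ e, i < edist E a b → e ∈ E ∧ p.getVert i ∈ e ∧ p.getVert (i + 1) ∈ e := by
    intro i
    by_cases hi : i < edist E a b
    · obtain ⟨-, e, he⟩ := hadj i hi
      exact ⟨e, fun _ => he⟩
    · exact ⟨∅, fun h => absurd h hi⟩
  choose ed hed using hed
  refine ⟨edist E a b, p.getVert, ed, fun c d => hmax (c, d) (Finset.mem_univ _), ?_, hed⟩
  have hle : ∀ i l, i + l ≤ edist E a b → edist E (p.getVert i) (p.getVert (i + l)) ≤ l := by
    intro i l
    induction l with
    | zero => simp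
    | succ l ih =>
      intro hl
      obtain ⟨he, h1, h2⟩ := hed (i + l) (by omega)
      have h3 := edist_triangle hE (p.getVert i) (p.getVert (i + l)) (p.getVert (i + l + 1))
      have h4 := edist_le_one he h1 h2
      have h5 := ih (by omega)
      rw [← add_assoc]
      omega
  intro i j hij hj
  have h0 : edist E (p.getVert 0) (p.getVert (edist E a b)) = edist E a b := by
    have hb : p.getVert (edist E a b) = b := by
      rw [edist, ← hp]
      exact p.getVert_length
    rw [p.getVert_zero, hb]
  have h1 := hle 0 i (by omega)
  have h2 := hle i (j - i) (by omega)
  have h3 := hle j (edist E a b - j) (by omega)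
  rw [zero_add] at h1
  rw [Nat.add_sub_cancel' hij] at h2
  rw [Nat.add_sub_cancel' hj] at h3
  have h4 := edist_triangle hE (p.getVert 0) (p.getVert i) (p.getVert (edist E a b))
  have h5 := edist_triangle hE (p.getVert i) (p.getVert j) (p.getVert (edist E a b))
  omega

variable {k : ℕ} (hE : IsTree k E)
  (hu : ∀ i j, i ≤ j → j ≤ M → edist E (u i) (u j) = j - i)
  (hed : ∀ i < M, ed i ∈ E ∧ u i ∈ ed i ∧ u (i + 1) ∈ ed i)
include hE hu hed

lemma geodesic_edge_ne {i : ℕ} (hi : i + 1 < M) : ed i ≠ ed (i + 1) := by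
  intro h
  obtain ⟨h1, h2, -⟩ := hed i (by omega)
  obtain ⟨-, -, h3⟩ := hed (i + 1) hi
  rw [← h] at h3
  have h4 := edist_le_one h1 h2 h3
  rw [hu i (i + 1 + 1) (by omega) (by omega)] at h4
  omega

lemma geodesic_mem_branch_right {i j : ℕ} (hij : i < j) (hj : j ≤ M) :
    u j ∈ branch E (u i) (ed i) := by
  obtain ⟨-, -, h3⟩ := hed i (by omega)
  refine mem_branch.2 ⟨_, h3, ?_⟩
  rw [edist_comm E (u j), edist_comm E (u j), hu i j hij.le hj, hu (i + 1) j hij hj]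
  omega

lemma geodesic_mem_branch_left {i j : ℕ} (hij : i ≤ j) (hj : j < M) :
    u i ∈ branch E (u (j + 1)) (ed j) := by
  obtain ⟨-, h2, -⟩ := hed j hj
  refine mem_branch.2 ⟨_, h2, ?_⟩
  rw [hu i j hij hj.le, hu i (j + 1) (by omega) hj]
  omega

lemma geodesic_inner_deg {i : ℕ} (hi : 0 < i) (hiM : i < M) : 2 ≤ deg E (u i) := by
  obtain ⟨j, rfl⟩ : ∃ j, i = j + 1 := ⟨i - 1, by omega⟩
  obtain ⟨h1, -, h3⟩ := hed j (by omega)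
  obtain ⟨h4, h5, -⟩ := hed (j + 1) hiM
  exact Finset.one_lt_card.2 ⟨ed j, by simp [h1, h3], ed (j + 1), by simp [h4, h5],
    geodesic_edge_ne hE hu hed hiM⟩

end Diametral

section Maximizer

variable [Nontrivial V] {k m Δ n : ℕ} {E : Finset (Finset V)} (hE : IsMaximizer k m Δ n E)
include hE

/-- All vertices of degree at least two lie on a diametral path of a maximizer. -/
lemma IsMaximizer.inner_of_deg {M : ℕ} {u : ℕ → V} {ed : ℕ → Finset V} (hM : 2 ≤ M)
    (hdiam : ∀ a b, edist E a b ≤ M)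
    (hu : ∀ i j, i ≤ j → j ≤ M → edist E (u i) (u j) = j - i)
    (hed : ∀ i < M, ed i ∈ E ∧ u i ∈ ed i ∧ u (i + 1) ∈ ed i) {w : V} (hw : 2 ≤ deg E w) :
    ∃ i, 0 < i ∧ i < M ∧ u i = w := by
  have hT := hE.mem.tree
  induction hd : edist E (u 1) w using Nat.strong_induction_on generalizing w with
  | _ d ih =>
    subst hd
    by_contra hnot
    have hne : ∀ i, 0 < i → i < M → w ≠ u i := fun i h1 h2 h3 => hnot ⟨i, h1, h2, h3.symm⟩
    obtain ⟨g, hg, hwg, y, hyg, hd⟩ := exists_closer hT.conn (hne 1 (by omega) (by omega))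
    -- the neighbour `y` of `w` closer to `u 1` is an inner vertex of the path
    obtain ⟨i, hi0, hiM, hig⟩ : ∃ i, 0 < i ∧ i < M ∧ u i ∈ g := by
      by_cases hy1 : y = u 1
      · exact ⟨1, by omega, by omega, hy1 ▸ hyg⟩
      · obtain ⟨f, hf, hyf, z, hzf, hd'⟩ := exists_closer hT.conn hy1
        have hfg : f ≠ g := by
          rintro rfl
          have := edist_le_succ hT.conn hf hwg hzf (u 1)
          omega
        obtain ⟨i, h1, h2, h3⟩ := ih _ (by omega) (w := y)
          (Finset.one_lt_card.2 ⟨f, by simp [hf, hyf], g, by simp [hg, hyg], hfg⟩) rfl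
        exact ⟨i, h1, h2, h3 ▸ hyg⟩
    -- no vertex has distance `M` to `w`, because one can move farther away beyond `w`
    have hfar : ∀ z, edist E z w ≠ M := by
      intro z hz
      obtain ⟨-, -, -, y, -, -, hy⟩ := hT.exists_farther hw z
      have := hdiam z y
      omega
    have hfirst : i = 1 → g ≠ ed 1 → False := by
      rintro rfl hne1
      obtain ⟨h1, h2, -⟩ := hed 1 hiM
      have h3 := geodesic_mem_branch_right hT hu hed (i := 1) (j := M) (by omega) le_rfl
      have h4 := hT.edist_of_not_mem_branch hg hig
        (fun hh => hne1 (hT.branch_unique hg h1 hig h2 hh h3)) hwg (hne 1 hi0 hiM)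
      rw [edist_comm E (u M) (u 1), hu 1 M (by omega) le_rfl] at h4
      exact hfar (u M) (by omega)
    have hlast : i = M - 1 → g ≠ ed (M - 2) → False := by
      intro hi hne1
      obtain ⟨j, rfl⟩ : ∃ j, M = j + 2 := ⟨M - 2, by omega⟩
      have hij : i = j + 1 := by omega
      subst hij
      simp only [Nat.add_sub_cancel] at hne1
      obtain ⟨h1, -, h2⟩ := hed j (by omega)
      have h3 := geodesic_mem_branch_left hT hu hed (i := 0) (j := j) (by omega) (by omega)
      have h4 := hT.edist_of_not_mem_branch hg hig
        (fun hh => hne1 (hT.branch_unique hg h1 hig h2 hh h3)) hwg (hne _ hi0 hiM)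
      rw [hu 0 (j + 1) (by omega) (by omega)] at h4
      exact hfar (u 0) (by omega)
    have hdeg : ∀ j, 0 < j → j < M → 2 ≤ deg E (u j) := fun j h1 h2 =>
      geodesic_inner_deg hT hu hed h1 h2
    have hinj : ∀ j, j + 1 ≤ M → u j ≠ u (j + 1) := by
      intro j hj hh
      have := hu j (j + 1) (by omega) hj
      rw [hh] at this
      simp at this
    obtain ⟨j, rfl⟩ : ∃ j, i = j + 1 := ⟨i - 1, by omega⟩
    obtain ⟨h1, h2, h3⟩ := hed j (by omega)
    obtain ⟨h4, h5, h6⟩ := hed (j + 1) hiM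
    have hne' := geodesic_edge_ne hT hu hed hiM
    by_cases hg1 : g = ed j
    · by_cases hj : j = 0
      · subst hj
        exact hfirst rfl (hg1 ▸ hne')
      · exact hE.no_three_in_edge hg hwg (hg1 ▸ h2) hig (hne j (by omega) (by omega))
          (hne (j + 1) hi0 hiM) (hinj j (by omega)) hw (hdeg j (by omega) (by omega))
          (hdeg (j + 1) hi0 hiM)
    · by_cases hg2 : g = ed (j + 1)
      · by_cases hj : j + 2 = M
        · subst hj
          exact hlast (by omega) (hg2 ▸ hne'.symm)
        · exact hE.no_three_in_edge hg hwg hig (hg2 ▸ h6) (hne (j + 1) hi0 hiM)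
            (hne (j + 1 + 1) (by omega) (by omega)) (hinj (j + 1) (by omega)) hw
            (hdeg (j + 1) hi0 hiM) (hdeg _ (by omega) (by omega))
      · by_cases hj : j = 0
        · subst hj
          exact hfirst rfl hg2
        · by_cases hj2 : j + 2 = M
          · subst hj2
            exact hlast (by omega) hg1
          · exact hE.no_three_branches hg h1 h4 hig h3 h5 hg1 hg2 hne'
              ⟨w, hwg, hne _ hi0 hiM, hw⟩
              ⟨u j, h2, hinj j (by omega), hdeg j (by omega) (by omega)⟩
              ⟨u (j + 1 + 1), h6, (hinj (j + 1) (by omega)).symm, hdeg _ (by omega) (by omega)⟩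

lemma IsMaximizer.exists_spine (hΔ : 3 ≤ Δ) (hn : 1 ≤ n) : ∃ M u ed, Spine E M u ed := by
  have hT := hE.mem.tree
  obtain ⟨M, u, ed, hdiam, hu, hed⟩ := exists_diametral hT.conn
  have hM : 2 ≤ M := by
    have h1 := hE.mem.card_deg
    obtain ⟨v, hv⟩ := Finset.card_pos.1 (by omega :
      0 < (Finset.univ.filter (deg E · = Δ)).card)
    have hv2 : 2 ≤ deg E v := by
      rw [(Finset.mem_filter.1 hv).2]
      omega
    obtain ⟨f, hf, hvf, y, hy, hyv, -⟩ := hT.exists_farther hv2 v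
    obtain ⟨-, -, -, z, -, -, hz⟩ := hT.exists_farther hv2 y
    rw [edist_eq_one hf hy hvf hyv] at hz
    have := hdiam y z
    omega
  refine ⟨M, u, ed, hM, hu, fun i hi => (hed i hi).1, fun i hi => (hed i hi).2.1,
    fun i hi => (hed i hi).2.2, fun w => ⟨hE.inner_of_deg hM hdiam hu hed, ?_⟩⟩
  rintro ⟨i, h1, h2, rfl⟩
  exact geodesic_inner_deg hT hu hed h1 h2

end Maximizer

namespace Spine

variable {E : Finset (Finset V)} {M : ℕ} {u : ℕ → V} {ed : ℕ → Finset V} (hS : Spine E M u ed)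
include hS

lemma edge : ∀ i < M, ed i ∈ E ∧ u i ∈ ed i ∧ u (i + 1) ∈ ed i :=
  fun i hi => ⟨hS.edge_mem i hi, hS.left_mem i hi, hS.right_mem i hi⟩

/-- The spine traversed in the opposite direction. -/
lemma reverse : Spine E M (fun i => u (M - i)) (fun i => ed (M - 1 - i)) where
  two_le := hS.two_le
  edist_eq i j hij hj := by
    rw [edist_comm, hS.edist_eq (M - j) (M - i) (by omega) (by omega)]
    omega
  edge_mem i hi := hS.edge_mem _ (by omega)
  left_mem i hi := by
    have := hS.right_mem (M - 1 - i) (by omega)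
    rwa [show M - 1 - i + 1 = M - i by omega] at this
  right_mem i hi := by
    have := hS.left_mem (M - 1 - i) (by omega)
    rwa [show M - 1 - i = M - (i + 1) by omega] at this ⊢
  inner_iff w := by
    rw [hS.inner_iff]
    constructor
    · rintro ⟨i, h1, h2, h3⟩
      exact ⟨M - i, by omega, by omega, by rw [← h3]; congr 1; omega⟩
    · rintro ⟨i, h1, h2, h3⟩
      exact ⟨M - i, by omega, by omega, h3⟩

lemma vertex_inj {i j : ℕ} (hi : i ≤ M) (hj : j ≤ M) (h : u i = u j) : i = j := by
  rcases le_total i j with hij | hij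
  · have := hS.edist_eq i j hij hj
    rw [h] at this
    simp at this
    omega
  · have := hS.edist_eq j i hij hi
    rw [h] at this
    simp at this
    omega

lemma deg_inner {i : ℕ} (h0 : 0 < i) (hM : i < M) : 2 ≤ deg E (u i) :=
  (hS.inner_iff _).2 ⟨i, h0, hM, rfl⟩

/-- The edges at `u i` that are not edges of the spine. -/
def starEdges (E : Finset (Finset V)) (u : ℕ → V) (ed : ℕ → Finset V) (i : ℕ) :
    Finset (Finset V) :=
  (E.filter (u i ∈ ·)) \ {ed (i - 1), ed i}

omit hS in
lemma mem_starEdges {i : ℕ} {f : Finset V} :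
    f ∈ starEdges E u ed i ↔ f ∈ E ∧ u i ∈ f ∧ f ≠ ed (i - 1) ∧ f ≠ ed i := by
  simp [starEdges, and_assoc]

lemma card_starEdges {k : ℕ} (hT : IsTree k E) {i : ℕ} (h0 : 0 < i) (hM : i < M) :
    (starEdges E u ed i).card + 2 = deg E (u i) := by
  obtain ⟨j, rfl⟩ : ∃ j, i = j + 1 := ⟨i - 1, by omega⟩
  have hsub : ({ed (j + 1 - 1), ed (j + 1)} : Finset (Finset V)) ⊆ E.filter (u (j + 1) ∈ ·) := by
    intro f hf
    simp only [Finset.mem_insert, Finset.mem_singleton, Nat.add_sub_cancel] at hf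
    rcases hf with rfl | rfl
    · simp [hS.edge_mem j (by omega), hS.right_mem j (by omega)]
    · simp [hS.edge_mem (j + 1) hM, hS.left_mem (j + 1) hM]
  have h1 := Finset.card_le_card hsub
  rw [starEdges, Finset.card_sdiff_of_subset hsub, deg]
  rw [Nat.add_sub_cancel, Finset.card_pair (geodesic_edge_ne hT hS.edist_eq hS.edge hM)] at h1 ⊢
  omega

/-- Each vertex off the spine has degree one, so the degree sum determines the number of edges. -/
lemma card_edges [Nontrivial V] {k m Δ n : ℕ} (hE : InClass k m Δ n E) (hΔ : 3 ≤ Δ)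
    (h2 : ∀ v, deg E v ≠ Δ → deg E v ≤ 2) : m = M + n * (Δ - 2) := by
  have hT := hE.tree
  have hk := hT.two_le
  have h1 : ∑ v, deg E v = k * m := by
    simp only [deg, Finset.card_eq_sum_ones, Finset.sum_filter]
    rw [Finset.sum_comm]
    have : ∀ e ∈ E, ∑ v : V, (if v ∈ e then 1 else 0) = k := by
      intro e he
      rw [← hT.unif e he]
      simp
    rw [Finset.sum_congr rfl this]
    simp [hE.card, mul_comm]
  have h3 : ∑ v, deg E v = Fintype.card V + ∑ v, (deg E v - 1) := by
    rw [← Finset.card_univ, Finset.card_eq_sum_ones, ← Finset.sum_add_distrib]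
    refine Finset.sum_congr rfl fun v _ => ?_
    have := hT.deg_pos v
    omega
  have h4 : ∑ v, (deg E v - 1) = ∑ v ∈ (Finset.Ioo 0 M).image u, (deg E v - 1) := by
    symm
    refine Finset.sum_subset (Finset.subset_univ _) fun v _ hv => ?_
    by_contra hne
    obtain ⟨i, hi0, hiM, rfl⟩ := (hS.inner_iff v).1 (by omega)
    exact hv (Finset.mem_image_of_mem u (Finset.mem_Ioo.2 ⟨hi0, hiM⟩))
  have hcard : ((Finset.Ioo 0 M).image u).card = M - 1 := by
    rw [Finset.card_image_of_injOn]
    · simp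
    · intro i hi j hj hij
      simp only [Finset.coe_Ioo, Set.mem_Ioo] at hi hj
      exact hS.vertex_inj hi.2.le hj.2.le hij
  have h5 : ∑ v ∈ (Finset.Ioo 0 M).image u, (deg E v - 1) =
      ∑ v ∈ (Finset.Ioo 0 M).image u, (1 + if deg E v = Δ then Δ - 2 else 0) := by
    refine Finset.sum_congr rfl fun v hv => ?_
    obtain ⟨i, hi, rfl⟩ := Finset.mem_image.1 hv
    rw [Finset.mem_Ioo] at hi
    have := hS.deg_inner hi.1 hi.2
    have := h2 (u i)
    split_ifs with hd
    · omega
    · have := this hd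
      omega
  have h6 : ((Finset.Ioo 0 M).image u).filter (deg E · = Δ) =
      Finset.univ.filter (deg E · = Δ) := by
    ext v
    simp only [Finset.mem_filter, Finset.mem_univ, true_and, and_iff_right_iff_imp]
    intro hd
    obtain ⟨i, hi0, hiM, rfl⟩ := (hS.inner_iff v).1 (by omega)
    exact Finset.mem_image_of_mem u (Finset.mem_Ioo.2 ⟨hi0, hiM⟩)
  rw [Finset.sum_add_distrib, ← Finset.card_eq_sum_ones, hcard, ← Finset.sum_filter, h6,
    Finset.sum_const, hE.card_deg, smul_eq_mul] at h5
  have h7 := hT.card_eq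
  rw [hE.card] at h7
  have h8 := hS.two_le
  have h9 : k * m = (k - 1) * m + m := by
    obtain ⟨l, rfl⟩ : ∃ l, k = l + 1 := ⟨k - 1, by omega⟩
    simp [add_mul]
  omega

/-- In a maximizer, a vertex of degree `Δ` is never between two inner vertices of degree two:
otherwise the edges off the spine could be moved from it to the one on the lighter side. -/
lemma not_between [Nontrivial V] {k m Δ n : ℕ} (hE : IsMaximizer k m Δ n E) (hΔ : 3 ≤ Δ)
    {i q j : ℕ} (hi : 0 < i) (hiq : i < q) (hqj : q < j) (hj : j < M) (hdi : deg E (u i) ≠ Δ)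
    (hdq : deg E (u q) = Δ) (hdj : deg E (u j) ≠ Δ) : False := by
  have hT := hE.mem.tree
  obtain ⟨x, hx⟩ := exists_isPerron hT.conn
  obtain ⟨p, rfl⟩ : ∃ p, q = p + 1 := ⟨q - 1, by omega⟩
  have hcard := hS.card_starEdges hT (i := p + 1) (by omega) (by omega)
  have hne := geodesic_edge_ne hT hS.edist_eq hS.edge (i := p) (by omega)
  have hmem := fun f => mem_starEdges (E := E) (u := u) (ed := ed) (i := p + 1) (f := f)
  rw [Nat.add_sub_cancel] at hmem
  have hd2 : ∀ l, 0 < l → l < M → deg E (u l) ≠ Δ → deg E (u l) = 2 := fun l h1 h2 h3 =>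
    le_antisymm (hE.deg_le_two hΔ h3) (hS.deg_inner h1 h2)
  have key : ∀ e g z, e ∈ E → u (p + 1) ∈ e → g ∈ E → u (p + 1) ∈ g → e ≠ g →
      e ∉ starEdges E u ed (p + 1) → g ∉ starEdges E u ed (p + 1) →
      z ∈ branch E (u (p + 1)) e → deg E z = 2 →
      ¬ ∑ w ∈ branch E (u (p + 1)) e, x w ≤ ∑ w ∈ branch E (u (p + 1)) g, x w := by
    intro e g z he hue hg hug heg heF hgF hz hdz hle
    obtain ⟨h, hlt⟩ := hT.rho_lt_move hx (F := starEdges E u ed (p + 1))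
      (Finset.card_pos.1 (by omega)) (fun f hf => ((hmem f).1 hf).1)
      (fun f hf => ((hmem f).1 hf).2.1) he hue hg hug heg heF hgF hle hz
    refine absurd (hE.le _ (hE.mem.exchange_swap h ?_)) (not_le.2 hlt)
    simp only [Finset.card_empty]
    omega
  have hL := hS.edge p (by omega)
  have hR := hS.edge (p + 1) (by omega)
  have hzi := geodesic_mem_branch_left hT hS.edist_eq hS.edge (i := i) (j := p) (by omega)
    (by omega)
  have hzj := geodesic_mem_branch_right hT hS.edist_eq hS.edge hqj hj.le
  have hLn : ed p ∉ starEdges E u ed (p + 1) := by simp [hmem]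
  have hRn : ed (p + 1) ∉ starEdges E u ed (p + 1) := by simp [hmem]
  rcases le_total (∑ w ∈ branch E (u (p + 1)) (ed p), x w)
    (∑ w ∈ branch E (u (p + 1)) (ed (p + 1)), x w) with hle | hle
  · exact key _ _ _ hL.1 hL.2.2 hR.1 hR.2.1 hne hLn hRn hzi (hd2 i hi (by omega) hdi) hle
  · exact key _ _ _ hR.1 hR.2.1 hL.1 hL.2.2 hne.symm hRn hLn hzj (hd2 j (by omega) hj hdj) hle

end Spine

/-! ### Distances along the spine -/

/-- If the vertex of an edge closest to `z` has degree one, then it is `z` itself. -/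
lemma IsTree.exists_gate_of_deg {k : ℕ} {E : Finset (Finset V)} (hT : IsTree k E) (z : V)
    {e : Finset V} (he : e ∈ E) :
    ∃ y ∈ e, (deg E y = 1 → y = z) ∧ ∀ w ∈ e, w ≠ y → edist E z w = edist E z y + 1 := by
  obtain ⟨y, hy, hg⟩ := hT.exists_gate z he
  refine ⟨y, hy, fun hd => ?_, hg⟩
  by_contra hyz
  obtain ⟨f, hf, hyf, y', hy', hlt⟩ := exists_closer hT.conn hyz
  have hfe : f = e := Finset.card_le_one.1 hd.le f (by simp [hf, hyf]) e (by simp [he, hy])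
  subst hfe
  have hne : y' ≠ y := by
    rintro rfl
    omega
  have := hg y' hy' hne
  omega

/-- The vertices of `ed i` that are not on the spine. -/
def extras (u : ℕ → V) (ed : ℕ → Finset V) (i : ℕ) : Finset V :=
  ((ed i).erase (u i)).erase (u (i + 1))

/-- The vertices other than `u i` of the edges at `u i` that are not on the spine. -/
def starLeaves (E : Finset (Finset V)) (u : ℕ → V) (ed : ℕ → Finset V) (i : ℕ) : Finset V :=
  (Spine.starEdges E u ed i).biUnion fun e => e.erase (u i)

lemma mem_extras {u : ℕ → V} {ed : ℕ → Finset V} {i : ℕ} {z : V} :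
    z ∈ extras u ed i ↔ z ∈ ed i ∧ z ≠ u i ∧ z ≠ u (i + 1) := by
  simp only [extras, Finset.mem_erase]
  tauto

lemma mem_starLeaves {E : Finset (Finset V)} {u : ℕ → V} {ed : ℕ → Finset V} {i : ℕ} {z : V} :
    z ∈ starLeaves E u ed i ↔ ∃ e ∈ Spine.starEdges E u ed i, z ∈ e ∧ z ≠ u i := by
  simp only [starLeaves, Finset.mem_biUnion, Finset.mem_erase]
  exact exists_congr fun e => by tauto

namespace Spine

variable {k : ℕ} {E : Finset (Finset V)} {M : ℕ} {u : ℕ → V} {ed : ℕ → Finset V}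
  (hS : Spine E M u ed)
include hS

lemma edist_spine {i j : ℕ} (hi : i ≤ M) (hj : j ≤ M) :
    edist E (u i) (u j) = (i - j) + (j - i) := by
  rcases le_total i j with h | h
  · rw [hS.edist_eq i j h hj]
    omega
  · rw [edist_comm, hS.edist_eq j i h hi]
    omega

lemma eq_of_mem_ed {i j : ℕ} (hi : i < M) (hj : j ≤ M) (h : u j ∈ ed i) : j = i ∨ j = i + 1 := by
  have h1 := edist_le_one (hS.edge_mem i hi) h (hS.left_mem i hi)
  have h2 := edist_le_one (hS.edge_mem i hi) h (hS.right_mem i hi)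
  rw [hS.edist_spine hj (by omega)] at h1 h2
  omega

lemma ed_inj {i j : ℕ} (hi : i < M) (hj : j < M) (h : ed i = ed j) : i = j := by
  have h1 := hS.eq_of_mem_ed hj hi.le (h ▸ hS.left_mem i hi)
  have h2 := hS.eq_of_mem_ed hj (by omega) (h ▸ hS.right_mem i hi)
  omega

lemma ed_not_mem_starEdges {i j : ℕ} (hi : i < M) (hj : j < M) :
    ed i ∉ starEdges E u ed j := by
  intro h
  obtain ⟨-, h1, h2, h3⟩ := mem_starEdges.1 h
  rcases hS.eq_of_mem_ed hi hj.le h1 with rfl | rfl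
  · exact h3 rfl
  · exact h2 rfl

variable (hT : IsTree k E)
include hT

/-- A star edge contains no spine vertex but its centre. -/
lemma eq_of_mem_starEdges {i j : ℕ} (hi : i < M) (hj : j ≤ M)
    {e : Finset V} (he : e ∈ starEdges E u ed i) (h : u j ∈ e) : j = i := by
  obtain ⟨h1, h2, h3, h4⟩ := mem_starEdges.1 he
  have hd := edist_le_one h1 h2 h
  rw [hS.edist_spine hi.le hj] at hd
  by_contra hne
  have hne' : u j ≠ u i := fun h => hne (hS.vertex_inj hj hi.le h)
  rcases (by omega : j = i + 1 ∨ i = j + 1) with rfl | rfl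
  · exact h4 (hT.edge_unique h1 (hS.edge_mem i hi) h2 (hS.left_mem i hi) h (hS.right_mem i hi)
      hne')
  · exact h3 (hT.edge_unique h1 (hS.edge_mem j (by omega)) h2 (hS.right_mem j (by omega)) h
      (hS.left_mem j (by omega)) hne')

lemma deg_eq_one {z : V} (hz : ∀ i, 0 < i → i < M → z ≠ u i) [Nontrivial V] : deg E z = 1 := by
  have h1 := hT.deg_pos z
  by_contra h2
  obtain ⟨i, h3, h4, h5⟩ := (hS.inner_iff z).1 (by omega)
  exact hz i h3 h4 h5.symm

lemma not_spine_of_mem_extras {i j : ℕ} (hi : i < M) (hj : j ≤ M) {z : V}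
    (hz : z ∈ extras u ed i) : z ≠ u j := by
  rintro rfl
  obtain ⟨h1, h2, h3⟩ := mem_extras.1 hz
  rcases hS.eq_of_mem_ed hi hj h1 with rfl | rfl
  · exact h2 rfl
  · exact h3 rfl

lemma not_spine_of_mem_star {i j : ℕ} (hi : i < M) (hj : j ≤ M) {z : V}
    (hz : z ∈ starLeaves E u ed i) : z ≠ u j := by
  rintro rfl
  obtain ⟨e, he, h1, h2⟩ := mem_starLeaves.1 hz
  exact h2 (congrArg u (hS.eq_of_mem_starEdges hT hi hj he h1))

/-- Every vertex lies on the spine, on an edge of the spine, or on a star edge. -/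
lemma vertex_cases (z : V) : (∃ i ≤ M, z = u i) ∨ (∃ i < M, z ∈ extras u ed i) ∨
    ∃ i, 0 < i ∧ i < M ∧ z ∈ starLeaves E u ed i := by
  by_cases h : ∃ i ≤ M, z = u i
  · exact Or.inl h
  right
  push Not at h
  have hM := hS.two_le
  obtain ⟨e, he, hze, y, hye, hd⟩ := exists_closer hT.conn (h 1 (by omega))
  obtain ⟨i, hi0, hiM, rfl⟩ : ∃ i, 0 < i ∧ i < M ∧ u i = y := by
    by_cases hy : y = u 1
    · exact ⟨1, by omega, by omega, hy.symm⟩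
    · obtain ⟨f, hf, hyf, y', hyf', hd'⟩ := exists_closer hT.conn hy
      refine (hS.inner_iff y).1 (Finset.one_lt_card.2 ⟨f, by simp [hf, hyf], e, by
        simp [he, hye], ?_⟩)
      rintro rfl
      have := edist_le_succ hT.conn hf hze hyf' (u 1)
      omega
  by_cases h1 : e = ed (i - 1)
  · refine Or.inl ⟨i - 1, by omega, mem_extras.2 ⟨h1 ▸ hze, h _ (by omega), ?_⟩⟩
    rw [Nat.sub_add_cancel hi0]
    exact h _ hiM.le
  · by_cases h2 : e = ed i
    · exact Or.inl ⟨i, hiM, mem_extras.2 ⟨h2 ▸ hze, h _ hiM.le, h _ hiM⟩⟩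
    · exact Or.inr ⟨i, hi0, hiM, mem_starLeaves.2 ⟨e, mem_starEdges.2 ⟨he, hye, h1, h2⟩, hze,
        h _ hiM.le⟩⟩

variable [Nontrivial V]

lemma deg_extras {i : ℕ} (hi : i < M) {z : V} (hz : z ∈ extras u ed i) : deg E z = 1 :=
  hS.deg_eq_one hT fun _ _ h2 => hS.not_spine_of_mem_extras hT hi h2.le hz

lemma deg_starLeaves {i : ℕ} (hi : i < M) {z : V} (hz : z ∈ starLeaves E u ed i) :
    deg E z = 1 :=
  hS.deg_eq_one hT fun _ _ h2 => hS.not_spine_of_mem_star hT hi h2.le hz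

omit hS hT in
lemma edge_eq_of_deg {z : V} (h : deg E z = 1) {e f : Finset V} (he : e ∈ E) (hf : f ∈ E)
    (hze : z ∈ e) (hzf : z ∈ f) : e = f :=
  Finset.card_le_one.1 h.le e (by simp [he, hze]) f (by simp [hf, hzf])

lemma extras_unique {i j : ℕ} (hi : i < M) (hj : j < M) {z : V} (hz : z ∈ extras u ed i)
    (hz' : z ∈ extras u ed j) : i = j :=
  hS.ed_inj hi hj (edge_eq_of_deg (hS.deg_extras hT hi hz) (hS.edge_mem i hi) (hS.edge_mem j hj)
    (mem_extras.1 hz).1 (mem_extras.1 hz').1)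

lemma not_mem_extras_of_star {i j : ℕ} (hi : i < M) (hj : j < M) {z : V}
    (hz : z ∈ starLeaves E u ed i) : z ∉ extras u ed j := by
  intro hz'
  obtain ⟨e, he, h1, -⟩ := mem_starLeaves.1 hz
  have := edge_eq_of_deg (hS.deg_extras hT hj hz') (hS.edge_mem j hj) (mem_starEdges.1 he).1
    (mem_extras.1 hz').1 h1
  exact hS.ed_not_mem_starEdges hj hi (this ▸ he)

lemma star_unique {i j : ℕ} (hi : i < M) (hj : j < M) {z : V} (hz : z ∈ starLeaves E u ed i)
    (hz' : z ∈ starLeaves E u ed j) : i = j := by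
  obtain ⟨e, he, h1, -⟩ := mem_starLeaves.1 hz
  obtain ⟨f, hf, h2, -⟩ := mem_starLeaves.1 hz'
  have := edge_eq_of_deg (hS.deg_starLeaves hT hi hz) (mem_starEdges.1 he).1
    (mem_starEdges.1 hf).1 h1 h2
  subst this
  exact hS.eq_of_mem_starEdges hT hj hi.le hf (mem_starEdges.1 he).2.1

/-- A vertex outside `extras i` is closest to one of the two ends of `ed i`. -/
lemma two_mul_edist_extras {i : ℕ} (hi : i < M) {w z : V} (hw : w ∈ extras u ed i)
    (hz : z ∉ extras u ed i) :
    2 * edist E w z = edist E (u i) z + edist E (u (i + 1)) z + 1 := by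
  obtain ⟨y, hy, hd, hg⟩ := hT.exists_gate_of_deg z (hS.edge_mem i hi)
  obtain ⟨h1, h2, h3⟩ := mem_extras.1 hw
  have hne : u i ≠ u (i + 1) := fun h => by
    have := hS.vertex_inj hi.le hi h
    omega
  rw [edist_comm E w, edist_comm E (u i), edist_comm E (u (i + 1))]
  by_cases hy1 : y = u i
  · subst hy1
    rw [hg w h1 h2, hg _ (hS.right_mem i hi) hne.symm]
    omega
  · by_cases hy2 : y = u (i + 1)
    · subst hy2
      rw [hg w h1 h3, hg _ (hS.left_mem i hi) hne]
      omega
    · have hye := mem_extras.2 ⟨hy, hy1, hy2⟩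
      have := hd (hS.deg_extras hT hi hye)
      subst this
      exact absurd hye hz

/-- A star edge is reached through its centre. -/
lemma edist_star {i : ℕ} (hi : i < M) {e : Finset V} (he : e ∈ starEdges E u ed i)
    {w z : V} (hw : w ∈ e) (hwi : w ≠ u i) (hz : z ∉ e.erase (u i)) :
    edist E w z = edist E (u i) z + 1 := by
  obtain ⟨h1, h2, -⟩ := mem_starEdges.1 he
  obtain ⟨y, hy, hd, hg⟩ := hT.exists_gate_of_deg z h1
  rw [edist_comm E w, edist_comm E (u i)]
  by_cases hyi : y = u i
  · subst hyi
    exact hg w hw hwi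
  · have := hd (hS.deg_starLeaves hT hi (mem_starLeaves.2 ⟨e, he, hy, hyi⟩))
    subst this
    exact absurd (Finset.mem_erase.2 ⟨hyi, hy⟩) hz

lemma two_mul_edist_spine_extras {i j : ℕ} (hi : i < M) (hj : j ≤ M) {w : V}
    (hw : w ∈ extras u ed i) :
    2 * edist E (u j) w = (i - j) + (j - i) + ((i + 1 - j) + (j - (i + 1))) + 1 := by
  rw [edist_comm, hS.two_mul_edist_extras hT hi hw
    fun h => hS.not_spine_of_mem_extras hT hi hj h rfl, hS.edist_spine hi.le hj,
    hS.edist_spine hi hj]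

lemma edist_spine_star {i j : ℕ} (hi : i < M) (hj : j ≤ M) {w : V}
    (hw : w ∈ starLeaves E u ed i) : edist E (u j) w = (i - j) + (j - i) + 1 := by
  obtain ⟨e, he, h1, h2⟩ := mem_starLeaves.1 hw
  rw [edist_comm, hS.edist_star hT hi he h1 h2, hS.edist_spine hi.le hj]
  intro h
  rw [Finset.mem_erase] at h
  exact hS.not_spine_of_mem_star hT hi hj (mem_starLeaves.2 ⟨e, he, h.2, h.1⟩) rfl

omit [Nontrivial V] in
lemma spine_not_mem_extras {i j : ℕ} (hi : i < M) (hj : j ≤ M) : u j ∉ extras u ed i :=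
  fun h => hS.not_spine_of_mem_extras hT hi hj h rfl

omit [Nontrivial V] in
lemma spine_not_mem_star {i j : ℕ} (hi : i < M) (hj : j ≤ M) : u j ∉ starLeaves E u ed i :=
  fun h => hS.not_spine_of_mem_star hT hi hj h rfl

/-- The distance to a spine vertex is a piecewise linear function of its position; its second
difference is concentrated at the position of `z`. -/
lemma edist_second_diff {i : ℕ} (hi : i + 1 < M) (z : V) :
    edist E (u i) z + edist E (u (i + 1 + 1)) z = 2 * edist E (u (i + 1)) z +
      (if z ∈ extras u ed i then 1 else 0) + (if z ∈ extras u ed (i + 1) then 1 else 0) +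
      (if z = u (i + 1) then 2 else 0) + (if z ∈ starLeaves E u ed (i + 1) then 2 else 0) := by
  rcases hS.vertex_cases hT z with ⟨j, hj, rfl⟩ | ⟨j, hj, hz⟩ | ⟨j, hj0, hj, hz⟩
  · rw [if_neg (hS.spine_not_mem_extras hT (by omega) hj),
      if_neg (hS.spine_not_mem_extras hT (by omega) hj),
      if_neg (hS.spine_not_mem_star hT hi hj),
      hS.edist_spine (by omega) hj, hS.edist_spine (by omega) hj, hS.edist_spine (by omega) hj]
    have : u j = u (i + 1) ↔ j = i + 1 :=
      ⟨fun h => hS.vertex_inj hj hi.le h, fun h => h ▸ rfl⟩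
    simp only [this]
    split_ifs <;> omega
  · have h1 := hS.two_mul_edist_spine_extras hT hj (by omega : i ≤ M) hz
    have h2 := hS.two_mul_edist_spine_extras hT hj (by omega : i + 1 ≤ M) hz
    have h3 := hS.two_mul_edist_spine_extras hT hj (by omega : i + 1 + 1 ≤ M) hz
    have h4 : ∀ l, l < M → (z ∈ extras u ed l ↔ j = l) := fun l hl =>
      ⟨hS.extras_unique hT hj hl hz, fun h => h ▸ hz⟩
    rw [if_neg (hS.not_spine_of_mem_extras hT hj hi.le hz),
      if_neg (fun h => hS.not_mem_extras_of_star hT hi hj h hz)]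
    simp only [h4 i (by omega), h4 (i + 1) hi]
    split_ifs <;> omega
  · rw [if_neg (hS.not_mem_extras_of_star hT hj (by omega) hz),
      if_neg (hS.not_mem_extras_of_star hT hj (by omega) hz),
      if_neg (hS.not_spine_of_mem_star hT hj hi.le hz),
      hS.edist_spine_star hT hj (by omega) hz, hS.edist_spine_star hT hj (by omega) hz,
      hS.edist_spine_star hT hj (by omega) hz]
    have : z ∈ starLeaves E u ed (i + 1) ↔ j = i + 1 :=
      ⟨hS.star_unique hT hj hi hz, fun h => h ▸ hz⟩
    simp only [this]
    split_ifs <;> omega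

/-- The first difference of the distances at the end `u 0` of the spine. -/
lemma edist_first_diff (z : V) :
    edist E (u 0) z + (if z ∈ extras u ed 0 then 1 else 0) + (if z = u 0 then 2 else 0) =
      edist E (u 1) z + 1 := by
  have hM := hS.two_le
  rcases hS.vertex_cases hT z with ⟨j, hj, rfl⟩ | ⟨j, hj, hz⟩ | ⟨j, hj0, hj, hz⟩
  · rw [if_neg (hS.spine_not_mem_extras hT (by omega) hj),
      hS.edist_spine (by omega) hj, hS.edist_spine (by omega) hj]
    have : u j = u 0 ↔ j = 0 := ⟨fun h => hS.vertex_inj hj (by omega) h, fun h => h ▸ rfl⟩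
    simp only [this]
    split_ifs <;> omega
  · have h1 := hS.two_mul_edist_spine_extras hT hj (by omega : 0 ≤ M) hz
    have h2 := hS.two_mul_edist_spine_extras hT hj (by omega : 1 ≤ M) hz
    have h4 : z ∈ extras u ed 0 ↔ j = 0 :=
      ⟨hS.extras_unique hT hj (by omega) hz, fun h => h ▸ hz⟩
    rw [if_neg (hS.not_spine_of_mem_extras hT hj (by omega) hz)]
    simp only [h4]
    split_ifs <;> omega
  · rw [if_neg (hS.not_mem_extras_of_star hT hj (by omega) hz),
      if_neg (hS.not_spine_of_mem_star hT hj (by omega) hz),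
      hS.edist_spine_star hT hj (by omega) hz, hS.edist_spine_star hT hj (by omega) hz]
    omega

/-- The first difference of the distances inside the spine; compared with the one at the end of the
spine it is smaller because of the vertices beyond `u (s + 1)`, of which only `u (s + 2)` is
recorded. -/
lemma edist_diff_le {s : ℕ} (hs : s + 1 < M) (z : V) :
    edist E (u (s + 1)) z + (if z ∈ extras u ed s then 1 else 0) +
      (if z = u (s + 1) then 2 else 0) + (if z = u (s + 1 + 1) then 2 else 0) ≤
      edist E (u s) z + 1 := by
  rcases hS.vertex_cases hT z with ⟨j, hj, rfl⟩ | ⟨j, hj, hz⟩ | ⟨j, hj0, hj, hz⟩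
  · rw [if_neg (hS.spine_not_mem_extras hT (by omega) hj),
      hS.edist_spine (by omega) hj, hS.edist_spine (by omega) hj]
    have h1 : u j = u (s + 1) ↔ j = s + 1 :=
      ⟨fun h => hS.vertex_inj hj (by omega) h, fun h => h ▸ rfl⟩
    have h2 : u j = u (s + 1 + 1) ↔ j = s + 1 + 1 :=
      ⟨fun h => hS.vertex_inj hj (by omega) h, fun h => h ▸ rfl⟩
    simp only [h1, h2]
    split_ifs <;> omega
  · have h1 := hS.two_mul_edist_spine_extras hT hj (by omega : s ≤ M) hz
    have h2 := hS.two_mul_edist_spine_extras hT hj (by omega : s + 1 ≤ M) hz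
    have h4 : z ∈ extras u ed s ↔ j = s :=
      ⟨hS.extras_unique hT hj (by omega) hz, fun h => h ▸ hz⟩
    rw [if_neg (hS.not_spine_of_mem_extras hT hj (by omega) hz),
      if_neg (hS.not_spine_of_mem_extras hT hj (by omega) hz)]
    simp only [h4]
    split_ifs <;> omega
  · rw [if_neg (hS.not_mem_extras_of_star hT hj (by omega) hz),
      if_neg (hS.not_spine_of_mem_star hT hj (by omega) hz),
      if_neg (hS.not_spine_of_mem_star hT hj (by omega) hz),
      hS.edist_spine_star hT hj (by omega) hz, hS.edist_spine_star hT hj (by omega) hz]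
    omega

lemma card_extras {i : ℕ} (hi : i < M) : (extras u ed i).card = k - 2 := by
  have hne : u (i + 1) ≠ u i := fun h => by
    have := hS.vertex_inj hi hi.le h
    omega
  rw [extras, Finset.card_erase_of_mem (Finset.mem_erase.2 ⟨hne, hS.right_mem i hi⟩),
    Finset.card_erase_of_mem (hS.left_mem i hi), hT.unif _ (hS.edge_mem i hi)]
  omega

lemma card_starLeaves {i : ℕ} (hi : i < M) :
    (starLeaves E u ed i).card = (starEdges E u ed i).card * (k - 1) := by
  rw [starLeaves, Finset.card_biUnion]
  · rw [Finset.sum_congr rfl (g := fun _ => k - 1), Finset.sum_const, smul_eq_mul]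
    intro e he
    obtain ⟨h1, h2, -⟩ := mem_starEdges.1 he
    rw [Finset.card_erase_of_mem h2, hT.unif e h1]
  · intro e he f hf hef
    rw [Function.onFun, Finset.disjoint_left]
    intro z hz hz'
    rw [Finset.mem_erase] at hz hz'
    exact hef (edge_eq_of_deg (hS.deg_starLeaves hT hi (mem_starLeaves.2 ⟨e, he, hz.2, hz.1⟩))
      (mem_starEdges.1 he).1 (mem_starEdges.1 hf).1 hz.2 hz'.2)

end Spine

/-! ### The Perron vector along the spine -/

lemma sum_ite_mem_mul (s : Finset V) (x : V → ℝ) (c : ℝ) :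
    ∑ z, (if z ∈ s then c else 0) * x z = c * ∑ z ∈ s, x z := by
  simp only [ite_mul, zero_mul, Finset.sum_ite_mem, Finset.univ_inter, Finset.mul_sum]

lemma sum_ite_eq_mul (w : V) (x : V → ℝ) (c : ℝ) :
    ∑ z, (if z = w then c else 0) * x z = c * x w := by
  simp

namespace Spine

variable [Nontrivial V] {k : ℕ} {E : Finset (Finset V)} {M : ℕ} {u : ℕ → V} {ed : ℕ → Finset V}
  (hS : Spine E M u ed) (hT : IsTree k E) {x : V → ℝ} (hx : IsPerron E x)
include hS hT hx

/-- The Perron entry at a leaf of the star at `u i` depends only on the entry at `u i`. -/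
lemma perron_star {i : ℕ} (hi : i < M) {w : V} (hw : w ∈ starLeaves E u ed i) :
    (rho E + k) * x w = ∑ z, x z + rho E * x (u i) := by
  obtain ⟨e, he, hwe, hwi⟩ := mem_starLeaves.1 hw
  obtain ⟨he1, he2, -⟩ := mem_starEdges.1 he
  have key : ∀ y ∈ e.erase (u i), (rho E + 1) * x y =
      ∑ z, x z + rho E * x (u i) - ∑ z ∈ e.erase (u i), x z := by
    intro y hy
    obtain ⟨hyi, hye⟩ := Finset.mem_erase.1 hy
    have hpt : ∀ z, (edist E y z : ℝ) = 1 + edist E (u i) z -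
        (if z ∈ e.erase (u i) then 1 else 0) - (if z = y then 1 else 0) := by
      intro z
      by_cases hz : z ∈ e.erase (u i)
      · obtain ⟨hzi, hze⟩ := Finset.mem_erase.1 hz
        rw [if_pos hz, edist_eq_one he1 he2 hze hzi.symm]
        by_cases hzy : z = y
        · rw [if_pos hzy, hzy, (edist_eq_zero hT.conn).2 rfl]
          norm_num
        · rw [if_neg hzy, edist_eq_one he1 hye hze (Ne.symm hzy)]
          norm_num
      · have hzy : z ≠ y := by
          rintro rfl
          exact hz hy
        rw [if_neg hz, if_neg hzy, hS.edist_star hT hi he hye hyi hz]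
        push_cast
        ring
    have h1 := hx.eigen y
    simp only [hpt, sub_mul, add_mul, one_mul, Finset.sum_sub_distrib, Finset.sum_add_distrib,
      hx.eigen (u i), sum_ite_mem_mul, sum_ite_eq_mul] at h1
    linarith
  have hρ := rho_pos hT.conn
  have hwe' := Finset.mem_erase.2 ⟨hwi, hwe⟩
  -- the other leaves of `e` have the same entry, so their sum is `(k - 1) * x w`
  have hconst : ∀ y ∈ e.erase (u i), x y = x w := fun y hy =>
    mul_left_cancel₀ (by positivity : rho E + 1 ≠ 0) ((key y hy).trans (key w hwe').symm)
  have h2 := key w hwe'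
  rw [Finset.sum_congr rfl hconst, Finset.sum_const, Finset.card_erase_of_mem he2,
    hT.unif e he1, nsmul_eq_mul, Nat.cast_sub (by have := hT.two_le; omega)] at h2
  push_cast at h2
  linarith

/-- The Perron entry at an extra vertex of `ed i` depends only on the entries at the two ends of
`ed i`. -/
lemma perron_extra {i : ℕ} (hi : i < M) {w : V} (hw : w ∈ extras u ed i) :
    (2 * rho E + k) * x w = ∑ z, x z + rho E * (x (u i) + x (u (i + 1))) := by
  have key : ∀ y ∈ extras u ed i, (2 * rho E + 2) * x y =
      ∑ z, x z + rho E * (x (u i) + x (u (i + 1))) - ∑ z ∈ extras u ed i, x z := by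
    intro y hy
    obtain ⟨hye, hy1, hy2⟩ := mem_extras.1 hy
    have hpt : ∀ z, 2 * (edist E y z : ℝ) = 1 + edist E (u i) z + edist E (u (i + 1)) z -
        (if z ∈ extras u ed i then 1 else 0) - (if z = y then 2 else 0) := by
      intro z
      by_cases hz : z ∈ extras u ed i
      · obtain ⟨hze, hz1, hz2⟩ := mem_extras.1 hz
        rw [if_pos hz, edist_eq_one (hS.edge_mem i hi) (hS.left_mem i hi) hze hz1.symm,
          edist_eq_one (hS.edge_mem i hi) (hS.right_mem i hi) hze hz2.symm]
        by_cases hzy : z = y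
        · rw [if_pos hzy, hzy, (edist_eq_zero hT.conn).2 rfl]
          norm_num
        · rw [if_neg hzy, edist_eq_one (hS.edge_mem i hi) hye hze (Ne.symm hzy)]
          norm_num
      · have hzy : z ≠ y := by
          rintro rfl
          exact hz hy
        have h := hS.two_mul_edist_extras hT hi hy hz
        rw [if_neg hz, if_neg hzy]
        have h' : (2 * edist E y z : ℝ) = edist E (u i) z + edist E (u (i + 1)) z + 1 := by
          exact_mod_cast h
        linarith
    have h1 : ∑ z, 2 * (edist E y z : ℝ) * x z = 2 * (rho E * x y) := by
      rw [← hx.eigen y, Finset.mul_sum]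
      exact Finset.sum_congr rfl fun z _ => by ring
    simp only [hpt, sub_mul, add_mul, one_mul, Finset.sum_sub_distrib, Finset.sum_add_distrib,
      hx.eigen (u i), hx.eigen (u (i + 1)), sum_ite_mem_mul, sum_ite_eq_mul] at h1
    linarith
  have hρ := rho_pos hT.conn
  -- all extra vertices of `ed i` have the same entry, so their sum is `(k - 2) * x w`
  have hconst : ∀ y ∈ extras u ed i, x y = x w := fun y hy =>
    mul_left_cancel₀ (by positivity : 2 * rho E + 2 ≠ 0) ((key y hy).trans (key w hw).symm)
  have h2 := key w hw
  rw [Finset.sum_congr rfl hconst, Finset.sum_const, hS.card_extras hT hi, nsmul_eq_mul,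
    Nat.cast_sub hT.two_le] at h2
  push_cast at h2
  linarith

lemma sum_extras {i : ℕ} (hi : i < M) :
    (2 * rho E + k) * ∑ w ∈ extras u ed i, x w =
      (k - 2 : ℝ) * (∑ z, x z + rho E * (x (u i) + x (u (i + 1)))) := by
  rw [Finset.mul_sum, Finset.sum_congr rfl fun w hw => hS.perron_extra hT hx hi hw,
    Finset.sum_const, hS.card_extras hT hi, nsmul_eq_mul, Nat.cast_sub hT.two_le]
  norm_num

lemma sum_starLeaves {i : ℕ} (hi : i < M) :
    (rho E + k) * ∑ w ∈ starLeaves E u ed i, x w =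
      (starEdges E u ed i).card * (k - 1 : ℝ) * (∑ z, x z + rho E * x (u i)) := by
  have := hT.two_le
  rw [Finset.mul_sum, Finset.sum_congr rfl fun w hw => hS.perron_star hT hx hi hw,
    Finset.sum_const, hS.card_starLeaves hT hi, nsmul_eq_mul, Nat.cast_mul,
    Nat.cast_sub (by omega)]
  norm_num

lemma perron_second_diff {i : ℕ} (hi : i + 1 < M) :
    rho E * (x (u i) + x (u (i + 1 + 1))) = 2 * rho E * x (u (i + 1)) +
      ∑ w ∈ extras u ed i, x w + ∑ w ∈ extras u ed (i + 1), x w + 2 * x (u (i + 1)) +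
      2 * ∑ w ∈ starLeaves E u ed (i + 1), x w := by
  have hpt : ∀ z, (edist E (u i) z : ℝ) + edist E (u (i + 1 + 1)) z =
      2 * edist E (u (i + 1)) z +
      (if z ∈ extras u ed i then 1 else 0) + (if z ∈ extras u ed (i + 1) then 1 else 0) +
      (if z = u (i + 1) then 2 else 0) + (if z ∈ starLeaves E u ed (i + 1) then 2 else 0) := by
    intro z
    exact_mod_cast hS.edist_second_diff hT hi z
  have h1 : ∑ z, ((edist E (u i) z : ℝ) + edist E (u (i + 1 + 1)) z) * x z =
      rho E * (x (u i) + x (u (i + 1 + 1))) := by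
    simp only [add_mul, Finset.sum_add_distrib, hx.eigen]
    ring
  simp only [hpt, add_mul, Finset.sum_add_distrib, sum_ite_mem_mul, sum_ite_eq_mul, mul_assoc,
    ← Finset.mul_sum, hx.eigen] at h1
  linarith

lemma perron_first_diff :
    rho E * x (u 0) + ∑ w ∈ extras u ed 0, x w + 2 * x (u 0) = rho E * x (u 1) + ∑ z, x z := by
  have hpt : ∀ z, (edist E (u 0) z : ℝ) + (if z ∈ extras u ed 0 then 1 else 0) +
      (if z = u 0 then 2 else 0) = edist E (u 1) z + 1 := by
    intro z
    exact_mod_cast hS.edist_first_diff hT z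
  have h1 : ∑ z, ((edist E (u 1) z : ℝ) + 1) * x z = rho E * x (u 1) + ∑ z, x z := by
    simp only [add_mul, one_mul, Finset.sum_add_distrib, hx.eigen]
  rw [← h1]
  simp only [← hpt, add_mul, Finset.sum_add_distrib, sum_ite_mem_mul, sum_ite_eq_mul, hx.eigen]
  ring

/-- The counterpart of `perron_first_diff` inside the spine is a strict inequality, because of the
mass beyond `u (s + 1)`. -/
lemma perron_diff_lt {s : ℕ} (hs : s + 1 < M) :
    rho E * x (u (s + 1)) + ∑ w ∈ extras u ed s, x w + 2 * x (u (s + 1)) <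
      rho E * x (u s) + ∑ z, x z := by
  have hpt : ∀ z, (edist E (u (s + 1)) z : ℝ) + (if z ∈ extras u ed s then 1 else 0) +
      (if z = u (s + 1) then 2 else 0) + (if z = u (s + 1 + 1) then 2 else 0) ≤
      edist E (u s) z + 1 := by
    intro z
    exact_mod_cast hS.edist_diff_le hT hs z
  have h1 := Finset.sum_le_sum fun z (_ : z ∈ Finset.univ) =>
    mul_le_mul_of_nonneg_right (hpt z) (hx.pos z).le
  simp only [add_mul, one_mul, Finset.sum_add_distrib, sum_ite_mem_mul, sum_ite_eq_mul,
    hx.eigen] at h1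
  have := hx.pos (u (s + 1 + 1))
  linarith

end Spine

/-! ### Antisymmetric sequences -/

/-- An antisymmetric sequence that is concave where it is nonpositive, and decreasing at the start
if it is nonpositive there, is positive on the first half. -/
lemma pos_of_antisymmetric {s : ℕ} {W : ℕ → ℝ} (hanti : ∀ i ≤ s, W (s - i) = - W i)
    (h0 : W 0 ≤ 0 → W 1 < W 0)
    (hconc : ∀ i, 2 * (i + 1) ≤ s → W (i + 1) ≤ 0 → W i + W (i + 1 + 1) ≤ 2 * W (i + 1))
    {i : ℕ} (hi : 2 * i < s) : 0 < W i := by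
  by_contra hneg
  push Not at hneg
  -- the first nonpositive entry
  obtain ⟨j, ⟨hj, hjneg⟩, hmin⟩ : ∃ j, (2 * j < s ∧ W j ≤ 0) ∧
      ∀ l < j, ¬ (2 * l < s ∧ W l ≤ 0) := by
    classical
    have hex : ∃ j, 2 * j < s ∧ W j ≤ 0 := ⟨i, hi, hneg⟩
    exact ⟨Nat.find hex, Nat.find_spec hex, fun l hl => Nat.find_min hex hl⟩
  -- from there on the sequence decreases up to the middle, against antisymmetry
  have hdec : ∀ l, 2 * (j + l) < s → W (j + l + 1) < W (j + l) ∧ W (j + l) ≤ 0 := by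
    intro l
    induction l with
    | zero =>
      intro _
      refine ⟨?_, hjneg⟩
      cases j with
      | zero => exact h0 hjneg
      | succ j =>
        have h1 := hconc j (by omega) hjneg
        have h2 := hmin j (by omega)
        have h3 : 0 < W j := by
          by_contra h
          exact h2 ⟨by omega, by linarith⟩
        simp only [add_zero]
        linarith
    | succ l ih =>
      intro hl
      obtain ⟨h1, h2⟩ := ih (by omega)
      have h3 := hconc (j + l) (by omega) (by linarith)
      rw [← add_assoc]
      exact ⟨by linarith, by linarith⟩
  rcases Nat.even_or_odd' s with ⟨h, rfl | rfl⟩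
  · obtain ⟨l, hl⟩ : ∃ l, j + l + 1 = h := ⟨h - j - 1, by omega⟩
    obtain ⟨h1, h2⟩ := hdec l (by omega)
    have h3 := hanti h (by omega)
    rw [show 2 * h - h = h by omega] at h3
    rw [hl] at h1
    linarith
  · obtain ⟨l, hl⟩ : ∃ l, j + l = h := ⟨h - j, by omega⟩
    obtain ⟨h1, h2⟩ := hdec l (by omega)
    have h3 := hanti h (by omega)
    rw [show 2 * h + 1 - h = h + 1 by omega] at h3
    rw [hl] at h1 h2
    linarith

/-- The comparison of two reflected Perron vectors. The sequences `Y` and `Y'` satisfy the same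
kind of recursion, with larger coefficients for `Y'`, up to the sources `-2 X` and `2 X'` at `p`,
which cancel in the combination `X Y' + X' Y`. The source of `Y` has the sign that makes `Y`
positive on the first half; therefore the coefficients of `Y` may be replaced by the larger ones of
`Y'`, and then the combination is positive for the same reason. -/
lemma pos_of_reflected {s p : ℕ} {X X' β β' c c' κ κ' : ℝ} {b Y Y' : ℕ → ℝ} (hs : 2 ≤ s)
    (hp : 2 * p < s) (hX : 0 ≤ X) (hX' : 0 < X') (hc : 0 ≤ c) (hcc : c ≤ c') (hc' : c' < 1)
    (hβ : 0 ≤ β) (hββ : β ≤ β') (hκ : 0 ≤ κ) (hκκ : κ ≤ κ') (hb : ∀ i, 0 ≤ b i)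
    (hY : ∀ i ≤ s, Y (s - i) = - Y i) (hY' : ∀ i ≤ s, Y' (s - i) = - Y' i)
    (h0 : (1 - c) * Y 1 < (1 + c + 2 * β) * Y 0)
    (h0' : (1 - c') * Y' 1 < (1 + c' + 2 * β') * Y' 0)
    (hrec : ∀ i, 2 * (i + 1) ≤ s → (1 - c) * (Y i + Y (i + 1 + 1)) =
      (2 + 2 * c + 2 * β + 2 * κ * b (i + 1)) * Y (i + 1) - if i + 1 = p then 2 * X else 0)
    (hrec' : ∀ i, 2 * (i + 1) ≤ s → (1 - c') * (Y' i + Y' (i + 1 + 1)) =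
      (2 + 2 * c' + 2 * β' + 2 * κ' * b (i + 1)) * Y' (i + 1) + if i + 1 = p then 2 * X' else 0) :
    0 < X * Y' p + X' * Y p := by
  have hpos : ∀ i, 2 * i < s → 0 < Y i := by
    intro i hi
    refine pos_of_antisymmetric hY (fun h => ?_) (fun i hi h => ?_) hi
    · have : (c + β) * Y 0 ≤ 0 := mul_nonpos_of_nonneg_of_nonpos (by linarith) h
      nlinarith
    · have h1 := hrec i hi
      have h2 : (2 * c + β + κ * b (i + 1)) * Y (i + 1) ≤ 0 :=
        mul_nonpos_of_nonneg_of_nonpos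
          (by have := mul_nonneg hκ (hb (i + 1)); linarith) h
      have h3 : (0 : ℝ) ≤ if i + 1 = p then 2 * X else 0 := by
        split_ifs <;> linarith
      have h4 : (1 - c) * (Y i + Y (i + 1 + 1)) ≤ (1 - c) * (2 * Y (i + 1)) := by linarith
      exact le_of_mul_le_mul_left h4 (by linarith)
  have hnonneg : ∀ i, 2 * i ≤ s → 0 ≤ Y i := by
    intro i hi
    rcases hi.lt_or_eq with h | h
    · exact (hpos i h).le
    · have := hY i (by omega)
      rw [show s - i = i by omega] at this
      linarith
  -- the entry after the middle is controlled by antisymmetry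
  have hsum : ∀ i, 2 * (i + 1) ≤ s → 0 ≤ Y i + 2 * Y (i + 1) + Y (i + 1 + 1) := by
    intro i hi
    have h1 := hnonneg i (by omega)
    have h2 := hnonneg (i + 1) hi
    by_cases h3 : 2 * (i + 1 + 1) ≤ s
    · linarith [hnonneg _ h3]
    · have h4 := hY (i + 1 + 1) (by omega)
      rcases (by omega : s - (i + 1 + 1) = i ∨ s - (i + 1 + 1) = i + 1) with h5 | h5 <;>
      · rw [h5] at h4
        linarith
  refine pos_of_antisymmetric (W := fun i => X * Y' i + X' * Y i) (fun i hi => ?_) (fun h => ?_)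
    (fun i hi h => ?_) hp
  · rw [hY i hi, hY' i hi]
    ring
  · change X * Y' 0 + X' * Y 0 ≤ 0 at h
    have h1 := hnonneg 0 (by omega)
    have h2 := hnonneg 1 hs
    have h3 : X * ((1 - c') * Y' 1) ≤ X * ((1 + c' + 2 * β') * Y' 0) :=
      mul_le_mul_of_nonneg_left h0'.le hX
    have h4 : X' * ((1 - c) * Y 1) < X' * ((1 + c + 2 * β) * Y 0) :=
      mul_lt_mul_of_pos_left h0 hX'
    have h5 : 0 ≤ X' * ((c' - c) * (Y 0 + Y 1)) :=
      mul_nonneg hX'.le (mul_nonneg (by linarith) (by linarith))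
    have h6 : 0 ≤ X' * ((β' - β) * Y 0) :=
      mul_nonneg hX'.le (mul_nonneg (by linarith) h1)
    have h7 : (c' + β') * (X * Y' 0 + X' * Y 0) ≤ 0 :=
      mul_nonpos_of_nonneg_of_nonpos (by linarith) h
    have h8 : (1 - c') * (X * Y' 1 + X' * Y 1) < (1 - c') * (X * Y' 0 + X' * Y 0) := by
      linarith
    exact lt_of_mul_lt_mul_left h8 (by linarith)
  · change X * Y' (i + 1) + X' * Y (i + 1) ≤ 0 at h
    have h1 := congrArg (X' * ·) (hrec i hi)
    have h2 := congrArg (X * ·) (hrec' i hi)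
    have h3 := hnonneg (i + 1) hi
    have h4 : X * (if i + 1 = p then 2 * X' else 0) = X' * (if i + 1 = p then 2 * X else 0) := by
      split_ifs <;> ring
    have h5 : 0 ≤ X' * ((c' - c) * (Y i + 2 * Y (i + 1) + Y (i + 1 + 1))) :=
      mul_nonneg hX'.le (mul_nonneg (by linarith) (hsum i hi))
    have h6 : 0 ≤ X' * (((β' - β) + (κ' - κ) * b (i + 1)) * Y (i + 1)) :=
      mul_nonneg hX'.le (mul_nonneg
        (by have := mul_nonneg (sub_nonneg.2 hκκ) (hb (i + 1)); linarith) h3)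
    have h7 : (2 * c' + β' + κ' * b (i + 1)) * (X * Y' (i + 1) + X' * Y (i + 1)) ≤ 0 :=
      mul_nonpos_of_nonneg_of_nonpos
        (by have := mul_nonneg (hκ.trans hκκ) (hb (i + 1)); linarith) h
    simp only [mul_sub, mul_add X] at h1 h2
    have h8 : (1 - c') * (X * Y' i + X' * Y i + (X * Y' (i + 1 + 1) + X' * Y (i + 1 + 1))) ≤
        (1 - c') * (2 * (X * Y' (i + 1) + X' * Y (i + 1))) := by
      linarith
    exact le_of_mul_le_mul_left h8 (by linarith)

/-! ### Reflecting the Perron vector -/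

/-- `rho E` times the difference of the entries at `u i` and at its mirror image `u (s - i)`. -/
noncomputable def reflected (E : Finset (Finset V)) (u : ℕ → V) (x : V → ℝ) (s i : ℕ) : ℝ :=
  rho E * (x (u i) - x (u (s - i)))

lemma reflected_sub (E : Finset (Finset V)) (u : ℕ → V) (x : V → ℝ) {s i : ℕ} (hi : i ≤ s) :
    reflected E u x s (s - i) = - reflected E u x s i := by
  rw [reflected, reflected, Nat.sub_sub_self hi]
  ring

namespace Spine

variable [Nontrivial V] {k : ℕ} {E : Finset (Finset V)} {M : ℕ} {u : ℕ → V} {ed : ℕ → Finset V}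
  (hS : Spine E M u ed) (hT : IsTree k E) {x : V → ℝ} (hx : IsPerron E x)
include hS hT hx

lemma reflected_extras {s i : ℕ} (hi : i + 1 ≤ s) (hs : s < M) :
    ∑ w ∈ extras u ed i, x w - ∑ w ∈ extras u ed (s - (i + 1)), x w =
      (k - 2) / (2 * rho E + k) * (reflected E u x s i + reflected E u x s (i + 1)) := by
  have h1 := hS.sum_extras hT hx (i := i) (by omega)
  have h2 := hS.sum_extras hT hx (i := s - (i + 1)) (by omega)
  rw [show s - (i + 1) + 1 = s - i by omega] at h2
  have hρ := rho_pos hT.conn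
  have hpos : (0 : ℝ) < 2 * rho E + k := by positivity
  rw [div_mul_eq_mul_div, eq_div_iff hpos.ne', reflected, reflected]
  linarith

/-- The boundary condition at the end of the spine; it is strict because the mirror image `u s` of
`u 0` is an inner vertex. -/
lemma reflected_boundary {s : ℕ} (hs1 : 1 ≤ s) (hs : s < M) :
    (1 - (k - 2) / (2 * rho E + k)) * reflected E u x s 1 <
      (1 + (k - 2) / (2 * rho E + k) + 2 * (1 / rho E)) * reflected E u x s 0 := by
  have h1 := hS.perron_first_diff hT hx
  have h2 := hS.perron_diff_lt hT hx (s := s - 1) (by omega)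
  have h3 := hS.reflected_extras hT hx (s := s) (i := 0) (by omega) hs
  rw [Nat.sub_add_cancel hs1] at h2
  rw [zero_add] at h3
  have hρ := rho_pos hT.conn
  have h4 : 1 / rho E * reflected E u x s 0 = x (u 0) - x (u s) := by
    rw [reflected]
    field_simp
    simp
  have h5 : reflected E u x s 0 = rho E * (x (u 0) - x (u s)) := by simp [reflected]
  have h6 : reflected E u x s 1 = rho E * (x (u 1) - x (u (s - 1))) := rfl
  linarith

/-- The eigenvalue equations as a recursion for the reflected Perron vector, up to the difference of
the star masses at mirror positions. -/
lemma reflected_rec {s i : ℕ} (hi : 2 * (i + 1) ≤ s) (hs : s < M) :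
    (1 - (k - 2) / (2 * rho E + k)) * (reflected E u x s i + reflected E u x s (i + 1 + 1)) =
      (2 + 2 * ((k - 2) / (2 * rho E + k)) + 2 * (1 / rho E)) * reflected E u x s (i + 1) +
      2 * (∑ w ∈ starLeaves E u ed (i + 1), x w -
        ∑ w ∈ starLeaves E u ed (s - (i + 1)), x w) := by
  have h1 := hS.perron_second_diff hT hx (i := i) (by omega)
  have h2 := hS.perron_second_diff hT hx (i := s - (i + 1 + 1)) (by omega)
  rw [show s - (i + 1 + 1) + 1 = s - (i + 1) by omega,
    show s - (i + 1) + 1 = s - i by omega] at h2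
  have h3 := hS.reflected_extras hT hx (s := s) (i := i) (by omega) hs
  have h3' := hS.reflected_extras hT hx (s := s) (i := i + 1) (by omega) hs
  have hρ := rho_pos hT.conn
  have h4 : 1 / rho E * reflected E u x s (i + 1) = x (u (i + 1)) - x (u (s - (i + 1))) := by
    rw [reflected]
    field_simp
  have h5 : ∀ j, reflected E u x s j = rho E * (x (u j) - x (u (s - j))) := fun j => rfl
  have h6 := h5 i
  have h7 := h5 (i + 1)
  have h8 := h5 (i + 1 + 1)
  linarith

/-- If there are equally many star edges at two mirror positions, the difference of their masses is
a multiple of the reflected Perron vector. -/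
lemma reflected_star {s i : ℕ} (hi : i < M) (hsi : s - i < M)
    (hcard : (starEdges E u ed i).card = (starEdges E u ed (s - i)).card) :
    ∑ w ∈ starLeaves E u ed i, x w - ∑ w ∈ starLeaves E u ed (s - i), x w =
      (k - 1) / (rho E + k) * (starEdges E u ed i).card * reflected E u x s i := by
  have h1 := hS.sum_starLeaves hT hx hi
  have h2 := hS.sum_starLeaves hT hx hsi
  rw [← hcard] at h2
  have hρ := rho_pos hT.conn
  have hpos : (0 : ℝ) < rho E + k := by positivity
  rw [div_mul_eq_mul_div, div_mul_eq_mul_div, eq_div_iff hpos.ne', reflected]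
  linarith

end Spine

/-- Comparison of two spectral radii through the scalar product of the two Perron vectors. -/
lemma le_rho_sub_mul {E E' : Finset (Finset V)} {x x' : V → ℝ} (hx : IsPerron E x)
    (hx' : IsPerron E' x') (s r : V → ℝ)
    (hM : ∀ w z, (edist E w z : ℝ) + s w * r z + s z * r w ≤ edist E' w z) :
    (∑ w, s w * x w) * (∑ z, r z * x' z) + (∑ z, s z * x' z) * (∑ w, r w * x w) ≤
      (rho E' - rho E) * ∑ w, x w * x' w := by
  have h1 : ∑ w, ∑ z, (edist E' w z : ℝ) * (x w * x' z) = rho E' * ∑ w, x w * x' w := by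
    rw [Finset.mul_sum]
    refine Finset.sum_congr rfl fun w _ => ?_
    rw [show rho E' * (x w * x' w) = x w * (rho E' * x' w) by ring, ← hx'.eigen w,
      Finset.mul_sum]
    exact Finset.sum_congr rfl fun z _ => by ring
  have h2 : ∑ w, ∑ z, (edist E w z : ℝ) * (x w * x' z) = rho E * ∑ w, x w * x' w := by
    rw [Finset.mul_sum, Finset.sum_comm]
    refine Finset.sum_congr rfl fun z _ => ?_
    rw [← mul_assoc, ← hx.eigen z, Finset.sum_mul]
    exact Finset.sum_congr rfl fun w _ => by rw [edist_comm E w z]; ring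
  have h3 : ∑ w, ∑ z, ((edist E w z : ℝ) + s w * r z + s z * r w) * (x w * x' z) ≤
      ∑ w, ∑ z, (edist E' w z : ℝ) * (x w * x' z) :=
    Finset.sum_le_sum fun w _ => Finset.sum_le_sum fun z _ =>
      mul_le_mul_of_nonneg_right (hM w z) (mul_pos (hx.pos w) (hx'.pos z)).le
  have h4 : ∑ w, ∑ z, s w * r z * (x w * x' z) = (∑ w, s w * x w) * ∑ z, r z * x' z := by
    rw [Finset.sum_mul_sum]
    exact Finset.sum_congr rfl fun w _ => Finset.sum_congr rfl fun z _ => by ring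
  have h5 : ∑ w, ∑ z, s z * r w * (x w * x' z) = (∑ z, s z * x' z) * ∑ w, r w * x w := by
    rw [Finset.sum_mul_sum, Finset.sum_comm]
    exact Finset.sum_congr rfl fun w _ => Finset.sum_congr rfl fun z _ => by ring
  simp only [add_mul, Finset.sum_add_distrib] at h3
  rw [h1, h2, h4, h5] at h3
  linarith

/-! ### Moving a star along the spine -/

namespace Spine

variable [Nontrivial V] {k m Δ n : ℕ} {E : Finset (Finset V)} {M : ℕ} {u : ℕ → V}
  {ed : ℕ → Finset V} (hS : Spine E M u ed)
include hS

section Move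

variable (hT : IsTree k E)
include hT

/-- Star edges are pendant: their branches consist of their own vertices. -/
lemma branches_starEdges {q : ℕ} (hq : q < M) :
    branches E (u q) (starEdges E u ed q) = starLeaves E u ed q := by
  ext w
  rw [mem_branches, mem_starLeaves]
  refine exists_congr fun e => and_congr_right fun he => ⟨fun hw => ?_, fun hw =>
    hT.mem_branch_of_mem hw.1 hw.2⟩
  refine ⟨?_, ne_of_mem_branch hw⟩
  by_contra hwe
  obtain ⟨y, hy, hlt⟩ := mem_branch.1 hw
  have hyq : y ≠ u q := by
    rintro rfl
    exact lt_irrefl _ hlt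
  have := hS.edist_star hT hq he hy hyq (z := w) fun h => hwe (Finset.mem_of_mem_erase h)
  rw [edist_comm E w y, edist_comm E w (u q)] at hlt
  omega

/-- The star at `u q` can be moved to `u p`. -/
lemma exchangeable_star {p q : ℕ} (hpq : p < q) (hq : q < M) :
    Exchangeable k E (u q) (u p) (starEdges E u ed q) ∅ where
  tree := hT
  ne h := hpq.ne' (hS.vertex_inj hq.le (by omega) h)
  sub₁ f hf := (mem_starEdges.1 hf).1
  sub₂ := by simp
  mem₁ f hf := (mem_starEdges.1 hf).2.1
  mem₂ := by simp
  not_mem₁ f hf h := by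
    have h1 : u p ∈ branches E (u q) (starEdges E u ed q) := mem_branches.2 ⟨f, hf, h⟩
    rw [hS.branches_starEdges hT hq] at h1
    exact hS.spine_not_mem_star hT hq (by omega) h1
  not_mem₂ := by simp

variable {p q : ℕ} (hp : 0 < p) (hpq : p < q) (hq : q < M)
include hp hpq hq

lemma ed_mem_move {i : ℕ} (hi : i < M) : ed i ∈ exchange E (u q) (u p) (starEdges E u ed q) ∅ :=
  (hS.exchangeable_star hT hpq hq).mem_exchange_of_not_mem (hS.edge_mem i hi)
    (hS.ed_not_mem_starEdges hi hq) (by simp)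

/-- The spine remains a spine when a star is moved along it. -/
lemma move : Spine (exchange E (u q) (u p) (starEdges E u ed q) ∅) M u ed := by
  have hex := hS.exchangeable_star hT hpq hq
  have hnot : ∀ i ≤ M, moved E (u q) (u p) (starEdges E u ed q) ∅ (u i) = 0 := by
    intro i hi
    have := hS.spine_not_mem_star hT hq hi
    rw [← hS.branches_starEdges hT hq] at this
    simp [moved, this, mem_branches]
  refine ⟨hS.two_le, fun i j hij hj => le_antisymm ?_ ?_,
    fun i hi => hS.ed_mem_move hT hp hpq hq hi, hS.left_mem, hS.right_mem, fun w => ?_⟩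
  · obtain ⟨l, rfl⟩ := Nat.exists_eq_add_of_le hij
    rw [Nat.add_sub_cancel_left]
    clear hij
    induction l with
    | zero => simp
    | succ l ih =>
      have h1 := ih (by omega)
      have h2 := edist_triangle hex.connected (u i) (u (i + l)) (u (i + l + 1))
      have h3 := edist_le_one (hS.ed_mem_move hT hp hpq hq (i := i + l) (by omega))
        (hS.left_mem _ (by omega)) (hS.right_mem _ (by omega))
      rw [← add_assoc]
      omega
  · have h1 := hex.le_edist (u i) (u j)
    rw [hnot i (by omega), hnot j hj, hS.edist_eq i j hij hj] at h1
    simp only [zero_mul, add_zero] at h1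
    exact_mod_cast h1
  · rw [← hS.inner_iff w]
    have h1 := hex.deg_left
    have h2 := hex.deg_right
    have h3 := hS.card_starEdges hT (by omega) hq
    have h4 := hS.deg_inner hp (by omega)
    rw [Finset.card_empty] at h1 h2
    by_cases hwq : w = u q
    · subst hwq
      omega
    · by_cases hwp : w = u p
      · subst hwp
        omega
      · rw [hex.deg_of_ne hwq hwp]

lemma starLeaves_move_of_ne {i : ℕ} (hi : i < M) (hiq : i ≠ q) :
    starLeaves E u ed i ⊆
      starLeaves (exchange E (u q) (u p) (starEdges E u ed q) ∅) u ed i := by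
  intro z hz
  obtain ⟨e, he, h1, h2⟩ := mem_starLeaves.1 hz
  obtain ⟨h3, h4, h5, h6⟩ := mem_starEdges.1 he
  refine mem_starLeaves.2 ⟨e, mem_starEdges.2 ⟨?_, h4, h5, h6⟩, h1, h2⟩
  refine (hS.exchangeable_star hT hpq hq).mem_exchange_of_not_mem h3 (fun h => hiq ?_) (by simp)
  exact hS.eq_of_mem_starEdges hT hq hi.le h h4

/-- The vertices that are not moved keep their distances to the spine. -/
lemma edist_move {i : ℕ} (hi : i ≤ M) {z : V} (hz : z ∉ starLeaves E u ed q) :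
    edist (exchange E (u q) (u p) (starEdges E u ed q) ∅) (u i) z = edist E (u i) z := by
  have hS' := hS.move hT hp hpq hq
  have hT' := (hS.exchangeable_star hT hpq hq).isTree
  rcases hS.vertex_cases hT z with ⟨j, hj, rfl⟩ | ⟨j, hj, hj'⟩ | ⟨j, hj0, hj, hj'⟩
  · rw [hS.edist_spine hi hj, hS'.edist_spine hi hj]
  · have h1 := hS.two_mul_edist_spine_extras hT hj hi hj'
    have h2 := hS'.two_mul_edist_spine_extras hT' hj hi hj'
    omega
  · have hjq : j ≠ q := by
      rintro rfl
      exact hz hj'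
    rw [hS.edist_spine_star hT hj hi hj', hS'.edist_spine_star hT' hj hi
      (hS.starLeaves_move_of_ne hT hp hpq hq hj hjq hj')]

variable (hdp : deg E (u p) = 2)
include hdp

/-- After a star has been moved to a vertex without star edges, its leaves are the star leaves
there. -/
lemma starLeaves_move :
    starLeaves (exchange E (u q) (u p) (starEdges E u ed q) ∅) u ed p = starLeaves E u ed q := by
  have hex := hS.exchangeable_star hT hpq hq
  have hS' := hS.move hT hp hpq hq
  symm
  refine Finset.eq_of_subset_of_card_le (fun z hz => ?_) ?_
  · obtain ⟨e, he, h1, h2⟩ := mem_starLeaves.1 hz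
    have hzp := hS.not_spine_of_mem_star hT hq (j := p) (by omega) hz
    have hze : z ∈ insert (u p) (e.erase (u q)) := by simp [h1, h2]
    have hned : ∀ i < M, insert (u p) (e.erase (u q)) ≠ ed i := by
      intro i hi h
      rw [h] at hze
      exact hS.not_mem_extras_of_star hT hq hi hz (mem_extras.2 ⟨hze,
        hS.not_spine_of_mem_star hT hq hi.le hz, hS.not_spine_of_mem_star hT hq hi hz⟩)
    exact mem_starLeaves.2 ⟨_, mem_starEdges.2 ⟨hex.mem_exchange_of_mem he, by simp,
      hned _ (by omega), hned _ (by omega)⟩, hze, hzp⟩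
  · rw [hS'.card_starLeaves hex.isTree (by omega), hS.card_starLeaves hT hq]
    refine Nat.mul_le_mul_right _ ?_
    have h1 := hS'.card_starEdges hex.isTree hp (by omega)
    have h2 := hex.deg_right
    rw [Finset.card_empty, hdp] at h2
    omega

/-- A lower bound for the change of the spectral radius when a star is moved, in terms of the
Perron vectors before and after. -/
lemma le_rho_move_sub_mul {x x' : V → ℝ} (hx : IsPerron E x)
    (hx' : IsPerron (exchange E (u q) (u p) (starEdges E u ed q) ∅) x') :
    (∑ w ∈ starLeaves E u ed q, x w) * (rho (exchange E (u q) (u p) (starEdges E u ed q) ∅) *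
        (x' (u p) - x' (u q))) +
      (∑ w ∈ starLeaves E u ed q, x' w) * (rho E * (x (u p) - x (u q))) ≤
      (rho (exchange E (u q) (u p) (starEdges E u ed q) ∅) - rho E) * ∑ w, x w * x' w := by
  have hex := hS.exchangeable_star hT hpq hq
  have hS' := hS.move hT hp hpq hq
  have hA := hS.branches_starEdges hT hq
  have h1 := le_rho_sub_mul hx hx' _ _ hex.le_edist
  have hs : ∀ w, moved E (u q) (u p) (starEdges E u ed q) ∅ w =
      if w ∈ starLeaves E u ed q then 1 else 0 := by
    intro w
    simp [moved, hA, mem_branches]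
  have hr : ∀ w, shift E (u q) (u p) (starEdges E u ed q) ∅ w =
      edist E (u p) w - edist E (u q) w -
        if w ∈ starLeaves E u ed q then ((q - p : ℕ) : ℝ) else 0 := by
    intro w
    by_cases hw : w ∈ starLeaves E u ed q
    · have h2 := hS.edist_spine_star hT hq (j := p) (by omega) hw
      have h3 := hS.edist_spine_star hT hq (j := q) (by omega) hw
      have h4 : edist E (u p) w = edist E (u q) w + (q - p) := by omega
      simp [shift, hA, hw, h4]
    · simp [shift, hA, hw, mem_branches]
  have hr' : ∀ w, shift E (u q) (u p) (starEdges E u ed q) ∅ w =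
      edist (exchange E (u q) (u p) (starEdges E u ed q) ∅) (u p) w -
        edist (exchange E (u q) (u p) (starEdges E u ed q) ∅) (u q) w +
        if w ∈ starLeaves E u ed q then ((q - p : ℕ) : ℝ) else 0 := by
    intro w
    by_cases hw : w ∈ starLeaves E u ed q
    · have hw' := hw
      rw [← hS.starLeaves_move hT hp hpq hq hdp] at hw'
      have h2 := hS'.edist_spine_star hex.isTree (hpq.trans hq) (j := p) (by omega) hw'
      have h3 := hS'.edist_spine_star hex.isTree (hpq.trans hq) (j := q) (by omega) hw'
      have h4 : edist (exchange E (u q) (u p) (starEdges E u ed q) ∅) (u q) w =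
          edist (exchange E (u q) (u p) (starEdges E u ed q) ∅) (u p) w + (q - p) := by omega
      simp [shift, hA, hw, h4]
    · rw [hr w, hS.edist_move hT hp hpq hq (by omega) hw,
        hS.edist_move hT hp hpq hq hq.le hw]
      simp [hw]
  have e1 : ∑ w, shift E (u q) (u p) (starEdges E u ed q) ∅ w * x w =
      rho E * x (u p) - rho E * x (u q) -
        ((q - p : ℕ) : ℝ) * ∑ w ∈ starLeaves E u ed q, x w := by
    simp only [hr, sub_mul, Finset.sum_sub_distrib, hx.eigen, sum_ite_mem_mul]
  have e2 : ∑ w, shift E (u q) (u p) (starEdges E u ed q) ∅ w * x' w =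
      rho (exchange E (u q) (u p) (starEdges E u ed q) ∅) * x' (u p) -
        rho (exchange E (u q) (u p) (starEdges E u ed q) ∅) * x' (u q) +
        ((q - p : ℕ) : ℝ) * ∑ w ∈ starLeaves E u ed q, x' w := by
    simp only [hr', sub_mul, add_mul, Finset.sum_sub_distrib, Finset.sum_add_distrib, hx'.eigen,
      sum_ite_mem_mul]
  rw [e1, e2] at h1
  simp only [hs, sum_ite_mem_mul, one_mul] at h1
  linarith

end Move

/-- In a maximizer, the numbers `a` and `b` of stars at the two ends of the spine differ by at most
one: otherwise the innermost star of the larger group could be moved to the other group. -/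
lemma balanced (hE : IsMaximizer k m Δ n E) (hΔ : 3 ≤ Δ) {a b : ℕ} (hab : a + 2 ≤ b)
    (habM : a + b + 2 ≤ M)
    (hstar : ∀ i, 0 < i → i < M → (deg E (u i) = Δ ↔ i ≤ a ∨ M ≤ i + b)) : False := by
  have hT := hE.mem.tree
  have hk := hT.two_le
  obtain ⟨q, hqM⟩ : ∃ q, q + b = M := ⟨M - b, by omega⟩
  have hq : q < M := by omega
  have hpq : a + 1 < q := by omega
  have hp : 0 < a + 1 := by omega
  have hcard := fun i h1 h2 => hS.card_starEdges hT (i := i) h1 h2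
  have hdeg : ∀ i, 0 < i → i < M → deg E (u i) = if i ≤ a ∨ M ≤ i + b then Δ else 2 := by
    intro i h1 h2
    split_ifs with h
    · exact (hstar i h1 h2).2 h
    · exact le_antisymm (hE.deg_le_two hΔ fun hd => h ((hstar i h1 h2).1 hd)) (hS.deg_inner h1 h2)
  have hdq : deg E (u q) = Δ := (hstar q (by omega) hq).2 (Or.inr (by omega))
  have hdp : deg E (u (a + 1)) = 2 := by
    rw [hdeg (a + 1) hp (by omega), if_neg (by omega)]
  have hex := hS.exchangeable_star hT hpq hq
  have hS' := hS.move hT hp hpq hq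
  have hL := hS.starLeaves_move hT hp hpq hq hdp
  have hle2 := hE.le _ (hE.mem.exchange_swap hex (by
    have := hcard q (by omega) hq
    rw [Finset.card_empty]
    omega))
  obtain ⟨x, hx⟩ := exists_isPerron hT.conn
  obtain ⟨x', hx'⟩ := exists_isPerron hex.connected
  have hmain := hS.le_rho_move_sub_mul hT hp hpq hq hdp hx hx'
  have hcard' := fun i h1 h2 => hS'.card_starEdges hex.isTree (i := i) h1 h2
  have hdeg' : ∀ i, 0 < i → i < M → i ≠ a + 1 → i ≠ q →
      deg (exchange E (u q) (u (a + 1)) (starEdges E u ed q) ∅) (u i) = deg E (u i) :=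
    fun i h1 h2 h3 h4 => hex.deg_of_ne (fun h => h4 (hS.vertex_inj h2.le hq.le h))
      fun h => h3 (hS.vertex_inj h2.le (by omega) h)
  have hdq' : deg (exchange E (u q) (u (a + 1)) (starEdges E u ed q) ∅) (u q) = 2 := by
    have h1 := hex.deg_left
    have h2 := hcard q (by omega) hq
    rw [Finset.card_empty] at h1
    omega
  generalize hE' : exchange E (u q) (u (a + 1)) (starEdges E u ed q) ∅ = E' at *
  have hT' : IsTree k E' := hE' ▸ hex.isTree
  have hρ := rho_pos hT.conn
  have hρ' := rho_pos hT'.conn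
  have hk2 : (2 : ℝ) ≤ k := by exact_mod_cast hk
  -- positions without star edges
  have hzero : ∀ i, 0 < i → i < M → deg E (u i) = 2 → starLeaves E u ed i = ∅ := by
    intro i h1 h2 h3
    have h4 := hS.card_starLeaves hT h2
    have := hcard i h1 h2
    rw [show (starEdges E u ed i).card = 0 by omega, zero_mul] at h4
    exact Finset.card_eq_zero.1 h4
  have hzero' : ∀ i, 0 < i → i < M → deg E' (u i) = 2 → starLeaves E' u ed i = ∅ := by
    intro i h1 h2 h3
    have h4 := hS'.card_starLeaves hT' h2
    have := hcard' i h1 h2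
    rw [show (starEdges E' u ed i).card = 0 by omega, zero_mul] at h4
    exact Finset.card_eq_zero.1 h4
  have hXpos : ∀ y : V → ℝ, (∀ v, 0 < y v) → 0 < ∑ w ∈ starLeaves E u ed q, y w := by
    intro y hy
    refine Finset.sum_pos (fun w _ => hy w) (Finset.card_pos.1 ?_)
    have := hcard q (by omega) hq
    rw [hS.card_starLeaves hT hq]
    exact Nat.mul_pos (by omega) (by omega)
  have hXx := hXpos x hx.pos
  have hXx' := hXpos x' hx'.pos
  have hs : a + 1 + q < M := by omega
  -- reflection of the spine at the midpoint of `a + 1` and `q`; the stars at `1, …, a` are mirrored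
  -- to stars at `q + 1, …, q + a`, which belong to the larger group because `a < b`
  have hpos := pos_of_reflected (s := a + 1 + q) (p := a + 1)
    (X := ∑ w ∈ starLeaves E u ed q, x w) (X' := ∑ w ∈ starLeaves E u ed q, x' w)
    (β := 1 / rho E) (β' := 1 / rho E')
    (c := (k - 2) / (2 * rho E + k)) (c' := (k - 2) / (2 * rho E' + k))
    (κ := (k - 1) / (rho E + k)) (κ' := (k - 1) / (rho E' + k))
    (b := fun i => if i ≤ a then (Δ - 2 : ℕ) else 0)
    (Y := reflected E u x (a + 1 + q)) (Y' := reflected E' u x' (a + 1 + q))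
    (by omega) (by omega) hXx.le hXx' (div_nonneg (by linarith) (by positivity))
    (div_le_div_of_nonneg_left (by linarith) (by positivity) (by linarith))
    ((div_lt_one (by positivity)).2 (by linarith)) (by positivity)
    (one_div_le_one_div_of_le hρ' hle2) (div_nonneg (by linarith) (by positivity))
    (div_le_div_of_nonneg_left (by linarith) (by positivity) (by linarith))
    (fun i => by split_ifs <;> positivity)
    (fun i hi => reflected_sub _ _ _ hi) (fun i hi => reflected_sub _ _ _ hi)
    (hS.reflected_boundary hT hx (by omega) hs) (hS'.reflected_boundary hT' hx' (by omega) hs)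
    ?_ ?_
  · have h1 : reflected E u x (a + 1 + q) (a + 1) = rho E * (x (u (a + 1)) - x (u q)) := by
      rw [reflected, Nat.add_sub_cancel_left]
    have h2 : reflected E' u x' (a + 1 + q) (a + 1) =
        rho E' * (x' (u (a + 1)) - x' (u q)) := by
      rw [reflected, Nat.add_sub_cancel_left]
    rw [h1, h2] at hpos
    have h3 : 0 ≤ ∑ w, x w * x' w :=
      Finset.sum_nonneg fun w _ => (mul_pos (hx.pos w) (hx'.pos w)).le
    have h4 := mul_nonpos_of_nonpos_of_nonneg (sub_nonpos.2 hle2) h3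
    linarith
  · intro i hi
    rw [hS.reflected_rec hT hx hi hs]
    have h1 := hdeg (i + 1) (by omega) (by omega)
    have h2 := hdeg (a + 1 + q - (i + 1)) (by omega) (by omega)
    rcases lt_trichotomy (i + 1) (a + 1) with h | h | h
    · rw [if_pos (by omega)] at h1 h2
      have h3 := hcard (i + 1) (by omega) (by omega)
      have h4 := hcard (a + 1 + q - (i + 1)) (by omega) (by omega)
      rw [hS.reflected_star hT hx (by omega) (by omega) (by omega), if_pos (by omega),
        if_neg (by omega), show (starEdges E u ed (i + 1)).card = Δ - 2 by omega]
      ring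
    · have h5 : a + 1 + q - (i + 1) = q := by omega
      rw [if_neg (by omega)] at h1
      rw [hzero _ (by omega) (by omega) h1, h5, if_neg (by omega), if_pos h]
      simp
      ring
    · rw [if_neg (by omega)] at h1 h2
      rw [hzero _ (by omega) (by omega) h1, hzero _ (by omega) (by omega) h2, if_neg (by omega),
        if_neg (by omega)]
      simp
  · intro i hi
    rw [hS'.reflected_rec hT' hx' hi hs]
    have h1 := hdeg (i + 1) (by omega) (by omega)
    have h2 := hdeg (a + 1 + q - (i + 1)) (by omega) (by omega)
    rcases lt_trichotomy (i + 1) (a + 1) with h | h | h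
    · rw [if_pos (by omega), ← hdeg' _ (by omega) (by omega) (by omega) (by omega)] at h1 h2
      have h3 := hcard' (i + 1) (by omega) (by omega)
      have h4 := hcard' (a + 1 + q - (i + 1)) (by omega) (by omega)
      rw [hS'.reflected_star hT' hx' (by omega) (by omega) (by omega), if_pos (by omega),
        if_neg (by omega), show (starEdges E' u ed (i + 1)).card = Δ - 2 by omega]
      ring
    · have h5 : a + 1 + q - (i + 1) = q := by omega
      rw [h5, hzero' q (by omega) hq hdq', h, hL, if_neg (by omega), if_pos rfl]
      simp
    · rw [if_neg (by omega)] at h1 h2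
      by_cases h6 : 2 * (i + 1) = a + 1 + q
      · have h7 : a + 1 + q - (i + 1) = i + 1 := by omega
        rw [h7, if_neg (by omega), if_neg (by omega)]
        simp
      · rw [← hdeg' _ (by omega) (by omega) (by omega) (by omega)] at h1 h2
        rw [hzero' _ (by omega) (by omega) h1, hzero' _ (by omega) (by omega) h2,
          if_neg (by omega), if_neg (by omega)]
        simp

end Spine

/-! ### The shape of a maximizer -/

section Shape

variable [Nontrivial V] {k m Δ n : ℕ} {E : Finset (Finset V)}

lemma Spine.card_inner {M : ℕ} {u : ℕ → V} {ed : ℕ → Finset V} (hS : Spine E M u ed)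
    (hE : InClass k m Δ n E) (hΔ : 3 ≤ Δ) :
    ((Finset.Ioo 0 M).filter fun i => deg E (u i) = Δ).card = n := by
  rw [← hE.card_deg]
  refine Finset.card_bij (fun i _ => u i) ?_ ?_ ?_
  · intro i hi
    simpa using (Finset.mem_filter.1 hi).2
  · intro i hi j hj hij
    simp only [Finset.mem_filter, Finset.mem_Ioo] at hi hj
    exact hS.vertex_inj (by omega) (by omega) hij
  · intro v hv
    have hd : deg E v = Δ := by simpa using hv
    obtain ⟨i, h1, h2, rfl⟩ := (hS.inner_iff v).1 (by omega)
    exact ⟨i, by simp [h1, h2, hd], rfl⟩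

/-- The spine of a maximizer can be chosen such that the stars are attached at the first `n / 2`
and the last `(n + 1) / 2` inner vertices. -/
lemma IsMaximizer.exists_balanced_spine (hE : IsMaximizer k m Δ n E) (hΔ : 3 ≤ Δ) (hn : 1 ≤ n) :
    ∃ M u ed, Spine E M u ed ∧ n < M ∧ ∀ i, 0 < i → i < M →
      (deg E (u i) = Δ ↔ i ≤ n / 2 ∨ M ≤ i + (n + 1) / 2) := by
  obtain ⟨M, u, ed, hS⟩ := hE.exists_spine hΔ hn
  have hM := hS.two_le
  have hcard := hS.card_inner hE.mem hΔ
  have hlt : n < M := by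
    have := Finset.card_filter_le (Finset.Ioo 0 M) fun i => deg E (u i) = Δ
    rw [hcard, Nat.card_Ioo] at this
    omega
  by_cases hall : ∀ i, 0 < i → i < M → deg E (u i) = Δ
  · refine ⟨M, u, ed, hS, hlt, fun i h1 h2 => iff_of_true (hall i h1 h2) ?_⟩
    rw [Finset.filter_true_of_mem fun i hi => hall i (Finset.mem_Ioo.1 hi).1
      (Finset.mem_Ioo.1 hi).2, Nat.card_Ioo] at hcard
    omega
  · push Not at hall
    obtain ⟨i₀, h1, h2, h3⟩ := hall
    have hne : ((Finset.Ioo 0 M).filter fun i => deg E (u i) ≠ Δ).Nonempty :=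
      ⟨i₀, by simp [h1, h2, h3]⟩
    obtain ⟨lo, hlo, hmin⟩ := Finset.exists_min_image _ id hne
    obtain ⟨hi, hhi, hmax⟩ := Finset.exists_max_image _ id hne
    simp only [Finset.mem_filter, Finset.mem_Ioo, id] at hlo hmin hhi hmax
    have hle := hmin hi hhi
    obtain ⟨a, rfl⟩ : ∃ a, lo = a + 1 := ⟨lo - 1, by omega⟩
    obtain ⟨b, hb⟩ : ∃ b, hi + b + 1 = M := ⟨M - hi - 1, by omega⟩
    have hiff : ∀ i, 0 < i → i < M → (deg E (u i) = Δ ↔ i ≤ a ∨ M ≤ i + b) := by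
      intro i hi0 hiM
      constructor
      · intro hd
        by_contra hnot
        push Not at hnot
        have hia : i ≠ a + 1 := by
          rintro rfl
          exact hlo.2 hd
        have hib : i ≠ hi := by
          rintro rfl
          exact hhi.2 hd
        exact hS.not_between hE hΔ (i := a + 1) (q := i) (j := hi) (by omega) (by omega)
          (by omega) (by omega) hlo.2 hd hhi.2
      · intro h
        by_contra hd
        have := hmin i ⟨⟨hi0, hiM⟩, hd⟩
        have := hmax i ⟨⟨hi0, hiM⟩, hd⟩
        omega
    have hn' : a + b = n := by
      rw [← hcard]
      have : (Finset.Ioo 0 M).filter (fun i => deg E (u i) = Δ) =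
          Finset.Ioc 0 a ∪ Finset.Ico (M - b) M := by
        ext i
        simp only [Finset.mem_filter, Finset.mem_Ioo, Finset.mem_union, Finset.mem_Ioc,
          Finset.mem_Ico]
        constructor
        · rintro ⟨⟨h4, h5⟩, h6⟩
          have := (hiff i h4 h5).1 h6
          omega
        · intro h
          have h4 : 0 < i ∧ i < M := by omega
          exact ⟨h4, (hiff i h4.1 h4.2).2 (by omega)⟩
      rw [this, Finset.card_union_of_disjoint]
      · simp only [Nat.card_Ioc, Nat.card_Ico]
        omega
      · rw [Finset.disjoint_left]
        intro i
        simp only [Finset.mem_Ioc, Finset.mem_Ico]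
        omega
    have h4 : ¬ a + 2 ≤ b := fun h => hS.balanced hE hΔ h (by omega) hiff
    have hiff' : ∀ i, 0 < i → i < M → (deg E (u (M - i)) = Δ ↔ i ≤ b ∨ M ≤ i + a) := by
      intro i hi0 hiM
      rw [hiff (M - i) (by omega) (by omega)]
      omega
    have h5 : ¬ b + 2 ≤ a := fun h => hS.reverse.balanced hE hΔ h (by omega) hiff'
    rcases le_total a b with hab | hab
    · refine ⟨M, u, ed, hS, hlt, fun i hi0 hiM => ?_⟩
      rw [hiff i hi0 hiM]
      omega
    · refine ⟨M, _, _, hS.reverse, hlt, fun i hi0 hiM => ?_⟩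
      rw [hiff' i hi0 hiM]
      omega

end Shape

/-! ### Representing hypergraphs by finite families of finite sets -/

/-- The family `E` on `V` is a copy of `G` along `f`. -/
structure Represents {α : Type*} (E : Finset (Finset V)) (G : Hypergraph α) (f : V → α) :
    Prop where
  inj : Function.Injective f
  range : Set.range f = G.vertexSet
  edge : ∀ s : Finset V, s ∈ E ↔ f '' s ∈ G.edgeSet

/-- A spine whose stars are placed as in the caterpillar identifies the family with it. -/
lemma Spine.exists_represents [Nontrivial V] {k Δ a b : ℕ} {E : Finset (Finset V)} {M : ℕ}
    {u : ℕ → V} {ed : ℕ → Finset V} (hS : Spine E M u ed) (hT : IsTree k E) (hΔ : 3 ≤ Δ)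
    (hle : ∀ v, deg E v ≠ Δ → deg E v ≤ 2)
    (hstar : ∀ i, 0 < i → i < M → (deg E (u i) = Δ ↔ i ≤ a ∨ M ≤ i + b)) :
    ∃ f, Represents E (Hypergraph.caterpillar k M Δ a b) f := by
  have hM := hS.two_le
  have hidx : ∀ i : {i : Fin (M + 1) // Hypergraph.IsStarIndex M a b i},
      0 < i.val.val ∧ i.val.val < M ∧ (i.val.val ≤ a ∨ M ≤ i.val.val + b) := by
    rintro ⟨i, hi⟩
    have := i.isLt
    simp only [Hypergraph.IsStarIndex] at hi
    dsimp only
    omega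
  have hcard : ∀ i : {i : Fin (M + 1) // Hypergraph.IsStarIndex M a b i},
      (starEdges E u ed i.val).card = Δ - 2 := by
    intro i
    obtain ⟨h1, h2, h3⟩ := hidx i
    have h4 := hS.card_starEdges hT h1 h2
    rw [(hstar _ h1 h2).2 h3] at h4
    omega
  -- enumerations of the vertices off the spine
  let X : ∀ i : Fin M, Fin (k - 2) ≃ extras u ed i := fun i =>
    ((extras u ed i).equivFinOfCardEq (hS.card_extras hT i.isLt)).symm
  let F : ∀ i : {i : Fin (M + 1) // Hypergraph.IsStarIndex M a b i},
      Fin (Δ - 2) ≃ starEdges E u ed i.val := fun i =>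
    ((starEdges E u ed i.val).equivFinOfCardEq (hcard i)).symm
  have hFc : ∀ i l, ((F i l).val.erase (u i.val)).card = k - 1 := by
    intro i l
    obtain ⟨h1, h2, -⟩ := mem_starEdges.1 (F i l).2
    rw [Finset.card_erase_of_mem h2, hT.unif _ h1]
  let L : ∀ i l, Fin (k - 1) ≃ ((F i l).val.erase (u i.val) : Finset V) := fun i l =>
    (((F i l).val.erase (u i.val)).equivFinOfCardEq (hFc i l)).symm
  let φ : Hypergraph.CaterpillarVertex k M Δ a b → V :=
    Sum.elim (fun i => u i) (Sum.elim (fun p => (X p.1 p.2).val)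
      fun p => (L p.1 p.2.1 p.2.2).val)
  have hφ1 : ∀ i, φ (Sum.inl i) = u i := fun i => rfl
  have hφ2 : ∀ i j, φ (Sum.inr (Sum.inl (i, j))) = (X i j).val := fun i j => rfl
  have hφ3 : ∀ i l j, φ (Sum.inr (Sum.inr (i, l, j))) = (L i l j).val := fun i l j => rfl
  have hLmem : ∀ i l j, (L i l j).val ∈ starLeaves E u ed i.val := by
    intro i l j
    have h1 := Finset.mem_erase.1 (L i l j).2
    exact mem_starLeaves.2 ⟨_, (F i l).2, h1.2, h1.1⟩
  have hinj : Function.Injective φ := by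
    rintro (i | ⟨i, j⟩ | ⟨i, l, j⟩) (i' | ⟨i', j'⟩ | ⟨i', l', j'⟩) h
    · rw [hφ1, hφ1] at h
      have := hS.vertex_inj (by omega) (by omega) h
      rw [Fin.ext this]
    · rw [hφ1, hφ2] at h
      exact absurd h.symm (hS.not_spine_of_mem_extras hT i'.isLt (by omega) (X i' j').2)
    · rw [hφ1, hφ3] at h
      exact absurd h.symm (hS.not_spine_of_mem_star hT (hidx i').2.1 (by omega) (hLmem i' l' j'))
    · rw [hφ1, hφ2] at h
      exact absurd h (hS.not_spine_of_mem_extras hT i.isLt (by omega) (X i j).2)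
    · rw [hφ2, hφ2] at h
      have h1 := (X i' j').2
      rw [← h] at h1
      have h2 := Fin.ext (hS.extras_unique hT i.isLt i'.isLt (X i j).2 h1)
      subst h2
      rw [(X i).injective (Subtype.ext h)]
    · rw [hφ2, hφ3] at h
      have h1 := hLmem i' l' j'
      rw [← h] at h1
      exact absurd (X i j).2 (hS.not_mem_extras_of_star hT (hidx i').2.1 i.isLt h1)
    · rw [hφ1, hφ3] at h
      exact absurd h (hS.not_spine_of_mem_star hT (hidx i).2.1 (by omega) (hLmem i l j))
    · rw [hφ2, hφ3] at h
      have h1 := hLmem i l j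
      rw [h] at h1
      exact absurd (X i' j').2 (hS.not_mem_extras_of_star hT (hidx i).2.1 i'.isLt h1)
    · rw [hφ3, hφ3] at h
      have h1 := hLmem i l j
      have h1' := hLmem i' l' j'
      rw [← h] at h1'
      have h2 := Subtype.ext (Fin.ext (hS.star_unique hT (hidx i).2.1 (hidx i').2.1 h1 h1'))
      subst h2
      have h3 := (Finset.mem_erase.1 (L i l j).2).2
      have h4 := (Finset.mem_erase.1 (L i l' j').2).2
      rw [← h] at h4
      have h5 := edge_eq_of_deg (hS.deg_starLeaves hT (hidx i).2.1 h1)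
        (mem_starEdges.1 (F i l).2).1 (mem_starEdges.1 (F i l').2).1 h3 h4
      have h6 := (F i).injective (Subtype.ext h5)
      subst h6
      rw [(L i l).injective (Subtype.ext h)]
  have hindex : ∀ i, 0 < i → ∀ h : i < M, (starEdges E u ed i).Nonempty →
      Hypergraph.IsStarIndex M a b ⟨i, by omega⟩ := by
    intro i h1 h2 h3
    have h4 := hS.card_starEdges hT h1 h2
    have h5 := Finset.card_pos.2 h3
    have h6 : deg E (u i) = Δ := by
      by_contra hd
      have := hle _ hd
      omega
    have := (hstar i h1 h2).1 h6
    simp only [Hypergraph.IsStarIndex]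
    omega
  have himg1 : ∀ i, φ '' Hypergraph.caterpillarPathEdge k M Δ a b i = ed i := by
    intro i
    ext z
    simp only [Hypergraph.caterpillarPathEdge, Set.image_union, Set.image_insert_eq,
      Set.image_singleton, ← Set.range_comp, Set.mem_union, Set.mem_insert_iff,
      Set.mem_singleton_iff, Set.mem_range, Function.comp, hφ1, hφ2, Finset.mem_coe,
      Fin.val_castSucc, Fin.val_succ]
    constructor
    · rintro ((rfl | rfl) | ⟨j, rfl⟩)
      · exact hS.left_mem i i.isLt
      · exact hS.right_mem i i.isLt
      · exact (mem_extras.1 (X i j).2).1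
    · intro hz
      by_cases h1 : z = u i
      · exact Or.inl (Or.inl h1)
      · by_cases h2 : z = u (i + 1)
        · exact Or.inl (Or.inr h2)
        · exact Or.inr ⟨(X i).symm ⟨z, mem_extras.2 ⟨hz, h1, h2⟩⟩, by simp⟩
  have himg2 : ∀ i l, φ '' Hypergraph.caterpillarStarEdge k M Δ a b i l = (F i l).val := by
    intro i l
    ext z
    simp only [Hypergraph.caterpillarStarEdge, Set.image_union, Set.image_singleton,
      ← Set.range_comp, Set.mem_union, Set.mem_singleton_iff, Set.mem_range, Function.comp, hφ1,
      hφ3, Finset.mem_coe]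
    constructor
    · rintro (rfl | ⟨j, rfl⟩)
      · exact (mem_starEdges.1 (F i l).2).2.1
      · exact (Finset.mem_erase.1 (L i l j).2).2
    · intro hz
      by_cases h1 : z = u i.val
      · exact Or.inl h1
      · exact Or.inr ⟨(L i l).symm ⟨z, Finset.mem_erase.2 ⟨h1, hz⟩⟩, by simp⟩
  have hsurj : Function.Surjective φ := by
    intro z
    rcases hS.vertex_cases hT z with ⟨i, hi, rfl⟩ | ⟨i, hi, hz⟩ | ⟨i, h0, hi, hz⟩
    · exact ⟨Sum.inl ⟨i, by omega⟩, rfl⟩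
    · exact ⟨Sum.inr (Sum.inl (⟨i, hi⟩, (X ⟨i, hi⟩).symm ⟨z, hz⟩)), by rw [hφ2]; simp⟩
    · obtain ⟨e, he, h1, h2⟩ := mem_starLeaves.1 hz
      have hi' := hindex i h0 hi ⟨e, he⟩
      have h3 : z ∈ (φ '' Hypergraph.caterpillarStarEdge k M Δ a b ⟨⟨i, by omega⟩, hi'⟩
          ((F ⟨⟨i, by omega⟩, hi'⟩).symm ⟨e, he⟩)) := by
        rw [himg2]
        simpa using h1
      obtain ⟨y, -, hy⟩ := h3
      exact ⟨y, hy⟩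
  let ψ := Equiv.ofBijective φ ⟨hinj, hsurj⟩
  refine ⟨ψ.symm, ψ.symm.injective, ?_, fun s => ?_⟩
  · rw [ψ.symm.surjective.range_eq]
    rfl
  · have hiff : ∀ t : Set (Hypergraph.CaterpillarVertex k M Δ a b),
        ψ.symm '' s = t ↔ (s : Set V) = φ '' t := fun t =>
      (ψ.eq_image_iff_symm_image_eq _ _).symm
    simp only [Hypergraph.caterpillar, Set.mem_union, Set.mem_range, Set.mem_ofPred_eq,
      hiff, himg1, himg2, Finset.coe_inj, eq_comm (b := ψ.symm '' (s : Set V))]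
    constructor
    · intro hs
      have hk := hT.two_le
      obtain ⟨z, hz⟩ := Finset.card_pos.1 (by rw [hT.unif s hs]; omega : 0 < s.card)
      have hstarEdge : ∀ i, 0 < i → i < M → s ∈ starEdges E u ed i → ∃ i l, s = (F i l).val := by
        intro i h0 hi h
        have hi' := hindex i h0 hi ⟨s, h⟩
        exact ⟨⟨⟨i, by omega⟩, hi'⟩, (F ⟨⟨i, by omega⟩, hi'⟩).symm ⟨s, h⟩, by simp⟩
      rcases hS.vertex_cases hT z with ⟨i, hi, rfl⟩ | ⟨i, hi, hz'⟩ | ⟨i, h0, hi, hz'⟩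
      · by_cases h0 : i = 0
        · subst h0
          have hd : deg E (u 0) = 1 := hS.deg_eq_one hT fun j h1 h2 h3 => by
            have := hS.vertex_inj (by omega) h2.le h3
            omega
          exact Or.inl ⟨⟨0, by omega⟩, edge_eq_of_deg hd hs (hS.edge_mem 0 (by omega)) hz
            (hS.left_mem 0 (by omega))⟩
        · by_cases h1 : i = M
          · obtain ⟨j, rfl⟩ : ∃ j, M = j + 1 := ⟨M - 1, by omega⟩
            subst h1
            have hd : deg E (u (j + 1)) = 1 := hS.deg_eq_one hT fun l h1 h2 h3 => by
              have := hS.vertex_inj le_rfl h2.le h3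
              omega
            exact Or.inl ⟨⟨j, by omega⟩, edge_eq_of_deg hd hs (hS.edge_mem j (by omega)) hz
              (hS.right_mem j (by omega))⟩
          · by_cases h2 : s = ed (i - 1)
            · exact Or.inl ⟨⟨i - 1, by omega⟩, h2⟩
            · by_cases h3 : s = ed i
              · exact Or.inl ⟨⟨i, by omega⟩, h3⟩
              · exact Or.inr (hstarEdge i (by omega) (by omega)
                  (mem_starEdges.2 ⟨hs, hz, h2, h3⟩))
      · exact Or.inl ⟨⟨i, hi⟩, edge_eq_of_deg (hS.deg_extras hT hi hz') hs (hS.edge_mem i hi) hz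
          (mem_extras.1 hz').1⟩
      · obtain ⟨e, he, h1, -⟩ := mem_starLeaves.1 hz'
        have h2 := edge_eq_of_deg (hS.deg_starLeaves hT hi hz') hs (mem_starEdges.1 he).1 hz h1
        exact Or.inr (hstarEdge i h0 hi (h2 ▸ he))
    · rintro (⟨i, rfl⟩ | ⟨i, l, rfl⟩)
      · exact hS.edge_mem i i.isLt
      · exact (mem_starEdges.1 (F i l).2).1

/-! ### Paths and cycles -/

/-- A shortest path: its vertices and edges are pairwise distinct. -/
lemma exists_geodesic {E : Finset (Finset V)} {x y : V} (h : (twoSection E).Reachable x y) :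
    ∃ (v : ℕ → V) (ed : ℕ → Finset V), v 0 = x ∧ v (edist E x y) = y ∧
      (∀ i < edist E x y, ed i ∈ E ∧ v i ∈ ed i ∧ v (i + 1) ∈ ed i) ∧
      (∀ i j, i < j → j ≤ edist E x y → v i ≠ v j) ∧
      ∀ i j, i < j → j < edist E x y → ed i ≠ ed j := by
  obtain ⟨p, hp⟩ := h.exists_walk_length_eq_dist
  have hed : ∀ i, ∃ e, i < edist E x y → e ∈ E ∧ p.getVert i ∈ e ∧ p.getVert (i + 1) ∈ e := by
    intro i
    by_cases hi : i < edist E x y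
    · obtain ⟨-, e, he⟩ := p.adj_getVert_succ (i := i) (by rw [hp]; exact hi)
      exact ⟨e, fun _ => he⟩
    · exact ⟨∅, fun h => absurd h hi⟩
  choose ed hed using hed
  -- a shortcut from the `i`-th to the `j`-th vertex
  have hshort : ∀ i j, j ≤ edist E x y →
      ∀ w : (twoSection E).Walk (p.getVert i) (p.getVert j), j ≤ i + w.length := by
    intro i j hj w
    have h1 : edist E x y ≤ _ := SimpleGraph.dist_le (((p.take i).append w).append (p.drop j))
    have h2 : p.length = edist E x y := hp
    simp only [SimpleGraph.Walk.length_append, SimpleGraph.Walk.take_length,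
      SimpleGraph.Walk.drop_length, h2] at h1
    omega
  refine ⟨p.getVert, ed, p.getVert_zero, ?_, hed, fun i j hij hj h => ?_, fun i j hij hj h => ?_⟩
  · rw [edist, ← hp]
    exact p.getVert_length
  · have := hshort i j hj (SimpleGraph.Walk.nil.copy rfl h)
    simp at this
    omega
  · obtain ⟨h1, h2, -⟩ := hed i (by omega)
    obtain ⟨-, -, h3⟩ := hed j hj
    rw [← h] at h3
    by_cases heq : p.getVert i = p.getVert (j + 1)
    · have := hshort i (j + 1) hj (SimpleGraph.Walk.nil.copy rfl heq)
      simp at this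
      omega
    · have hadj : (twoSection E).Adj (p.getVert i) (p.getVert (j + 1)) := ⟨heq, ed i, h1, h2, h3⟩
      have := hshort i (j + 1) hj hadj.toWalk
      simp at this
      omega

namespace Represents

variable {α : Type*} {E : Finset (Finset V)} {G : Hypergraph α} {f : V → α}
  (hR : Represents E G f)
include hR

lemma exists_edge {e : Set α} (he : e ∈ G.edgeSet) : ∃ s ∈ E, f '' (s : Set V) = e := by
  classical
  have h1 : f '' (f ⁻¹' e) = e := by
    rw [Set.image_preimage_eq_iff, hR.range]
    exact G.subset_vertexSet_of_mem_edgeSet' he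
  refine ⟨(f ⁻¹' e).toFinset, (hR.edge _).2 ?_, ?_⟩
  · simpa [h1] using he
  · simp [h1]

lemma edgeSet_eq : G.edgeSet = (fun s : Finset V => f '' (s : Set V)) '' E := by
  ext e
  constructor
  · intro he
    obtain ⟨s, hs, h⟩ := hR.exists_edge he
    exact ⟨s, hs, h⟩
  · rintro ⟨s, hs, rfl⟩
    exact (hR.edge s).1 hs

lemma image_injective : Function.Injective fun s : Finset V => f '' (s : Set V) :=
  hR.inj.image_injective.comp Finset.coe_injective

lemma mem_vertexSet (v : V) : f v ∈ G.vertexSet := hR.range ▸ Set.mem_range_self v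

/-- Walks of `G` come from walks of `E`. -/
lemma lift_walk {p : ℕ} {v : Fin (p + 1) → α} {e : Fin p → Set α} (h : G.IsWalk v e) :
    ∃ (w : Fin (p + 1) → V) (s : Fin p → Finset V), (∀ i, f (w i) = v i) ∧
      ∀ i, s i ∈ E ∧ f '' (s i : Set V) = e i ∧ w i.castSucc ∈ s i ∧ w i.succ ∈ s i := by
  have h1 : ∀ i, ∃ y, f y = v i := fun i => by
    have := h.vertex_mem i
    rwa [← hR.range] at this
  choose w hw using h1
  choose s hs hse using fun i => hR.exists_edge (h.edge_mem i)
  have key : ∀ i a, f a ∈ e i → a ∈ s i := by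
    intro i a ha
    rw [← hse i] at ha
    simpa using (hR.inj.mem_set_image).1 ha
  exact ⟨w, s, hw, fun i => ⟨hs i, hse i, key i _ (hw _ ▸ h.left_mem i),
    key i _ (hw _ ▸ h.right_mem i)⟩⟩

lemma hasPath {x y : V} (h : (twoSection E).Reachable x y) :
    G.HasPath (f x) (f y) (edist E x y) := by
  obtain ⟨v, ed, h0, hp, hmem, hv, hed⟩ := exists_geodesic h
  have hv' : Function.Injective fun i : Fin (edist E x y + 1) => f (v i) := by
    intro i j hij
    have hij' := hR.inj hij
    rcases lt_trichotomy i.val j.val with h | h | h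
    · exact absurd hij' (hv _ _ h (by omega))
    · exact Fin.ext h
    · exact absurd hij'.symm (hv _ _ h (by omega))
  refine ⟨fun i => f (v i), fun i => f '' (ed i : Set V), ⟨⟨fun i => hR.mem_vertexSet _,
    fun i => (hR.edge _).1 (hmem i i.isLt).1, fun i => ?_, fun i => ?_, fun i h => ?_⟩, hv', ?_⟩,
    ?_, ?_⟩
  · exact ⟨_, (hmem i i.isLt).2.1, rfl⟩
  · exact ⟨_, (hmem i i.isLt).2.2, rfl⟩
  · have := congrArg Fin.val (hv' h)
    simp at this
  · intro i j hij
    have hij' := hR.image_injective hij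
    rcases lt_trichotomy i.val j.val with h | h | h
    · exact absurd hij' (hed _ _ h (by omega))
    · exact Fin.ext h
    · exact absurd hij'.symm (hed _ _ h (by omega))
  · simp [h0]
  · simp [hp]

section Connected

variable (hE : (twoSection E).Connected)
include hE

lemma edist_le {x y : V} {p : ℕ} (h : G.HasPath (f x) (f y) p) : edist E x y ≤ p := by
  obtain ⟨v, e, hpath, h0, hp⟩ := h
  obtain ⟨w, s, hw, hs⟩ := hR.lift_walk hpath.toIsWalk
  have key : ∀ i : Fin (p + 1), edist E x (w i) ≤ i := by
    intro i
    induction i using Fin.induction with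
    | zero =>
      have : w 0 = x := hR.inj (by rw [hw, h0])
      simp [this]
    | succ i ih =>
      obtain ⟨h1, -, h2, h3⟩ := hs i
      have := edist_le_succ hE h1 h3 h2 x
      simp only [Fin.val_castSucc, Fin.val_succ] at ih ⊢
      omega
  have hy : w (Fin.last p) = y := hR.inj (by rw [hw, hp])
  simpa [hy] using key (Fin.last p)

lemma dist_eq (x y : V) : G.dist (f x) (f y) = edist E x y := by
  have h := hR.hasPath (hE.preconnected x y)
  exact le_antisymm (Nat.sInf_le h) (le_csInf ⟨_, h⟩ fun p hp => hR.edist_le hE hp)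

lemma distSpectralRadius_eq [Finite G.vertexSet] : G.distSpectralRadius = rho E := by
  classical
  let _ : Fintype G.vertexSet := Fintype.ofFinite _
  have h1 : G.distSpectralRadius = topEigenvalue G.distMatrix := by
    unfold Hypergraph.distSpectralRadius topEigenvalue
    congr!
  rw [h1]
  exact topEigenvalue_reindex ((Equiv.ofInjective f hR.inj).trans (Equiv.setCongr hR.range)) _ _
    fun x y => congrArg Nat.cast (hR.dist_eq hE x y)

end Connected

lemma degree_eq (v : V) : G.degree (f v) = deg E v := by
  have : {e | e ∈ G.edgeSet ∧ f v ∈ e} =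
      (fun s : Finset V => f '' (s : Set V)) '' (E.filter (v ∈ ·) : Finset (Finset V)) := by
    rw [hR.edgeSet_eq]
    ext e
    constructor
    · rintro ⟨⟨s, hs, rfl⟩, hv⟩
      have := (hR.inj.mem_set_image).1 hv
      exact ⟨s, by simpa using ⟨hs, this⟩, rfl⟩
    · rintro ⟨s, hs, rfl⟩
      simp only [Finset.coe_filter, Set.mem_ofPred_eq] at hs
      exact ⟨⟨s, hs.1, rfl⟩, v, hs.2, rfl⟩
  rw [Hypergraph.degree, this, Set.ncard_image_of_injective _ hR.image_injective,
    Set.ncard_coe_finset]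
  rfl

lemma ncard_edge (s : Finset V) : (f '' (s : Set V)).ncard = s.card := by
  rw [Set.ncard_image_of_injective _ hR.inj, Set.ncard_coe_finset]

lemma ncard_edgeSet : G.edgeSet.ncard = E.card := by
  rw [hR.edgeSet_eq, Set.ncard_image_of_injective _ hR.image_injective, Set.ncard_coe_finset]

lemma ncard_degree (Δ : ℕ) : {v | v ∈ G.vertexSet ∧ G.degree v = Δ}.ncard =
    (Finset.univ.filter (deg E · = Δ)).card := by
  have : {v | v ∈ G.vertexSet ∧ G.degree v = Δ} =
      f '' (Finset.univ.filter (deg E · = Δ) : Finset V) := by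
    rw [← hR.range]
    ext a
    constructor
    · rintro ⟨⟨v, rfl⟩, h⟩
      rw [hR.degree_eq] at h
      exact ⟨v, by simpa using h, rfl⟩
    · rintro ⟨v, hv, rfl⟩
      exact ⟨⟨v, rfl⟩, by rw [hR.degree_eq]; simpa using hv⟩
  rw [this, Set.ncard_image_of_injective _ hR.inj, Set.ncard_coe_finset]

/-- The edge closing a path between two of its vertices gives a cycle. -/
lemma exists_cycle {F : Finset (Finset V)} (hF : F ⊆ E) {x y : V}
    (hxy : (twoSection F).Reachable x y) (hne : x ≠ y) {e : Finset V} (he : e ∈ E) (heF : e ∉ F)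
    (hx : x ∈ e) (hy : y ∈ e) : ∃ (p : ℕ) (v : Fin (p + 1) → α) (e : Fin p → Set α),
      G.IsCycle v e := by
  obtain ⟨v, ed, h0, hp, hmem, hv, hed⟩ := exists_geodesic hxy
  generalize edist F x y = p at *
  have hp0 : 0 < p := by
    rcases Nat.eq_zero_or_pos p with rfl | h
    · exact absurd (h0.symm.trans hp) hne
    · exact h
  have hedge : ∀ i < p + 1, (if i < p then ed i else e) ∈ E := by
    intro i _
    split_ifs with h
    · exact hF (hmem i h).1
    · exact he
  refine ⟨p + 1, fun i => f (if i.val ≤ p then v i else x),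
    fun i => f '' ((if i.val < p then ed i else e : Finset V) : Set V),
    ⟨⟨fun i => hR.mem_vertexSet _, fun i => (hR.edge _).1 (hedge i i.isLt), fun i => ?_,
      fun i => ?_, fun i h => ?_⟩, by omega, ?_, fun i j hij => ?_, fun i j hij => ?_⟩⟩
  · refine Set.mem_image_of_mem f ?_
    simp only [Fin.val_castSucc, Finset.mem_coe]
    rw [if_pos (show i.val ≤ p by omega)]
    split_ifs with h
    · exact (hmem i h).2.1
    · rw [show i.val = p by omega, hp]
      exact hy
  · refine Set.mem_image_of_mem f ?_
    simp only [Fin.val_succ, Finset.mem_coe]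
    split_ifs with h h' h'
    · exact (hmem i h').2.2
    · omega
    · omega
    · exact hx
  · have h' := hR.inj h
    simp only [Fin.val_castSucc, Fin.val_succ] at h'
    rw [if_pos (by omega)] at h'
    split_ifs at h' with h2
    · exact hv _ _ (by omega) h2 h'
    · rw [show i.val = p by omega, hp] at h'
      exact hne h'.symm
  · simp [h0]
  · have h' := hR.inj hij
    simp only [Fin.val_castSucc] at h'
    rw [if_pos (by omega), if_pos (by omega)] at h'
    rcases lt_trichotomy i.val j.val with h | h | h
    · exact absurd h' (hv _ _ h (by omega))
    · exact Fin.ext h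
    · exact absurd h'.symm (hv _ _ h (by omega))
  · have h' := hR.image_injective hij
    split_ifs at h' with h1 h2 h2
    · rcases lt_trichotomy i.val j.val with h | h | h
      · exact absurd h' (hed _ _ h (by omega))
      · exact Fin.ext h
      · exact absurd h'.symm (hed _ _ h (by omega))
    · exact absurd (h' ▸ (hmem _ h1).1) heF
    · exact absurd (h' ▸ (hmem _ h2).1) heF
    · exact Fin.ext (by omega)

end Represents

lemma reachable_mono {F F' : Finset (Finset V)} (h : F ⊆ F') {x y : V}
    (hxy : (twoSection F).Reachable x y) : (twoSection F').Reachable x y := by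
  refine hxy.mono ?_
  rintro a b ⟨hne, e, he, h'⟩
  exact ⟨hne, e, h he, h'⟩

lemma reachable_of_mem {F : Finset (Finset V)} {e : Finset V} (he : e ∈ F) {x y : V} (hx : x ∈ e)
    (hy : y ∈ e) : (twoSection F).Reachable x y := by
  by_cases h : x = y
  · rw [h]
  · exact SimpleGraph.Adj.reachable ⟨h, e, he, hx, hy⟩

/-- An acyclic connected uniform family attains the bound of `card_le_of_connected`: a maximal
subfamily attaining it on its own vertices is the whole family. -/
lemma Represents.card_eq {α : Type*} {E : Finset (Finset V)} {G : Hypergraph α} {f : V → α}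
    (hR : Represents E G f) {k : ℕ} (hk : 2 ≤ k) (hE : (twoSection E).Connected)
    (hunif : ∀ e ∈ E, e.card = k)
    (hacyc : ∀ (p : ℕ) (v : Fin (p + 1) → α) (e : Fin p → Set α), ¬ G.IsCycle v e) :
    Fintype.card V = 1 + (k - 1) * E.card := by
  classical
  obtain ⟨r⟩ := hE.nonempty
  let P : Finset (Finset V) × Finset V → Prop := fun q => q.1 ⊆ E ∧ q.2.Nonempty ∧
    (∀ e ∈ q.1, e ⊆ q.2) ∧ (∀ x ∈ q.2, ∀ y ∈ q.2, (twoSection q.1).Reachable x y) ∧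
    q.2.card = 1 + (k - 1) * q.1.card
  obtain ⟨⟨F, S⟩, hFS, hmax⟩ := Finset.exists_max_image (Finset.univ.filter P)
    (fun q => q.1.card) ⟨(∅, {r}), by
      simp only [P, Finset.mem_filter, Finset.mem_univ, true_and]
      refine ⟨by simp, by simp, by simp, ?_, by simp⟩
      intro x hx y hy
      rw [Finset.mem_singleton] at hx hy
      rw [hx, hy]⟩
  simp only [P, Finset.mem_filter, Finset.mem_univ, true_and] at hFS hmax
  obtain ⟨hF, hS, hsub, hreach, hcard⟩ := hFS
  -- every edge meeting `S` belongs to `F`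
  have key : ∀ e ∈ E, ∀ x ∈ e, x ∈ S → e ∈ F := by
    intro e he x hx hxS
    by_contra heF
    have hone : e ∩ S = {x} := by
      ext y
      simp only [Finset.mem_inter, Finset.mem_singleton]
      constructor
      · rintro ⟨hy, hyS⟩
        by_contra hne
        obtain ⟨p, v, e', hc⟩ := hR.exists_cycle hF (hreach x hxS y hyS) (Ne.symm hne) he heF hx hy
        exact hacyc p v e' hc
      · rintro rfl
        exact ⟨hx, hxS⟩
    have h1 : (S ∪ e).card + 1 = S.card + k := by
      have := Finset.card_union_add_card_inter S e
      rw [Finset.inter_comm, hone, Finset.card_singleton, hunif e he] at this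
      exact this
    have hreach' : ∀ y ∈ S ∪ e, (twoSection (insert e F)).Reachable x y := by
      intro y hy
      rcases Finset.mem_union.1 hy with h | h
      · exact reachable_mono (Finset.subset_insert _ _) (hreach x hxS y h)
      · exact reachable_of_mem (Finset.mem_insert_self _ _) hx h
    have h2 := hmax (insert e F, S ∪ e) ⟨Finset.insert_subset he hF, hS.mono
      Finset.subset_union_left, ?_, fun y hy z hz => (hreach' y hy).symm.trans (hreach' z hz), ?_⟩
    · rw [Finset.card_insert_of_notMem heF] at h2
      omega
    · intro g hg
      rcases Finset.mem_insert.1 hg with rfl | h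
      · exact Finset.subset_union_right
      · exact (hsub g h).trans Finset.subset_union_left
    · rw [Finset.card_insert_of_notMem heF, mul_add, mul_one]
      dsimp only
      omega
  obtain ⟨s, hs⟩ := hS
  have huniv : ∀ z, z ∈ S := by
    intro z
    obtain ⟨p⟩ := hE.preconnected s z
    induction p with
    | nil => exact hs
    | cons h p ih =>
      obtain ⟨-, e, he, h1, h2⟩ := h
      exact ih (hsub e (key e he _ h1 hs) h2)
  have hFE : F = E := by
    refine Finset.Subset.antisymm hF fun e he => ?_
    obtain ⟨x, hx⟩ := Finset.card_pos.1 (by rw [hunif e he]; omega : 0 < e.card)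
    exact key e he x hx (huniv x)
  rw [← hFE, ← hcard, ← Finset.card_univ]
  congr 1
  ext z
  simp [huniv z]

namespace Represents

variable {α : Type*} {E : Finset (Finset V)} {G : Hypergraph α} {f : V → α}
  (hR : Represents E G f)
include hR

lemma inClass {k m Δ n : ℕ} (hk : 2 ≤ k) (hG : G.MemClass k m Δ n) : InClass k m Δ n E := by
  have hunif : ∀ e ∈ E, e.card = k := fun e he => by
    rw [← hR.ncard_edge]
    exact hG.isUniform _ ((hR.edge e).1 he)
  have hconn : (twoSection E).Connected := by
    have hne : Nonempty V := by
      obtain ⟨a, ha⟩ := hG.isHypertree.nonempty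
      rw [← hR.range] at ha
      obtain ⟨v, -⟩ := ha
      exact ⟨v⟩
    refine ⟨fun x y => ?_⟩
    obtain ⟨p, v, e, hpath, h0, hp⟩ := hG.isHypertree.connected _ (hR.mem_vertexSet x) _
      (hR.mem_vertexSet y)
    obtain ⟨w, s, hw, hs⟩ := hR.lift_walk hpath.toIsWalk
    have hx : w 0 = x := hR.inj (by rw [hw, h0])
    have hy : w (Fin.last p) = y := hR.inj (by rw [hw, hp])
    have key : ∀ i, (twoSection E).Reachable x (w i) := by
      intro i
      induction i using Fin.induction with
      | zero => rw [hx]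
      | succ i ih => exact ih.trans (reachable_of_mem (hs i).1 (hs i).2.2.1 (hs i).2.2.2)
    exact hy ▸ key (Fin.last p)
  refine ⟨⟨hk, hunif, hconn, hR.card_eq hk hconn hunif hG.isHypertree.acyclic⟩,
    hR.ncard_edgeSet.symm.trans hG.size, fun v => ?_, (hR.ncard_degree Δ).symm.trans
      hG.card_maxDegree⟩
  rw [← hR.degree_eq]
  exact hG.maxDegree.2 ⟨_, hR.mem_vertexSet v, rfl⟩

/-- A hypertree has no cycles: a vertex of a cycle farthest from another vertex of the cycle would
have two parent edges. -/
lemma acyclic {k : ℕ} (hT : IsTree k E) (p : ℕ) (v : Fin (p + 1) → α) (e : Fin p → Set α) :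
    ¬ G.IsCycle v e := by
  intro hc
  obtain ⟨w, s, hw, hs⟩ := hR.lift_walk hc.toIsWalk
  have hne : ∀ i : Fin p, w i.castSucc ≠ w i.succ := fun i h =>
    hc.ne i (by rw [← hw, ← hw, h])
  have hclosed : w 0 = w (Fin.last p) := hR.inj (by rw [hw, hw, hc.closed])
  obtain ⟨j, -, hj⟩ := Finset.exists_max_image Finset.univ (fun i => edist E (w 0) (w i))
    ⟨0, Finset.mem_univ _⟩
  have h2 := hc.two_le
  have hj' : w j ≠ w 0 := by
    intro h
    have h3 := hj (Fin.succ ⟨0, by omega⟩) (Finset.mem_univ _)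
    rw [h, (edist_eq_zero hT.conn).2 rfl] at h3
    exact hne ⟨0, by omega⟩ ((edist_eq_zero hT.conn).1 (Nat.le_zero.1 h3))
  -- both neighbouring edges contain a vertex closer to `w 0`
  have hclose : ∀ g ∈ E, w j ∈ g → ∀ l, w l ∈ g → w l ≠ w j →
      ∃ y ∈ g, edist E (w 0) y < edist E (w 0) (w j) := by
    intro g hg hjg l hl hlj
    obtain ⟨y, hy, hgate⟩ := hT.exists_gate (w 0) hg
    by_cases hyj : w j = y
    · have h4 := hgate (w l) hl (hyj ▸ hlj)
      have h5 := hj l (Finset.mem_univ _)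
      rw [← hyj] at h4
      omega
    · exact ⟨y, hy, by rw [hgate (w j) hjg hyj]; omega⟩
  have hj0 : j.val ≠ 0 := fun h => hj' (congrArg w (Fin.ext h))
  have hjp : j.val ≠ p := fun h => hj' (by
    rw [hclosed]
    exact congrArg w (Fin.ext h))
  have hjlt := j.isLt
  have e1 : j = Fin.succ (⟨j.val - 1, by omega⟩ : Fin p) := Fin.ext (by simp; omega)
  have e2 : j = Fin.castSucc (⟨j.val, by omega⟩ : Fin p) := Fin.ext (by simp)
  obtain ⟨a1, a2, a3, a4⟩ := hs ⟨j.val - 1, by omega⟩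
  obtain ⟨b1, b2, b3, b4⟩ := hs ⟨j.val, by omega⟩
  have a5 := hne ⟨j.val - 1, by omega⟩
  have b5 := hne ⟨j.val, by omega⟩
  rw [← e1] at a4 a5
  rw [← e2] at b3 b5
  have heq := hT.unique_parent hj' a1 b1 a4 b3 (hclose _ a1 a4 _ a3 a5)
    (hclose _ b1 b3 _ b4 b5.symm)
  have := hc.edge_inj (a2.symm.trans ((congrArg (fun t : Finset V => f '' (t : Set V)) heq).trans
    b2))
  simp only [Fin.mk.injEq] at this
  omega

lemma memClass {k m Δ n : ℕ} (hn : 1 ≤ n) (hE : InClass k m Δ n E) : G.MemClass k m Δ n := by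
  have hk := hE.tree.two_le
  have hunif : G.IsUniform k := by
    intro e he
    obtain ⟨s, hs, rfl⟩ := hR.exists_edge he
    rw [hR.ncard_edge]
    exact hE.tree.unif s hs
  obtain ⟨r⟩ := hE.tree.conn.nonempty
  refine ⟨hR.range ▸ Set.finite_range f, ⟨⟨f r, hR.mem_vertexSet r⟩, fun e he => ?_, ?_,
    hR.acyclic hE.tree⟩, hunif, hR.ncard_edgeSet.trans hE.card, ⟨?_, ?_⟩,
    (hR.ncard_degree Δ).trans hE.card_deg⟩
  · refine Set.nonempty_of_ncard_ne_zero ?_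
    rw [hunif e he]
    omega
  · intro x hx y hy
    rw [← hR.range] at hx hy
    obtain ⟨x, rfl⟩ := hx
    obtain ⟨y, rfl⟩ := hy
    exact ⟨_, hR.hasPath (hE.tree.conn.preconnected x y)⟩
  · obtain ⟨v, hv⟩ := Finset.card_pos.1 (hE.card_deg ▸ hn)
    exact ⟨f v, hR.mem_vertexSet v, by rw [hR.degree_eq]; simpa using hv⟩
  · rintro d ⟨a, ha, rfl⟩
    rw [← hR.range] at ha
    obtain ⟨v, rfl⟩ := ha
    rw [hR.degree_eq]
    exact hE.deg_le v

lemma isomorphic {β : Type*} {H : Hypergraph β} {g : V → β} (hR' : Represents E H g) :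
    G.Isomorphic H := by
  classical
  let φ : V ≃ G.vertexSet := (Equiv.ofInjective f hR.inj).trans (Equiv.setCongr hR.range)
  let ψ : V ≃ H.vertexSet := (Equiv.ofInjective g hR'.inj).trans (Equiv.setCongr hR'.range)
  refine ⟨φ.symm.trans ψ, fun s => ?_⟩
  obtain ⟨t, rfl⟩ : ∃ t : Finset V, φ '' (t : Set V) = s :=
    ⟨(φ ⁻¹' s).toFinset, by simp⟩
  have h1 : Subtype.val '' (φ '' (t : Set V)) = f '' (t : Set V) := by
    rw [Set.image_image]
    rfl
  have h2 : (φ.symm.trans ψ) '' (φ '' (t : Set V)) = ψ '' (t : Set V) := by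
    rw [Set.image_image]
    simp
  have h3 : Subtype.val '' (ψ '' (t : Set V)) = g '' (t : Set V) := by
    rw [Set.image_image]
    rfl
  rw [h1, h2, h3, ← hR.edge, ← hR'.edge]

lemma of_isomorphic {β : Type*} {H : Hypergraph β} (h : G.Isomorphic H) :
    ∃ g, Represents E H g := by
  obtain ⟨e, he⟩ := h
  let φ : V ≃ G.vertexSet := (Equiv.ofInjective f hR.inj).trans (Equiv.setCongr hR.range)
  refine ⟨fun v => e (φ v), fun v w hvw => ?_, ?_, fun s => ?_⟩
  · exact φ.injective (e.injective (Subtype.ext hvw))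
  · have : (fun v => (e (φ v) : β)) = Subtype.val ∘ (φ.trans e) := rfl
    rw [this, Set.range_comp, (φ.trans e).surjective.range_eq, Set.image_univ, Subtype.range_coe]
  · rw [hR.edge]
    have h1 : Subtype.val '' (φ '' (s : Set V)) = f '' (s : Set V) := by
      rw [Set.image_image]
      rfl
    rw [← h1, he, Set.image_image, Set.image_image]

end Represents

/-! ### The extremal hypertree -/

/-- Every maximizer is a copy of the caterpillar. -/
lemma IsMaximizer.exists_represents {V : Type*} [Fintype V] [DecidableEq V] [Nontrivial V]
    {k m Δ n : ℕ} {E : Finset (Finset V)} (hE : IsMaximizer k m Δ n E) (hΔ : 3 ≤ Δ)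
    (hn : 1 ≤ n) :
    ∃ f, Represents E (Hypergraph.caterpillar k (m - n * (Δ - 2)) Δ (n / 2) ((n + 1) / 2)) f := by
  obtain ⟨M, u, ed, hS, -, hstar⟩ := hE.exists_balanced_spine hΔ hn
  have hle : ∀ v, deg E v ≠ Δ → deg E v ≤ 2 := fun v hv => hE.deg_le_two hΔ hv
  have hM : m - n * (Δ - 2) = M := by
    have := hS.card_edges hE.mem hΔ hle
    omega
  rw [hM]
  exact hS.exists_represents hE.mem.tree hΔ hle hstar

lemma InClass.exists_isMaximizer {V : Type*} [Fintype V] [DecidableEq V] {k m Δ n : ℕ}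
    {E : Finset (Finset V)} (hE : InClass k m Δ n E) :
    ∃ E' : Finset (Finset V), IsMaximizer k m Δ n E' := by
  classical
  obtain ⟨E', h1, h2⟩ := Finset.exists_max_image
    (Finset.univ.filter fun F : Finset (Finset V) => InClass k m Δ n F) rho
    ⟨E, by simpa using hE⟩
  exact ⟨E', by simpa using h1, fun F hF => h2 F (by simpa using hF)⟩

lemma InClass.nontrivial {V : Type*} [Fintype V] [DecidableEq V] {k m Δ n : ℕ}
    {E : Finset (Finset V)} (hE : InClass k m Δ n E) (hn : 2 ≤ n) : Nontrivial V := by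
  rw [← Fintype.one_lt_card_iff_nontrivial, ← Finset.card_univ]
  have h1 := hE.card_deg
  have h2 := Finset.card_filter_le Finset.univ fun v => deg E v = Δ
  omega

end Hypertree

theorem mainTheorem1 (k m Δ n : ℕ) (hk : 2 ≤ k) (hΔ : 3 ≤ Δ) (hn : 2 ≤ n)
    {α : Type*} (T : Hypergraph α) [Finite T.vertexSet] (hT : T.MemClass k m Δ n) :
    (Hypergraph.caterpillar k (m - n * (Δ - 2)) Δ (n / 2) ((n + 1) / 2)).MemClass k m Δ n ∧
    T.distSpectralRadius ≤
      (Hypergraph.caterpillar k (m - n * (Δ - 2)) Δ (n / 2) ((n + 1) / 2)).distSpectralRadius ∧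
    (T.distSpectralRadius =
        (Hypergraph.caterpillar k (m - n * (Δ - 2)) Δ (n / 2) ((n + 1) / 2)).distSpectralRadius ↔
      T.Isomorphic (Hypergraph.caterpillar k (m - n * (Δ - 2)) Δ (n / 2) ((n + 1) / 2))) := by
  classical
  let _ : Fintype T.vertexSet := Fintype.ofFinite _
  let E : Finset (Finset T.vertexSet) :=
    Finset.univ.filter fun s => Subtype.val '' (s : Set T.vertexSet) ∈ T.edgeSet
  have hR : Hypertree.Represents E T Subtype.val :=
    ⟨Subtype.val_injective, Subtype.range_coe, fun s => by simp [E]⟩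
  have hE := hR.inClass hk hT
  have := hE.nontrivial hn
  obtain ⟨E', hE'⟩ := hE.exists_isMaximizer
  obtain ⟨f, hf⟩ := hE'.exists_represents hΔ (by omega)
  rw [hR.distSpectralRadius_eq hE.tree.conn, hf.distSpectralRadius_eq hE'.mem.tree.conn]
  refine ⟨hf.memClass (by omega) hE'.mem, hE'.le E hE, fun h => ?_, fun h => ?_⟩
  · have hmax : Hypertree.IsMaximizer k m Δ n E := ⟨hE, fun F hF => h ▸ hE'.le F hF⟩
    obtain ⟨g, hg⟩ := hmax.exists_represents hΔ (by omega)
    exact hR.isomorphic hg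
  · obtain ⟨g, hg⟩ := hR.of_isomorphic h
    rw [← hf.distSpectralRadius_eq hE'.mem.tree.conn, hg.distSpectralRadius_eq hE.tree.conn]
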